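/- Let $\eta(\tau)=e^{\pi i\tau/12}\prod_{n\ge1}(1-q^n)$, $q=e^{2\pi i\tau}$, be the Dedekind eta function. For $N\ge1$, a modular function on $X_0(N)$ is a meromorphic function on the upper half-plane that is invariant under $\Gamma_0(N)$ and meromorphic at all cusps. A Hauptmodul of $X_0(N)$ is a modular function $h$ on $X_0(N)$ such that every modular function on $X_0(N)$ is a rational function of $h$ (that is, $\mathbb C(X_0(N))=\mathbb C(h)$) and such that $h=q^{-1}+O(1)$ at the cusp $\infty$. (1) Let $N\ge1$ and let $r_\delta\in\mathbb Z$ for each positive divisor $\delta$ of $N$. The eta product $\prod_{\delta\mid N}\eta(\delta\tau)^{r_\delta}$ is a Hauptmodul of $X_0(N)$ with a simple zero at the cusp $0$ if and only if (a) $\sum_{\delta\mid N} r_\delta\,\delta=-24$, (b) $\sum_{\delta\mid N} r_\delta\,(N/\delta)=24$, (c) $\sum_{\delta\mid N} r_\delta=0$, (d) $\prod_{\delta\mid N}(N/\delta)^{r_\delta}\in(\mathbb Q^\times)^2$, and (e) $(N/d)\,\gcd(d,N/d)\sum_{\delta\mid N} r_\delta\,\gcd(\delta,d)^2/\delta=0$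 for every divisor $d$ of $N$ with $d\ne1,N$. (2) For each $N\in\{2,3,4,5,6,7,8,9,10,12,13,16,18,25\}$ the conditions (a), (b), (c), (e) have exactly one integer solution $(r_\delta)_{\delta\mid N}$; it also satisfies (d). Hence the corresponding eta product $h_N$ is a Hauptmodul of $X_0(N)$ with a simple zero at the cusp $0$. Explicitly, writing $\eta_\delta=\eta(\delta\tau)$: $$h_2=\frac{\eta_1^{24}}{\eta_2^{24}},\quad h_3=\frac{\eta_1^{12}}{\eta_3^{12}},\quad h_4=\frac{\eta_1^{8}}{\eta_4^{8}},\quad h_5=\frac{\eta_1^{6}}{\eta_5^{6}},\quad h_6=\frac{\eta_1^5\eta_3}{\eta_2\eta_6^5},\quad h_7=\frac{\eta_1^4}{\eta_7^4},\quad h_8=\frac{\eta_1^4\eta_4^2}{\eta_2^2\eta_8^4},$$ $$h_9=\frac{\eta_1^3}{\eta_9^3},\quad h_{10}=\frac{\eta_1^3\eta_5}{\eta_2\eta_{10}^3},\quad h_{12}=\frac{\eta_1^3\eta_4\eta_6^2}{\eta_2^2\eta_3\eta_{12}^3},\quad h_{13}=\frac{\eta_1^2}{\eta_{13}^2},\quad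 h_{16}=\frac{\eta_1^2\eta_8}{\eta_2\eta_{16}^2},\quad h_{18}=\frac{\eta_1^2\eta_6\eta_9}{\eta_2\eta_3\eta_{18}^2},\quad h_{25}=\frac{\eta_1}{\eta_{25}}.$$ -/

import Mathlib

open UpperHalfPlane Filter Polynomial
open scoped MatrixGroups

/-- `f ∘ γ` is given near `i∞` by the function `F` of the local parameter
`q_w = exp (2 π i τ / w)`; for `w` the width of the cusp `γ ∞`, `q_w` is the local coordinate at
that cusp. -/
def HasCuspExpansion (f : ℍ → ℂ) (γ : SL(2, ℤ)) (w : ℕ) (F : ℂ → ℂ) : Prop :=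
  ∀ᶠ τ : ℍ in atImInfty, f (γ • τ) = F (Function.Periodic.qParam (w : ℝ) (τ : ℂ))

/-- A modular function on `X₀(N)`, that is, an element of the function field `ℂ(X₀(N))`, given by a
representative `f : ℍ → ℂ`: it is meromorphic on `ℍ`, invariant under `Γ₀(N)` (as a meromorphic
function, i.e. off a closed discrete set; the values at poles are irrelevant), and meromorphic at
every cusp `γ ∞`. All cusp widths divide `N`, so that `q_N = exp (2 π i τ / N)` may be used as a
parameter at each of them. -/
structure IsModularFunction (N : ℕ) (f : ℍ → ℂ) : Prop where
  meromorphic : MeromorphicOn (f ∘ UpperHalfPlane.ofComplex) upperHalfPlaneSet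
  invariant : ∀ γ ∈ CongruenceSubgroup.Gamma0 N,
    (fun τ : ℍ => f (γ • τ)) =ᶠ[codiscrete ℍ] f
  meromorphic_cusps : ∀ γ : SL(2, ℤ), ∃ F : ℂ → ℂ,
    MeromorphicAt F 0 ∧ HasCuspExpansion f γ N F

/-- A Hauptmodul of `X₀(N)`: a modular function `h` with `ℂ(X₀(N)) = ℂ(h)`, i.e. every modular
function is a rational function of `h`, and with `q`-expansion `1/q + O(1)`. -/
structure IsHauptmodul (N : ℕ) (h : ℍ → ℂ) : Prop where
  modular : IsModularFunction N h
  generates : ∀ g : ℍ → ℂ, IsModularFunction N g →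
    ∃ P Q : ℂ[X], Q ≠ 0 ∧
      g =ᶠ[codiscrete ℍ] fun τ : ℍ => P.eval (h τ) / Q.eval (h τ)
  qExpansion : IsBoundedAtImInfty
    (fun τ : ℍ => h τ - (Function.Periodic.qParam 1 (τ : ℂ))⁻¹)

/-- `f` has a simple zero at the cusp `0 = S ∞` of `X₀(N)`, a cusp of width `N`. -/
def HasSimpleZeroAtCuspZero (N : ℕ) (f : ℍ → ℂ) : Prop :=
  ∃ F : ℂ → ℂ, MeromorphicAt F 0 ∧ meromorphicOrderAt F 0 = 1 ∧
    HasCuspExpansion f ModularGroup.S N F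

/-- The eta product `∏_{δ ∣ N} η(δ τ) ^ r_δ`. -/
noncomputable def etaProduct (N : ℕ) (r : ℕ → ℤ) (τ : ℍ) : ℂ :=
  ∏ δ ∈ N.divisors, ModularForm.eta ((δ : ℂ) * (τ : ℂ)) ^ r δ

/-- The linear conditions on the exponents. They express order `-1` at the cusp `∞`, order `1` at
the cusp `0`, weight `0`, and order `0` at the cusps of denominator `d ≠ 1, N`. -/
structure LinearConditions (N : ℕ) (r : ℕ → ℤ) : Prop where
  order_infty : ∑ δ ∈ N.divisors, r δ * (δ : ℤ) = -24
  order_zero : ∑ δ ∈ N.divisors, r δ * ((N / δ : ℕ) : ℤ) = 24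
  weight : ∑ δ ∈ N.divisors, r δ = 0
  order_other : ∀ d ∈ N.divisors, d ≠ 1 → d ≠ N →
    ((N / d : ℕ) : ℚ) * (Nat.gcd d (N / d) : ℚ) *
      ∑ δ ∈ N.divisors, (r δ : ℚ) * (Nat.gcd δ d : ℚ) ^ 2 / (δ : ℚ) = 0

/-- The product `∏_{δ ∣ N} (N / δ) ^ r_δ` is the square of a nonzero rational number. -/
def SquareCondition (N : ℕ) (r : ℕ → ℤ) : Prop :=
  ∃ x : ℚ, x ≠ 0 ∧ ∏ δ ∈ N.divisors, ((N / δ : ℕ) : ℚ) ^ r δ = x ^ 2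

/-- The levels `N > 1` for which `X₀(N)` has genus `0`. -/
def tableLevels : Finset ℕ := {2, 3, 4, 5, 6, 7, 8, 9, 10, 12, 13, 16, 18, 25}

/-- `tableExponent N δ` is the exponent of `η(δ τ)` in the eta product `h_N`, for `N` in
`tableLevels`. -/
def tableExponent : ℕ → ℕ → ℤ
  | 2, 1 => 24 | 2, 2 => -24
  | 3, 1 => 12 | 3, 3 => -12
  | 4, 1 => 8 | 4, 4 => -8
  | 5, 1 => 6 | 5, 5 => -6
  | 6, 1 => 5 | 6, 2 => -1 | 6, 3 => 1 | 6, 6 => -5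
  | 7, 1 => 4 | 7, 7 => -4
  | 8, 1 => 4 | 8, 2 => -2 | 8, 4 => 2 | 8, 8 => -4
  | 9, 1 => 3 | 9, 9 => -3
  | 10, 1 => 3 | 10, 2 => -1 | 10, 5 => 1 | 10, 10 => -3
  | 12, 1 => 3 | 12, 2 => -2 | 12, 3 => -1 | 12, 4 => 1 | 12, 6 => 2 | 12, 12 => -3
  | 13, 1 => 2 | 13, 13 => -2
  | 16, 1 => 2 | 16, 2 => -1 | 16, 8 => 1 | 16, 16 => -2
  | 18, 1 => 2 | 18, 2 => -1 | 18, 3 => -1 | 18, 6 => 1 | 18, 9 => 1 | 18, 18 => -2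
  | 25, 1 => 1 | 25, 25 => -1
  | _, _ => 0

/-! The linear conditions say that the eta product has divisor (0) - (∞): since `η` has no zero on
`ℍ`, all zeros and poles sit at cusps, and the order at a cusp depends only on the gcd of its
denominator with `N`. The square condition is what remains of invariance under `Γ₀(N)`.

Invariance. `etaTransforms` gives the multiplier of `η` for lower right entry `d` odd and positive:
a Jacobi symbol times an explicit 24th root of unity. In a product satisfying (a), (b), (c) the
roots of unity cancel and `etaProduct_eq_jacobiSym_mul` leaves the symbol modulo `d` of the integer
`absProduct`. It is trivial for all such `d` exactly when this integer is a square
(`isSquare_of_forall_jacobiSym`), which is the square condition.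

Orders. `‖η‖ ^ 24 = ‖Δ‖`, so the modularity of `Δ` alone gives the growth of an eta product at every
cusp, without any multiplier (`tendsto_norm_etaProduct_smul`).

Sufficiency. The product `h` is invariant and holomorphic on `ℍ`, and its only pole is simple, at
`∞`. Given a modular function `g`, a polynomial in `h` removes the poles of `g` away from `∞`; the
result is a polynomial in `h`, by subtracting powers of `h` until a bounded, hence constant,
function is left (`IsModularFunction.exists_eq_div`).

Necessity. Growth at `∞` and `0` gives (a), (b), (c), and invariance gives (d). For (e), a generator
cannot have zeros, or poles, at two cusps that some modular function distinguishes: a rational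
function of `h` has order zero at both or at neither. Quotients of `Δ(τ)`, `Δ(dτ)`, `Δ(Nτ)`
distinguish the cusp of denominator `d` from `∞` and from `0` (`etaOrder_eq_zero_of_generates`). -/

/-! ### Principal square roots -/

open scoped Real in
lemma Complex.sqrt_sq' (z : ℂ) : Complex.sqrt z ^ 2 = z := by
  rcases eq_or_ne z 0 with rfl | hz
  · simp [Complex.sqrt]
  · rw [sqrt_eq_exp hz, ← Complex.exp_nat_mul]
    rw [show ((2 : ℕ) : ℂ) * (Complex.log z / 2) = Complex.log z by push_cast; ring,
      Complex.exp_log hz]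

lemma Complex.re_sqrt_pos {z : ℂ} (hz : z ∈ Complex.slitPlane) : 0 < (Complex.sqrt z).re := by
  rw [sqrt_eq_exp (Complex.slitPlane_ne_zero hz), Complex.exp_re]
  refine mul_pos (Real.exp_pos _) (Real.cos_pos_of_mem_Ioo ?_)
  have h1 := Complex.neg_pi_lt_arg z
  have h2 := lt_of_le_of_ne (Complex.arg_le_pi z) (Complex.mem_slitPlane_iff_arg.mp hz).1
  simp only [Complex.div_ofNat_im, Complex.log_im]
  constructor <;> linarith

lemma Complex.im_eq_two_mul_sqrt (z : ℂ) :
    z.im = 2 * (Complex.sqrt z).re * (Complex.sqrt z).im := by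
  conv_lhs => rw [← Complex.sqrt_sq' z]
  rw [sq, Complex.mul_im]
  ring

/-- Two complex numbers with positive real part and the same square agree. -/
lemma Complex.eq_of_sq_eq_of_re_pos {x y : ℂ} (hx : 0 < x.re) (hy : 0 < y.re)
    (h : x ^ 2 = y ^ 2) : x = y := by
  rcases sq_eq_sq_iff_eq_or_eq_neg.mp h with h | h
  · exact h
  · rw [h, Complex.neg_re] at hx
    linarith

lemma mem_slitPlane_mul_add {z : ℂ} (hz : 0 < z.im) (s : ℝ) {d : ℝ} (hd : 0 < d) :
    (s : ℂ) * z + d ∈ Complex.slitPlane := by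
  rw [Complex.mem_slitPlane_iff]
  rcases eq_or_ne s 0 with rfl | hs
  · left; simpa using hd
  · right; simp [hs, hz.ne']

/-- With `A = a₁ + a₂ i` and `B = b₁ + b₂ i` the roots of `p = s z + d` and `q = t z + e`, the claim
is `Re (A * conj B) > 0`. Only `a₂`, `b₂` of opposite signs need an argument. Then `s`, `t` have
these signs, so `Im (p * conj q)` and `Im (A * conj B)` have the same sign, while the first is `2 Re
(A * conj B) * Im (A * conj B)`. -/
lemma add_mul_pos_of_cross {a₁ a₂ b₁ b₂ s t d e y : ℝ} (hy : 0 < y) (hd : 0 < d) (he : 0 < e)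
    (ha : 0 < a₁) (hb : 0 < b₁) (hs : s * y = 2 * a₁ * a₂) (ht : t * y = 2 * b₁ * b₂)
    (h : (s * e - d * t) * y = 2 * (a₁ * b₁ + a₂ * b₂) * (a₂ * b₁ - a₁ * b₂)) :
    0 < a₁ * b₁ + a₂ * b₂ := by
  rcases le_or_gt 0 (a₂ * b₂) with h0 | h0
  · have := mul_pos ha hb
    linarith
  have sgn : ∀ {u v w : ℝ}, 0 < v → u * y = 2 * v * w → 0 < w → 0 < u := by
    intro u v w hv huv hw
    have : 0 < u * y := by rw [huv]; positivity
    exact pos_of_mul_pos_left this hy.le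
  have pos : ∀ {u v : ℝ}, 0 < u * v → 0 < v → 0 < u := fun h h' => pos_of_mul_pos_left h h'.le
  rcases mul_neg_iff.mp h0 with ⟨h1, h2⟩ | ⟨h1, h2⟩
  · have hs' : 0 < s := sgn ha hs h1
    have ht' : 0 < -t := sgn hb (w := -b₂) (by linarith) (by linarith)
    have h3 : 0 < a₂ * b₁ - a₁ * b₂ := by
      have := mul_pos h1 hb
      have := mul_pos ha (neg_pos.mpr h2)
      linarith
    have h4 : 0 < (s * e - d * t) * y := by
      refine mul_pos ?_ hy
      have := mul_pos hs' he
      have := mul_pos hd ht'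
      linarith
    rw [h] at h4
    have := pos h4 h3
    linarith
  · have hs' : 0 < -s := sgn ha (w := -a₂) (by linarith) (by linarith)
    have ht' : 0 < t := sgn hb ht h2
    have h3 : 0 < a₁ * b₂ - a₂ * b₁ := by
      have := mul_pos (neg_pos.mpr h1) hb
      have := mul_pos ha h2
      linarith
    have h4 : 0 < (d * t - s * e) * y := by
      refine mul_pos ?_ hy
      have := mul_pos hs' he
      have := mul_pos hd ht'
      linarith
    have h5 : (d * t - s * e) * y = 2 * (a₁ * b₁ + a₂ * b₂) * (a₁ * b₂ - a₂ * b₁) := by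
      linarith
    rw [h5] at h4
    have := pos h4 h3
    linarith

/-- The principal square root is multiplicative on quotients of points of
`ℝ z + ℝ_{> 0}`. -/
lemma Complex.sqrt_div_mul_sqrt {z : ℂ} (hz : 0 < z.im) (s t : ℝ) {d e : ℝ} (hd : 0 < d)
    (he : 0 < e) :
    Complex.sqrt (((s : ℂ) * z + d) / ((t : ℂ) * z + e)) * Complex.sqrt ((t : ℂ) * z + e) =
      Complex.sqrt ((s : ℂ) * z + d) := by
  set p := (s : ℂ) * z + d with hp
  set q := (t : ℂ) * z + e with hq
  have hps : p ∈ Complex.slitPlane := mem_slitPlane_mul_add hz s hd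
  have hqs : q ∈ Complex.slitPlane := mem_slitPlane_mul_add hz t he
  have hq0 := Complex.slitPlane_ne_zero hqs
  have hp0 := Complex.slitPlane_ne_zero hps
  have ha := Complex.re_sqrt_pos hps
  have hb := Complex.re_sqrt_pos hqs
  have hpi : p.im = s * z.im := by simp [hp]
  have hqi : q.im = t * z.im := by simp [hq]
  have hpi' := Complex.im_eq_two_mul_sqrt p
  have hqi' := Complex.im_eq_two_mul_sqrt q
  set A := Complex.sqrt p
  set B := Complex.sqrt q
  have hA2 : A ^ 2 = p := Complex.sqrt_sq' p
  have hB2 : B ^ 2 = q := Complex.sqrt_sq' q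
  have hB0 : B ≠ 0 := fun h => hq0 (by rw [← hB2, h]; simp)
  -- The real part of `A * conj B` is positive.
  have key : 0 < A.re * B.re + A.im * B.im := by
    have hA2r : p.re = A.re ^ 2 - A.im ^ 2 := by rw [← hA2, sq, Complex.mul_re]; ring
    have hB2r : q.re = B.re ^ 2 - B.im ^ 2 := by rw [← hB2, sq, Complex.mul_re]; ring
    have hpr : p.re = s * z.re + d := by simp [hp]
    have hqr : q.re = t * z.re + e := by simp [hq]
    have hcross : p.im * q.re - p.re * q.im =
        2 * (A.re * B.re + A.im * B.im) * (A.im * B.re - A.re * B.im) := by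
      rw [hA2r, hB2r, hpi', hqi']; ring
    have hcross' : p.im * q.re - p.re * q.im = (s * e - d * t) * z.im := by
      rw [hpi, hqi, hpr, hqr]; ring
    exact add_mul_pos_of_cross hz hd he ha hb (hpi ▸ hpi') (hqi ▸ hqi') (hcross' ▸ hcross)
  have hdiv : 0 < (A / B).re := by
    rw [Complex.div_re, ← add_div]
    exact div_pos key (Complex.normSq_pos.mpr hB0)
  have hABsq : (A / B) ^ 2 = p / q := by rw [div_pow, hA2, hB2]
  have hslit : p / q ∈ Complex.slitPlane := by
    rw [← hABsq, Complex.mem_slitPlane_iff]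
    by_cases him : (A / B).im = 0
    · left
      rw [sq, Complex.mul_re, him]
      have := mul_pos hdiv hdiv
      linarith
    · right
      rw [sq, Complex.mul_im]
      have : (A / B).re * (A / B).im ≠ 0 := mul_ne_zero hdiv.ne' him
      intro h
      apply this
      linarith
  have : Complex.sqrt (p / q) = A / B :=
    Complex.eq_of_sq_eq_of_re_pos (Complex.re_sqrt_pos hslit) hdiv
      (by rw [Complex.sqrt_sq', hABsq])
  rw [this, div_mul_cancel₀ _ hB0]

/-! ### Roots of unity, and `η` under upper and lower unipotent matrices -/

/-- The root of unity `exp (2 π i n / 24)`. -/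
noncomputable def zeta24 (n : ℤ) : ℂ := Complex.exp (2 * Real.pi * Complex.I * n / 24)

lemma zeta24_add (m n : ℤ) : zeta24 (m + n) = zeta24 m * zeta24 n := by
  rw [zeta24, zeta24, zeta24, ← Complex.exp_add]
  congr 1; push_cast; ring

lemma zeta24_zero : zeta24 0 = 1 := by simp [zeta24]

lemma zeta24_ne_zero (n : ℤ) : zeta24 n ≠ 0 := Complex.exp_ne_zero _

lemma zeta24_zpow (m n : ℤ) : zeta24 m ^ n = zeta24 (m * n) := by
  rw [zeta24, zeta24, ← Complex.exp_int_mul]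
  congr 1; push_cast; ring

lemma zeta24_twentyfour_mul (n : ℤ) : zeta24 (24 * n) = 1 := by
  rw [zeta24, Complex.exp_eq_one_iff]
  exact ⟨n, by push_cast; ring⟩

lemma zeta24_eq_one_of_dvd {n : ℤ} (h : 24 ∣ n) : zeta24 n = 1 := by
  obtain ⟨k, rfl⟩ := h
  exact zeta24_twentyfour_mul k

lemma zeta24_congr {m n : ℤ} (h : 24 ∣ m - n) : zeta24 m = zeta24 n := by
  rw [← sub_add_cancel m n, zeta24_add, zeta24_eq_one_of_dvd h, one_mul]

lemma zeta24_twelve_mul (n : ℕ) : zeta24 (12 * n) = (-1) ^ n := by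
  rw [zeta24, ← Complex.exp_pi_mul_I, ← Complex.exp_nat_mul]
  congr 1; push_cast; ring

lemma zeta24_prod {ι : Type*} (s : Finset ι) (f : ι → ℤ) :
    ∏ i ∈ s, zeta24 (f i) = zeta24 (∑ i ∈ s, f i) := by
  classical
  induction s using Finset.induction_on with
  | empty => simp [zeta24_zero]
  | insert a s ha ih => rw [Finset.prod_insert ha, Finset.sum_insert ha, zeta24_add, ih]

namespace ModularForm

lemma eta_add_one (z : ℂ) : eta (z + 1) = zeta24 1 * eta z := by
  have h1 : Function.Periodic.qParam 24 (z + 1) = zeta24 1 * Function.Periodic.qParam 24 z := by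
    simp only [Function.Periodic.qParam, zeta24]
    rw [← Complex.exp_add]; congr 1; push_cast; ring
  have h2 : ∀ n, eta_q n (z + 1) = eta_q n z := by
    intro n
    rw [eta_q_eq_pow, eta_q_eq_pow, mul_add, Complex.exp_add]
    simp
  simp only [eta, h1, h2, mul_assoc]

lemma eta_add_int (z : ℂ) (n : ℤ) : eta (z + n) = zeta24 n * eta z := by
  induction n using Int.induction_on with
  | zero => simp [zeta24_zero]
  | succ k ih =>
    rw [show z + ((k + 1 : ℤ) : ℂ) = z + (k : ℤ) + 1 by push_cast; ring, eta_add_one, ih,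
      zeta24_add]
    ring
  | pred k ih =>
    have h := eta_add_one (z + ((-k - 1 : ℤ) : ℂ))
    rw [show z + ((-k - 1 : ℤ) : ℂ) + 1 = z + (-(k : ℤ) : ℤ) by push_cast; ring, ih] at h
    have h2 : zeta24 (-(k : ℤ)) = zeta24 1 * zeta24 (-(k : ℤ) - 1) := by
      rw [← zeta24_add]; congr 1; ring
    rw [h2, mul_assoc] at h
    exact (mul_left_cancel₀ (zeta24_ne_zero 1) h).symm

/-- `z / (z + 1) = -1 / w` with `w = -1 / z - 1`: an inversion, a translation by `-1` and another
inversion. -/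
lemma eta_div_add_one {z : ℂ} (hz : 0 < z.im) :
    eta (z / (z + 1)) = zeta24 (-1) * Complex.sqrt (z + 1) * eta z := by
  have hz0 : z ≠ 0 := by rintro rfl; simp at hz
  have hz1 : z + 1 ≠ 0 := by
    intro h
    have := congrArg Complex.im h
    simp at this; linarith
  set w : ℂ := -1 / z - 1 with hw
  have hzi : 0 < (-1 / z : ℂ).im := by
    rw [neg_div, one_div, Complex.neg_im, Complex.inv_im, neg_div, neg_neg]
    exact div_pos hz (Complex.normSq_pos.mpr hz0)
  have hwim : 0 < w.im := by simpa [hw] using hzi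
  have hwz : w * z = -(z + 1) := by rw [hw]; field_simp; ring
  have h1 : z / (z + 1) = -1 / w := by
    have : w ≠ 0 := by rintro h; rw [h] at hwim; simp at hwim
    rw [div_eq_div_iff hz1 this, mul_comm z w, hwz]; ring
  have hS := fun {u : ℂ} (hu : 0 < u.im) => eta_comp_eq_csqrt_I_inv hu
  simp only [Function.comp_apply, Pi.smul_apply, Pi.mul_apply, smul_eq_mul] at hS
  have h2 : eta w = zeta24 (-1) * eta (-1 / z) := by
    rw [← eta_add_int]; congr 1; rw [hw]; push_cast; ring
  have hpos : ∀ {u : ℂ}, 0 < u.im → u ∈ Complex.slitPlane := fun h =>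
    Complex.mem_slitPlane_iff.mpr (Or.inr h.ne')
  -- Both sides have square `w z = -(z + 1)`, up to regrouping. The sign is settled by the imaginary
  -- parts: principal roots of points of `ℍ` lie in the open first quadrant.
  have h3 : Complex.sqrt w * Complex.sqrt z = Complex.I * Complex.sqrt (z + 1) := by
    have e1 : 0 < (Complex.sqrt w * Complex.sqrt z).im := by
      have a1 := Complex.re_sqrt_pos (hpos hwim)
      have a2 := Complex.re_sqrt_pos (hpos hz)
      have b1 := Complex.im_eq_two_mul_sqrt w
      have b2 := Complex.im_eq_two_mul_sqrt z
      rw [b1] at hwim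
      rw [b2] at hz
      have c1 := pos_of_mul_pos_right hwim (by positivity)
      have c2 := pos_of_mul_pos_right hz (by positivity)
      rw [Complex.mul_im]
      positivity
    have e2 : 0 < (Complex.I * Complex.sqrt (z + 1)).im := by
      have := Complex.re_sqrt_pos (z := z + 1) (hpos (by simpa using hz))
      simpa using this
    have e3 : (Complex.sqrt w * Complex.sqrt z) ^ 2 = (Complex.I * Complex.sqrt (z + 1)) ^ 2 := by
      rw [mul_pow, mul_pow, Complex.sqrt_sq', Complex.sqrt_sq', Complex.sqrt_sq', Complex.I_sq, hwz]
      ring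
    rcases sq_eq_sq_iff_eq_or_eq_neg.mp e3 with h | h
    · exact h
    · rw [h, Complex.neg_im] at e1; linarith
  have hI : Complex.sqrt Complex.I ^ 2 = Complex.I := Complex.sqrt_sq' _
  have hI0 : Complex.sqrt Complex.I ≠ 0 := fun h => by
    rw [h] at hI; simp at hI; exact Complex.I_ne_zero hI.symm
  rw [h1, hS hwim, h2, hS hz]
  have : (Complex.sqrt Complex.I)⁻¹ * (Complex.sqrt w *
      (zeta24 (-1) * ((Complex.sqrt Complex.I)⁻¹ * (Complex.sqrt z * eta z)))) =
      (Complex.sqrt Complex.I ^ 2)⁻¹ * (Complex.sqrt w * Complex.sqrt z) * zeta24 (-1) * eta z := by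
    ring
  rw [this, h3, hI, ← mul_assoc, inv_mul_cancel₀ Complex.I_ne_zero]
  ring

lemma im_div_mul_add_one_pos {z : ℂ} (hz : 0 < z.im) (k : ℝ) : 0 < (z / (k * z + 1)).im := by
  have h0 : (k : ℂ) * z + 1 ≠ 0 := by
    simpa using Complex.slitPlane_ne_zero (mem_slitPlane_mul_add hz k one_pos)
  rw [Complex.div_im, ← sub_div]
  refine div_pos ?_ (Complex.normSq_pos.mpr h0)
  simp
  nlinarith

/-- Induction on `k` in both directions, by `eta_div_add_one` at the point `z / (k z + 1)`. The
principal roots compose without a sign by `Complex.sqrt_div_mul_sqrt`. -/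
lemma eta_div_int_mul_add_one {z : ℂ} (hz : 0 < z.im) (k : ℤ) :
    eta (z / (k * z + 1)) = zeta24 (-k) * Complex.sqrt (k * z + 1) * eta z := by
  have step : ∀ (k : ℤ) {z : ℂ}, 0 < z.im → z / ((k + 1 : ℤ) * z + 1) =
      (z / (k * z + 1)) / (z / (k * z + 1) + 1) := by
    intro k z hz
    have h0 : (k : ℂ) * z + 1 ≠ 0 := by
      simpa using Complex.slitPlane_ne_zero (mem_slitPlane_mul_add hz k one_pos)
    have h1 : ((k + 1 : ℤ) : ℂ) * z + 1 ≠ 0 := by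
      simpa using Complex.slitPlane_ne_zero (mem_slitPlane_mul_add hz (k + 1 : ℤ) one_pos)
    have h2 : z / (k * z + 1) + 1 = (((k + 1 : ℤ) : ℂ) * z + 1) / (k * z + 1) := by
      rw [div_add_one h0]; push_cast; ring
    rw [h2, div_div_div_cancel_right₀ h0]
  have hsq : ∀ (k : ℤ) {z : ℂ}, 0 < z.im → Complex.sqrt (z / (k * z + 1) + 1) *
      Complex.sqrt (k * z + 1) = Complex.sqrt ((k + 1 : ℤ) * z + 1) := by
    intro k z hz
    have h0 : (k : ℂ) * z + 1 ≠ 0 := by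
      simpa using Complex.slitPlane_ne_zero (mem_slitPlane_mul_add hz k one_pos)
    have := Complex.sqrt_div_mul_sqrt hz ((k + 1 : ℤ) : ℝ) (k : ℝ) one_pos one_pos
    simp only [Complex.ofReal_intCast, Complex.ofReal_one] at this
    rw [← this]
    congr 2
    rw [div_add_one h0]; push_cast; ring
  have hstep : ∀ k : ℤ, eta (z / ((k + 1 : ℤ) * z + 1)) * Complex.sqrt (k * z + 1) =
      zeta24 (-1) * Complex.sqrt ((k + 1 : ℤ) * z + 1) * eta (z / (k * z + 1)) := by
    intro k
    have := im_div_mul_add_one_pos hz k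
    rw [step k hz, eta_div_add_one (by simpa using this), ← hsq k hz]
    ring
  have hne : ∀ k : ℤ, Complex.sqrt ((k : ℂ) * z + 1) ≠ 0 := by
    intro k h
    have := Complex.re_sqrt_pos (mem_slitPlane_mul_add hz k one_pos)
    simp [h] at this
  induction k using Int.induction_on with
  | zero => simp [zeta24_zero, Complex.sqrt]
  | succ k ih =>
    have := hstep k
    rw [ih] at this
    apply mul_right_cancel₀ (hne k)
    rw [this, neg_add, zeta24_add]
    ring
  | pred k ih =>
    have := hstep (-k - 1)
    rw [show (-(k : ℤ) - 1 + 1) = -(k : ℤ) by ring, ih] at this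
    have h2 : zeta24 (-(-(k : ℤ))) * zeta24 1 = zeta24 (-(-(k : ℤ) - 1)) := by
      rw [← zeta24_add]; congr 1; ring
    have h3 : zeta24 1 * zeta24 (-1) = 1 := by rw [← zeta24_add]; exact zeta24_zero
    apply mul_left_cancel₀ (mul_ne_zero (zeta24_ne_zero (-1)) (hne (-k)))
    rw [← this, ← h2]
    linear_combination (-zeta24 (-(-(k : ℤ))) * Complex.sqrt ((-k : ℤ) * z + 1) * eta z *
      Complex.sqrt ((-k - 1 : ℤ) * z + 1)) * h3

end ModularForm

/-! ### Congruences for the multiplier exponent and the Jacobi symbol -/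

/-- The exponent of `exp (2 π i / 24)` in the multiplier of `η` on a matrix `(a b; c d)` with
`d` odd and positive. -/
def etaExponent (a b c d : ℤ) : ℤ :=
  (a + d) * c - b * d * (c ^ 2 - 1) + 3 * d - 3 - 3 * c * d

lemma twentyfour_dvd_of_zmod {n : ℤ} (h3 : (n : ZMod 3) = 0) (h8 : (n : ZMod 8) = 0) : 24 ∣ n := by
  rw [ZMod.intCast_zmod_eq_zero_iff_dvd] at h3 h8
  norm_num at h3 h8
  omega

/-- Effect of right multiplication by `(1 0; k 1)`. Modulo 3 this is a finite check; modulo 8, `d ^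
2 = 1` reduces the difference to `k (a d - b c - 1)`. -/
lemma etaExponent_mul_lower {a b c d : ℤ} (k : ℤ) (hd : Odd d) (h : a * d - b * c = 1) :
    24 ∣ etaExponent (a + b * k) b (c + d * k) d - (etaExponent a b c d - k) := by
  have e : etaExponent (a + b * k) b (c + d * k) d - (etaExponent a b c d - k) =
      k * (a * d + b * c + d ^ 2 - 2 * b * c * d ^ 2 - 3 * d ^ 2 + 1)
        + k ^ 2 * b * d * (1 - d ^ 2) := by
    simp only [etaExponent]; ring
  rw [e]
  apply twentyfour_dvd_of_zmod
  · have h' : (a : ZMod 3) * d - b * c = 1 := by exact_mod_cast congrArg (Int.cast : ℤ → ZMod 3) h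
    push_cast
    generalize (a : ZMod 3) = a at *
    generalize (b : ZMod 3) = b at *
    generalize (c : ZMod 3) = c at *
    generalize (d : ZMod 3) = d at *
    generalize (k : ZMod 3) = k at *
    revert a b c d k
    decide
  · have h' : (a : ZMod 8) * d - b * c = 1 := by exact_mod_cast congrArg (Int.cast : ℤ → ZMod 8) h
    have hd2 : (d : ZMod 8) ^ 2 = 1 := by
      obtain ⟨m, rfl⟩ := hd
      push_cast
      generalize (m : ZMod 8) = m
      revert m; decide
    push_cast
    rw [hd2]
    linear_combination (k : ZMod 8) * h'

/-- Right multiplication by `T⁻¹`, for `c = 2k`, so that the lower right entry stays odd. The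
summand `12 * n` stands for the sign `(-1) ^ n` by which the Jacobi symbol changes, see
`jacobiSym_even_sub`. -/
lemma etaExponent_mul_T_neg {a b k m : ℤ} (h : a * (2 * m + 1) - b * (2 * k) = 1) :
    24 ∣ etaExponent a (b - a) (2 * k) (2 * m + 1 - 2 * k) + 1 -
      (etaExponent a b (2 * k) (2 * m + 1) + 12 * (m * (m - k) + m)) := by
  have hao : Odd a := by
    have : Odd (a * (2 * m + 1)) := ⟨b * k, by linarith⟩
    exact (Int.odd_mul.mp this).1
  obtain ⟨l, rfl⟩ := hao
  simp only [etaExponent]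
  apply twentyfour_dvd_of_zmod
  · have h' : (2 * l + 1 : ZMod 3) * (2 * m + 1) - b * (2 * k) = 1 := by
      exact_mod_cast congrArg (Int.cast : ℤ → ZMod 3) h
    push_cast
    generalize (l : ZMod 3) = l at *
    generalize (b : ZMod 3) = b at *
    generalize (k : ZMod 3) = k at *
    generalize (m : ZMod 3) = m at *
    clear h
    revert l b k m
    decide
  · have h' : (2 * l + 1 : ZMod 8) * (2 * m + 1) - b * (2 * k) = 1 := by
      exact_mod_cast congrArg (Int.cast : ℤ → ZMod 8) h
    push_cast
    generalize (l : ZMod 8) = l at *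
    generalize (b : ZMod 8) = b at *
    generalize (k : ZMod 8) = k at *
    generalize (m : ZMod 8) = m at *
    clear h
    revert l b k m
    decide

lemma etaExponent_mul_T {a b k m : ℤ} (h : a * (2 * m + 1) - b * (-(2 * k)) = 1) :
    24 ∣ etaExponent a (b + a) (-(2 * k)) (2 * m + 1 - 2 * k) - 1 -
      (etaExponent a b (-(2 * k)) (2 * m + 1) + 12 * (m * (m - k) + (m - k))) := by
  have hao : Odd a := by
    have : Odd (a * (2 * m + 1)) := ⟨-(b * k), by linarith⟩
    exact (Int.odd_mul.mp this).1
  obtain ⟨l, rfl⟩ := hao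
  simp only [etaExponent]
  apply twentyfour_dvd_of_zmod
  · have h' : (2 * l + 1 : ZMod 3) * (2 * m + 1) - b * (-(2 * k)) = 1 := by
      exact_mod_cast congrArg (Int.cast : ℤ → ZMod 3) h
    push_cast
    generalize (l : ZMod 3) = l at *
    generalize (b : ZMod 3) = b at *
    generalize (k : ZMod 3) = k at *
    generalize (m : ZMod 3) = m at *
    clear h
    revert l b k m
    decide
  · have h' : (2 * l + 1 : ZMod 8) * (2 * m + 1) - b * (-(2 * k)) = 1 := by
      exact_mod_cast congrArg (Int.cast : ℤ → ZMod 8) h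
    push_cast
    generalize (l : ZMod 8) = l at *
    generalize (b : ZMod 8) = b at *
    generalize (k : ZMod 8) = k at *
    generalize (m : ZMod 8) = m at *
    clear h
    revert l b k m
    decide

open scoped NumberTheorySymbols in
-- Put `d = 2m + 1` and `d' = d - 2k`. Then `2k ≡ d` modulo `d'` and `d' ≡ -2k` modulo `d`, so
-- reciprocity contributes `(-1) ^ (m (m - k))` and the symbol of `-1` modulo `d` contributes `(-1)
-- ^ m`.
lemma jacobiSym_even_sub {k m : ℕ} (hk : k ≤ m) :
    J((2 * k : ℤ) | 2 * (m - k) + 1) = (-1) ^ (m * (m - k) + m) * J((2 * k : ℤ) | 2 * m + 1) := by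
  have hodd : ∀ n : ℕ, Odd (2 * n + 1) := fun n => ⟨n, rfl⟩
  have h1 : J((2 * k : ℤ) | 2 * (m - k) + 1) = J(((2 * m + 1 : ℕ) : ℤ) | 2 * (m - k) + 1) := by
    apply jacobiSym.mod_left'
    apply Int.ModEq.symm
    rw [Int.modEq_comm, Int.modEq_iff_dvd]
    exact ⟨1, by push_cast [hk]; ring⟩
  have h2 : J(((2 * (m - k) + 1 : ℕ) : ℤ) | 2 * m + 1) = J(-(2 * k : ℤ) | 2 * m + 1) := by
    apply jacobiSym.mod_left'
    apply Int.ModEq.symm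
    rw [Int.modEq_iff_dvd]
    exact ⟨1, by push_cast [hk]; ring⟩
  have e : ∀ n : ℕ, (2 * n + 1) / 2 = n := fun n => by omega
  rw [h1, jacobiSym.quadratic_reciprocity (hodd _) (hodd _), h2, jacobiSym.neg _ (hodd _),
    ZMod.χ₄_eq_neg_one_pow (by omega), e, e, pow_add, mul_assoc]

open scoped NumberTheorySymbols in
lemma jacobiSym_neg_even_sub {k m : ℕ} (hk : k ≤ m) :
    J(-(2 * k : ℤ) | 2 * (m - k) + 1) =
      (-1) ^ (m * (m - k) + (m - k)) * J(-(2 * k : ℤ) | 2 * m + 1) := by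
  have hodd : ∀ n : ℕ, Odd (2 * n + 1) := fun n => ⟨n, rfl⟩
  have e : ∀ n : ℕ, (2 * n + 1) / 2 = n := fun n => by omega
  rw [jacobiSym.neg _ (hodd _), jacobiSym.neg _ (hodd _), jacobiSym_even_sub hk,
    ZMod.χ₄_eq_neg_one_pow (by omega), ZMod.χ₄_eq_neg_one_pow (by omega), e, e, pow_add, pow_add]
  have : ((-1 : ℤ) ^ m) * (-1) ^ m = 1 := by rw [← mul_pow]; simp
  linear_combination (0 : ℤ) * this

/-! ### The transformation formula of `η` -/

namespace ModularForm

open scoped NumberTheorySymbols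

/-- The transformation formula of `η` under the matrix `(a b; c d)`. -/
def EtaTransforms (a b c : ℤ) (d : ℕ) : Prop :=
  ∀ z : ℂ, 0 < z.im → eta ((a * z + b) / (c * z + d)) =
    (J(c | d) : ℂ) * zeta24 (etaExponent a b c d) * Complex.sqrt (c * z + d) * eta z

/-- The formula for `γ` is applied at `z / (k z + 1)`; the Jacobi symbol sees `c` only modulo `d`.
-/
lemma EtaTransforms.mul_lower {a b c : ℤ} {d : ℕ} (hd : Odd d) (h : a * d - b * c = 1)
    (H : EtaTransforms a b c d) (k : ℤ) : EtaTransforms (a + b * k) b (c + d * k) d := by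
  intro z hz
  have hdpos : (0 : ℝ) < d := by exact_mod_cast hd.pos
  have h0 : (k : ℂ) * z + 1 ≠ 0 := by
    simpa using Complex.slitPlane_ne_zero (mem_slitPlane_mul_add hz k one_pos)
  have hden : (c : ℂ) * (z / (k * z + 1)) + d = (((c + d * k : ℤ) : ℂ) * z + d) / (k * z + 1) := by
    rw [eq_div_iff h0, add_mul, mul_assoc, div_mul_cancel₀ _ h0]; push_cast; ring
  have hnum : (a : ℂ) * (z / (k * z + 1)) + b = (((a + b * k : ℤ) : ℂ) * z + b) / (k * z + 1) := by
    rw [eq_div_iff h0, add_mul, mul_assoc, div_mul_cancel₀ _ h0]; push_cast; ring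
  have key := H (z / (k * z + 1)) (im_div_mul_add_one_pos hz k)
  have hsq := Complex.sqrt_div_mul_sqrt hz ((c + d * k : ℤ) : ℝ) (k : ℝ) hdpos one_pos
  simp only [Complex.ofReal_intCast, Complex.ofReal_one, Complex.ofReal_natCast] at hsq
  rw [hden, hnum, div_div_div_cancel_right₀ h0, eta_div_int_mul_add_one hz] at key
  have hJ : J(c + d * k | d) = J(c | d) := by
    apply jacobiSym.mod_left'
    simp
  have hE : zeta24 (etaExponent (a + b * k) b (c + d * k) d) =
      zeta24 (etaExponent a b c d) * zeta24 (-k) := by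
    rw [← zeta24_add]
    exact zeta24_congr (etaExponent_mul_lower k (by exact_mod_cast hd) h)
  rw [key, hJ, hE, ← hsq]
  ring

lemma etaTransforms_T (b : ℤ) : EtaTransforms 1 b 0 1 := by
  intro z hz
  simp [etaExponent, eta_add_int, Complex.sqrt]

/-- The matrix is `γ' T ^ e`, where `γ'` has lower right entry `d'`: the formula for `γ'` is applied
at `z + e`. The signs `(-1) ^ n` from the symbol and from the root of unity cancel. -/
lemma EtaTransforms.mul_T {a b c : ℤ} {d d' : ℕ} (e : ℤ) (n : ℕ) (hcd : c * e + d' = d)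
    (H : EtaTransforms a (b - a * e) c d') (hJ : J(c | d') = (-1) ^ n * J(c | d))
    (hE : 24 ∣ etaExponent a (b - a * e) c d' + e - (etaExponent a b c d + 12 * n)) :
    EtaTransforms a b c d := by
  intro z hz
  have key := H (z + e) (by simpa using hz)
  have h1 : (a : ℂ) * (z + e) + (b - a * e : ℤ) = a * z + b := by push_cast; ring
  have h2 : (c : ℂ) * (z + e) + d' = c * z + d := by
    have : (c : ℂ) * e + d' = d := by exact_mod_cast congrArg (Int.cast : ℤ → ℂ) hcd
    rw [← this]; ring
  have h3 := zeta24_congr hE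
  rw [zeta24_add, zeta24_add, zeta24_twelve_mul] at h3
  rw [h1, h2, eta_add_int, hJ] at key
  have h4 : ((-1 : ℂ) ^ n) * (-1) ^ n = 1 := by rw [← mul_pow]; simp
  rw [key]
  push_cast
  linear_combination ((-1) ^ n * (J(c | d) : ℂ) * Complex.sqrt (c * z + d) * eta z) * h3 +
    ((J(c | d) : ℂ) * Complex.sqrt (c * z + d) * eta z * zeta24 (etaExponent a b c d)) * h4

/-- A Euclidean algorithm that keeps `d = 2m + 1` odd. Lower unipotents replace `c` by an even
representative modulo `d` of absolute value less than `d`; then `T` or `T⁻¹` replaces `d` by `d -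
|c|`. For `d > 1` coprimality gives `c ≠ 0`, so `d` drops; at `d = 1` one takes `c = 0`, a
translation. -/
theorem etaTransforms (m : ℕ) : ∀ a b c : ℤ, a * (2 * m + 1 : ℕ) - b * c = 1 →
    EtaTransforms a b c (2 * m + 1) := by
  induction m using Nat.strong_induction_on with
  | _ m ih =>
    have hodd : Odd (2 * m + 1) := ⟨m, rfl⟩
    -- It suffices to treat one representative of `c` modulo `d`.
    have reduce : ∀ a b c k : ℤ, a * (2 * m + 1 : ℕ) - b * c = 1 →
        EtaTransforms (a - b * k) b (c - (2 * m + 1 : ℕ) * k) (2 * m + 1) →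
        EtaTransforms a b c (2 * m + 1) := by
      intro a b c k h H
      have := H.mul_lower hodd (by linear_combination h) k
      simpa using this
    intro a b c h
    rcases Nat.eq_zero_or_pos m with rfl | hm
    · refine reduce a b c c h ?_
      have e1 : a - b * c = 1 := by simpa using h
      rw [e1]
      simpa using etaTransforms_T b
    · set D : ℤ := ((2 * m + 1 : ℕ) : ℤ) with hD
      have hDval : D = 2 * m + 1 := by rw [hD]; push_cast; ring
      have hDpos : 0 < D := by rw [hDval]; positivity
      have hr0 := Int.emod_nonneg c hDpos.ne'
      have hr1 := Int.emod_lt_of_pos c hDpos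
      have hrdef : c - D * (c / D) = c % D := by rw [Int.emod_def]
      have hne : c % D ≠ 0 := by
        intro h0
        have hdvd : D ∣ 1 := by
          rw [← h]; exact dvd_sub (dvd_mul_left _ _) ((Int.dvd_of_emod_eq_zero h0).mul_left b)
        have := Int.le_of_dvd one_pos hdvd
        omega
      rcases Int.even_or_odd' (c % D) with ⟨k, hk | hk⟩
      · lift k to ℕ using by omega
        refine reduce a b c (c / D) h ?_
        rw [hrdef, hk]
        have hdet : (a - b * (c / D)) * (2 * m + 1) - b * (2 * k) = 1 := by
          rw [← hk, ← hrdef, ← hDval]; linear_combination h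
        refine EtaTransforms.mul_T (d' := 2 * (m - k) + 1) 1 (m * (m - k) + m) ?_
          (ih (m - k) (by omega) _ _ _ ?_) (jacobiSym_even_sub (by omega)) ?_
        · push_cast [show k ≤ m by omega]; ring
        · push_cast [show k ≤ m by omega]; linear_combination hdet
        · convert etaExponent_mul_T_neg hdet using 4
          · ring
          · push_cast [show k ≤ m by omega]; ring
          · push_cast [show k ≤ m by omega]; ring
      · lift k to ℕ using by omega
        obtain ⟨l, hl⟩ : ∃ l : ℕ, c % D - D = -(2 * l : ℤ) := ⟨m - k, by
          push_cast [show k ≤ m by omega]; omega⟩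
        -- The least residue of `c` is odd here, so the even representative is the residue minus
        -- `d`.
        refine reduce a b c (c / D + 1) h ?_
        have hc' : c - D * (c / D + 1) = -(2 * l : ℤ) := by rw [← hl, ← hrdef]; ring
        rw [hc']
        have hdet : (a - b * (c / D + 1)) * (2 * m + 1) - b * (-(2 * l)) = 1 := by
          rw [← hc', ← hDval]; linear_combination h
        refine EtaTransforms.mul_T (d' := 2 * (m - l) + 1) (-1)
          (m * (m - l) + (m - l)) ?_
          (ih (m - l) (by omega) _ _ _ ?_) (jacobiSym_neg_even_sub (by omega)) ?_
        · push_cast [show l ≤ m by omega]; ring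
        · push_cast [show l ≤ m by omega]; linear_combination hdet
        · have e1 : ((2 * (m - l) + 1 : ℕ) : ℤ) = 2 * m + 1 - 2 * l := by
            push_cast [show l ≤ m by omega]; ring
          have e2 : ((m * (m - l) + (m - l) : ℕ) : ℤ) = m * (m - l) + (m - l) := by
            push_cast [show l ≤ m by omega]; ring
          rw [e1, e2, mul_neg_one, sub_neg_eq_add, ← sub_eq_add_neg]
          simpa using etaExponent_mul_T hdet

end ModularForm

/-! ### Squares detected by Jacobi symbols -/

open scoped NumberTheorySymbols

/-- A positive integer is a square as soon as its Jacobi symbols are trivial for all odd `d`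
coprime to a fixed modulus. -/
theorem isSquare_of_forall_jacobiSym {s M : ℕ} (hs : s ≠ 0) (hM : M ≠ 0)
    (h : ∀ d : ℕ, Odd d → d.Coprime M → J(s | d) = 1) : IsSquare s := by
  obtain ⟨m, t, rfl, hm⟩ := Nat.sq_mul_squarefree s
  have ht : t ≠ 0 := by rintro rfl; simp at hs
  have hm0 : m ≠ 0 := hm.ne_zero
  have h' : ∀ d : ℕ, Odd d → d.Coprime (M * t) → J(m | d) = 1 := by
    intro d hd hdM
    have h1 := h d hd hdM.coprime_mul_right_right
    have h2 : Int.gcd t d = 1 := by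
      simpa [Int.gcd_natCast_natCast] using hdM.coprime_mul_left_right.symm
    have h3 := jacobiSym.sq_one' h2
    push_cast at h1
    rwa [jacobiSym.mul_left, h3, one_mul] at h1
  suffices m = 1 by subst this; exact ⟨t, by ring⟩
  by_contra hm1
  set K := M * t with hK
  have hK0 : K ≠ 0 := mul_ne_zero hM ht
  by_cases hp : ∃ p, p.Prime ∧ p ∣ m ∧ p ≠ 2
  · obtain ⟨p, hp, ⟨m', rfl⟩, hp2⟩ := hp
    have := Fact.mk hp
    have hpodd : Odd p := hp.odd_of_ne_two hp2
    have hpm' : ¬ p ∣ m' := by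
      intro hdvd
      obtain ⟨u, rfl⟩ := hdvd
      have := hm p ⟨u, by ring⟩
      exact hp.one_lt.ne' (Nat.isUnit_iff.mp this)
    obtain ⟨e, K', hpK, hKe⟩ := Nat.exists_eq_pow_mul_and_not_dvd hK0 p hp.ne_one
    obtain ⟨n, hn⟩ : ∃ n : ℕ, J((n : ℤ) | p) = -1 := by
      obtain ⟨x, hx⟩ := quadraticChar_exists_neg_one (F := ZMod p) (by
        rw [ZMod.ringChar_zmod_n]; exact hp2)
      refine ⟨x.val, ?_⟩
      rw [← jacobiSym.legendreSym.to_jacobiSym, legendreSym]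
      simpa using hx
    have hcop : Nat.Coprime (4 * m' * K') p := by
      refine Nat.Coprime.symm ((Nat.Prime.coprime_iff_not_dvd hp).mpr fun hdvd => ?_)
      rcases hp.dvd_mul.mp hdvd with h1 | h1
      · rcases hp.dvd_mul.mp h1 with h2 | h2
        · have : p ∣ 2 := hp.dvd_of_dvd_pow (n := 2) (by simpa using h2)
          exact hp2 ((Nat.prime_dvd_prime_iff_eq hp Nat.prime_two).mp this)
        · exact hpm' h2
      · exact hpK h1
    -- `d` is a nonresidue modulo `p` and is 1 modulo 4, modulo `4 * m'` and modulo the prime-to-`p`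
    -- part of `K`. Hence the symbol of `m'` is 1 and that of `p` is -1 by reciprocity. As `d` need
    -- not be prime, the Chinese remainder theorem replaces Dirichlet's theorem.
    obtain ⟨d, hd1, hd2⟩ := Nat.chineseRemainder hcop 1 n
    have hd4 : d % 4 = 1 := by
      have : d ≡ 1 [MOD 4] := hd1.of_dvd ⟨m' * K', by ring⟩
      simpa [Nat.ModEq] using this
    have hdodd : Odd d := Nat.odd_iff.mpr (by omega)
    have hJp : J(((d : ℕ) : ℤ) | p) = -1 := by
      rw [← hn]
      apply jacobiSym.mod_left'
      exact_mod_cast (Int.natCast_modEq_iff.mpr hd2)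
    have hdp : d.Coprime p := by
      by_contra hcon
      have : J((d : ℤ) | p) = 0 := jacobiSym.eq_zero_iff.mpr
        ⟨hp.ne_zero, by simpa [Int.gcd_natCast_natCast] using hcon⟩
      omega
    have hdK : d.Coprime K := by
      rw [hKe]
      refine Nat.Coprime.mul_right (hdp.pow_right e) ?_
      have : d ≡ 1 [MOD K'] := hd1.of_dvd ⟨4 * m', by ring⟩
      rw [Nat.Coprime, this.gcd_eq, Nat.gcd_one_left]
    have hJm : J((m' : ℤ) | d) = 1 := by
      rw [jacobiSym.mod_right _ hdodd]
      have : d ≡ 1 [MOD 4 * (m' : ℤ).natAbs] := hd1.of_dvd ⟨K', by simp⟩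
      have h2 : d % (4 * (m' : ℤ).natAbs) = 1 % (4 * (m' : ℤ).natAbs) := this
      rw [h2, ← jacobiSym.mod_right _ odd_one, jacobiSym.one_right]
    have hcontra := h' d hdodd hdK
    push_cast at hcontra
    rw [jacobiSym.mul_left, hJm, mul_one, jacobiSym.quadratic_reciprocity_one_mod_four' hpodd hd4,
      hJp] at hcontra
    omega
  · push Not at hp
    have h2m : m = 2 := by
      obtain ⟨q, hq, hqm⟩ := Nat.exists_prime_and_dvd hm1
      obtain rfl := hp q hq hqm
      obtain ⟨u, rfl⟩ := hqm
      by_contra hu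
      have hu1 : u ≠ 1 := fun h => hu (by rw [h])
      obtain ⟨q, hq, hqu⟩ := Nat.exists_prime_and_dvd hu1
      obtain rfl := hp q hq (hqu.mul_left 2)
      obtain ⟨v, rfl⟩ := hqu
      have := hm 2 ⟨v, by ring⟩
      simp at this
    subst h2m
    obtain ⟨e, K', hpK, hKe⟩ := Nat.exists_eq_pow_mul_and_not_dvd hK0 2 (by norm_num)
    have hcop : Nat.Coprime 8 K' := by
      have : Nat.Coprime 2 K' := (Nat.Prime.coprime_iff_not_dvd Nat.prime_two).mpr hpK
      simpa using this.pow_left 3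
    -- 2 is a nonresidue for `d ≡ 5` modulo 8; the second congruence makes `d` coprime to the odd
    -- part of `K`.
    obtain ⟨d, hd1, hd2⟩ := Nat.chineseRemainder hcop 5 1
    have hd8 : d % 8 = 5 := hd1
    have hdodd : Odd d := Nat.odd_iff.mpr (by omega)
    have hdK : d.Coprime K := by
      rw [hKe]
      refine Nat.Coprime.mul_right (hdodd.coprime_two_right.pow_right e) ?_
      rw [Nat.Coprime, hd2.gcd_eq, Nat.gcd_one_left]
    have hcontra := h' d hdodd hdK
    rw [Nat.cast_ofNat, jacobiSym.at_two hdodd, ZMod.χ₈_nat_eq_if_mod_eight] at hcontra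
    simp [hd8, show d % 2 = 1 by omega] at hcontra

/-! ### The square condition and invariance under `Γ₀(N)` -/

/-- The integer `∏_{δ ∣ N} (N / δ) ^ |r_δ|`, which agrees with `∏_{δ ∣ N} (N / δ) ^ r_δ` up to
rational squares. -/
def absProduct (N : ℕ) (r : ℕ → ℤ) : ℕ := ∏ δ ∈ N.divisors, (N / δ) ^ (r δ).natAbs

lemma div_pos_of_mem_divisors {N δ : ℕ} (h : δ ∈ N.divisors) : 0 < N / δ :=
  Nat.div_pos (Nat.divisor_le h) (Nat.pos_of_mem_divisors h)

lemma absProduct_ne_zero (N : ℕ) (r : ℕ → ℤ) : absProduct N r ≠ 0 :=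
  Finset.prod_ne_zero_iff.mpr fun _ h => pow_ne_zero _ (div_pos_of_mem_divisors h).ne'

lemma squareCondition_iff_isSquare (N : ℕ) (r : ℕ → ℤ) :
    SquareCondition N r ↔ IsSquare (absProduct N r) := by
  set y : ℚ := ∏ δ ∈ N.divisors, ((N / δ : ℕ) : ℚ) ^ (-(r δ)).toNat with hy
  have hne : ∀ δ ∈ N.divisors, ((N / δ : ℕ) : ℚ) ≠ 0 := fun δ h =>
    Nat.cast_ne_zero.mpr (div_pos_of_mem_divisors h).ne'
  have hy0 : y ≠ 0 := Finset.prod_ne_zero_iff.mpr fun δ h => pow_ne_zero _ (hne δ h)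
  -- Factor by factor, `|r| = r + 2 max (-r) 0`.
  have key : (absProduct N r : ℚ) = (∏ δ ∈ N.divisors, ((N / δ : ℕ) : ℚ) ^ r δ) * y ^ 2 := by
    rw [absProduct, hy, ← Finset.prod_pow, ← Finset.prod_mul_distrib]
    push_cast
    refine Finset.prod_congr rfl fun δ h => ?_
    rw [← zpow_natCast, ← pow_mul, ← zpow_natCast, ← zpow_add₀ (hne δ h)]
    congr 1
    rw [Nat.cast_mul]
    omega
  have hs0 : (absProduct N r : ℚ) ≠ 0 := Nat.cast_ne_zero.mpr (absProduct_ne_zero N r)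
  rw [← Rat.isSquare_natCast_iff, key]
  constructor
  · rintro ⟨x, -, hx⟩
    exact ⟨x * y, by rw [hx]; ring⟩
  · rintro ⟨x, hx⟩
    refine ⟨x / y, div_ne_zero ?_ hy0, ?_⟩
    · rintro rfl
      exact hs0 (by rw [key, hx, zero_mul])
    · rw [div_pow, eq_div_iff (pow_ne_zero _ hy0), hx, sq]

namespace ModularForm

variable {N : ℕ} {r : ℕ → ℤ}

/-- The symbol of `c` cancels in weight 0. The remaining symbols are `±1`, so their exponents matter
only up to sign. -/
lemma prod_jacobiSym_zpow {c : ℤ} {d : ℕ} (hcd : IsCoprime (c * N) (d : ℤ))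
    (h0 : ∑ δ ∈ N.divisors, r δ = 0) :
    ∏ δ ∈ N.divisors, ((J(c * (N / δ : ℕ) | d) : ℤ) : ℂ) ^ r δ = (J(absProduct N r | d) : ℤ) := by
  have hc : Int.gcd c d = 1 := Int.isCoprime_iff_gcd_eq_one.mp hcd.of_mul_left_left
  have hN : IsCoprime (N : ℤ) d := hcd.of_mul_left_right
  have hJc : ((J(c | d) : ℤ) : ℂ) ≠ 0 := Int.cast_ne_zero.mpr (jacobiSym.ne_zero hc)
  have e1 : ∏ δ ∈ N.divisors, ((J(c | d) : ℤ) : ℂ) ^ r δ = 1 := by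
    rw [← zpow_zero ((J(c | d) : ℤ) : ℂ), ← h0]
    generalize N.divisors = S
    classical
    induction S using Finset.induction_on with
    | empty => simp
    | insert a S ha ih => rw [Finset.prod_insert ha, Finset.sum_insert ha, zpow_add₀ hJc, ih]
  simp_rw [jacobiSym.mul_left, Int.cast_mul, mul_zpow]
  rw [Finset.prod_mul_distrib, e1, one_mul, absProduct]
  have e2 : J(((∏ δ ∈ N.divisors, (N / δ) ^ (r δ).natAbs : ℕ) : ℤ) | d) =
      ∏ δ ∈ N.divisors, J(((N / δ : ℕ) : ℤ) | d) ^ (r δ).natAbs := by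
    generalize N.divisors = S
    classical
    induction S using Finset.induction_on with
    | empty => simp
    | insert a S ha ih =>
      rw [Finset.prod_insert ha, Finset.prod_insert ha, Nat.cast_mul, jacobiSym.mul_left, ih,
        Nat.cast_pow, jacobiSym.pow_left]
  rw [e2, Int.cast_prod]
  refine Finset.prod_congr rfl fun δ h => ?_
  have hg : Int.gcd ((N / δ : ℕ) : ℤ) d = 1 := by
    apply Int.isCoprime_iff_gcd_eq_one.mp
    exact hN.of_isCoprime_of_dvd_left
      (Int.natCast_dvd_natCast.mpr (Nat.div_dvd_of_dvd (Nat.dvd_of_mem_divisors h)))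
  obtain ⟨n, hr | hr⟩ := Int.eq_nat_or_neg (r δ) <;>
  rcases jacobiSym.eq_one_or_neg_one hg with h | h <;> rw [h] <;> simp [hr, ← inv_pow]

/-- An eta product of weight `0` with integral orders at `∞` and `0` transforms under a matrix of
`Γ₀(N)` with odd positive lower right entry `d` by a Jacobi symbol modulo `d`. -/
theorem etaProduct_eq_jacobiSym_mul (ha : 24 ∣ ∑ δ ∈ N.divisors, r δ * (δ : ℤ))
    (hb : 24 ∣ ∑ δ ∈ N.divisors, r δ * ((N / δ : ℕ) : ℤ)) (h0 : ∑ δ ∈ N.divisors, r δ = 0)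
    {a b c : ℤ} {d : ℕ} (hd : Odd d) (hdet : a * d - b * (c * N) = 1) (τ σ : ℍ)
    (hσ : (σ : ℂ) = (a * τ + b) / (c * N * τ + d)) :
    etaProduct N r σ = (J(absProduct N r | d) : ℤ) * etaProduct N r τ := by
  have hterm : ∀ δ ∈ N.divisors, eta ((δ : ℂ) * σ) =
      ((J(c * (N / δ : ℕ) | d) : ℤ) : ℂ) *
        zeta24 (etaExponent a (b * δ) (c * (N / δ : ℕ)) d) *
        Complex.sqrt (c * N * τ + d) * eta (δ * τ) := by
    intro δ hδ
    have hδ0 : (0 : ℝ) < δ := by exact_mod_cast Nat.pos_of_mem_divisors hδ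
    have hNδ : ((N / δ : ℕ) : ℂ) * δ = N := by
      exact_mod_cast Nat.div_mul_cancel (Nat.dvd_of_mem_divisors hδ)
    have hNδ' : ((N / δ : ℕ) : ℤ) * δ = N := by
      exact_mod_cast Nat.div_mul_cancel (Nat.dvd_of_mem_divisors hδ)
    obtain ⟨m, rfl⟩ := hd
    have hz : 0 < ((δ : ℂ) * τ).im := by
      simpa using mul_pos hδ0 τ.im_pos
    -- `δ σ` is the image of `δ τ` under `(a, b δ; c N/δ, d)`. Its automorphy factor `c N τ + d`
    -- does not depend on `δ`, so the square roots cancel in weight 0.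
    have := etaTransforms m a (b * δ) (c * (N / δ : ℕ))
      (by linear_combination hdet - b * c * hNδ') _ hz
    have e1 : ((c * (N / δ : ℕ) : ℤ) : ℂ) * (δ * τ) = c * N * τ := by
      rw [Int.cast_mul, Int.cast_natCast, ← hNδ]; ring
    rw [e1] at this
    rw [← this, hσ, ← mul_div_assoc]
    congr 2
    push_cast; ring
  have hsqrt : Complex.sqrt (c * N * τ + d) ≠ 0 := by
    have := Complex.re_sqrt_pos (mem_slitPlane_mul_add (z := τ) τ.im_pos (c * N : ℝ) (d := d)
      (by exact_mod_cast hd.pos))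
    intro h
    push_cast at this
    rw [h] at this
    simp at this
  have hE : ∏ δ ∈ N.divisors, zeta24 (etaExponent a (b * δ) (c * (N / δ : ℕ)) d) ^ r δ = 1 := by
    simp_rw [zeta24_zpow]
    rw [zeta24_prod]
    apply zeta24_eq_one_of_dvd
    -- Since `(N/δ) * δ = N`, the exponent is a combination of `N/δ`, `δ` and `1` with coefficients
    -- free of `δ`.
    have : ∑ δ ∈ N.divisors, etaExponent a (b * δ) (c * (N / δ : ℕ)) d * r δ =
        ((a + d) * c - b * d * c ^ 2 * N - 3 * c * d) * ∑ δ ∈ N.divisors, r δ * ((N / δ : ℕ) : ℤ) +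
        b * d * ∑ δ ∈ N.divisors, r δ * (δ : ℤ) + (3 * d - 3) * ∑ δ ∈ N.divisors, r δ := by
      simp_rw [Finset.mul_sum, ← Finset.sum_add_distrib]
      refine Finset.sum_congr rfl fun δ hδ => ?_
      have hNδ' : ((N / δ : ℕ) : ℤ) * δ = N := by
        exact_mod_cast Nat.div_mul_cancel (Nat.dvd_of_mem_divisors hδ)
      rw [← hNδ']
      simp only [etaExponent]
      ring
    rw [this, h0, mul_zero, add_zero]
    exact dvd_add (hb.mul_left _) (ha.mul_left _)
  have hS : ∏ δ ∈ N.divisors, Complex.sqrt (c * N * τ + d) ^ r δ = 1 := by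
    rw [← zpow_zero (Complex.sqrt (c * N * τ + d)), ← h0]
    generalize N.divisors = S
    classical
    induction S using Finset.induction_on with
    | empty => simp
    | insert a S ha ih => rw [Finset.prod_insert ha, Finset.sum_insert ha, zpow_add₀ hsqrt, ih]
  have hcop : IsCoprime (c * N) (d : ℤ) := ⟨-b, a, by linear_combination hdet⟩
  rw [etaProduct, Finset.prod_congr rfl fun δ hδ => by rw [hterm δ hδ]]
  simp_rw [mul_zpow]
  rw [Finset.prod_mul_distrib, Finset.prod_mul_distrib, Finset.prod_mul_distrib, hE, hS,
    prod_jacobiSym_zpow hcop h0, mul_one, mul_one]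
  rfl

lemma coe_smul_SL (γ : SL(2, ℤ)) (τ : ℍ) :
    ((γ • τ : ℍ) : ℂ) = ((γ 0 0 : ℤ) * τ + (γ 0 1 : ℤ)) / ((γ 1 0 : ℤ) * τ + (γ 1 1 : ℤ)) := by
  rw [UpperHalfPlane.coe_specialLinearGroup_apply]; simp

lemma etaProduct_T_smul (ha : 24 ∣ ∑ δ ∈ N.divisors, r δ * (δ : ℤ)) (τ : ℍ) :
    etaProduct N r (ModularGroup.T • τ) = etaProduct N r τ := by
  have hT : ((ModularGroup.T • τ : ℍ) : ℂ) = τ + 1 := by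
    rw [coe_smul_SL]; simp [ModularGroup.T]
  have : ∀ δ : ℕ, eta ((δ : ℂ) * (ModularGroup.T • τ : ℍ)) = zeta24 δ * eta (δ * τ) := by
    intro δ
    rw [← eta_add_int, hT]
    congr 1; push_cast; ring
  simp_rw [etaProduct, this, mul_zpow, zeta24_zpow]
  rw [Finset.prod_mul_distrib, zeta24_prod, zeta24_eq_one_of_dvd, one_mul]
  simpa [mul_comm] using ha

lemma det_eq_one (γ : SL(2, ℤ)) : γ 0 0 * γ 1 1 - γ 0 1 * γ 1 0 = 1 := by
  rw [← Matrix.det_fin_two]; exact γ.det_coe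

/-- An eta product of weight `0` whose orders at the cusps `∞` and `0` are integers is invariant
under `Γ₀(N)` if the square condition holds. -/
theorem etaProduct_smul (ha : 24 ∣ ∑ δ ∈ N.divisors, r δ * (δ : ℤ))
    (hb : 24 ∣ ∑ δ ∈ N.divisors, r δ * ((N / δ : ℕ) : ℤ)) (h0 : ∑ δ ∈ N.divisors, r δ = 0)
    (hsq : SquareCondition N r) {γ : SL(2, ℤ)} (hγ : γ ∈ CongruenceSubgroup.Gamma0 N) (τ : ℍ) :
    etaProduct N r (γ • τ) = etaProduct N r τ := by
  -- matrices with odd positive lower right entry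
  have hpos : ∀ γ ∈ CongruenceSubgroup.Gamma0 N, Odd (γ 1 1) → 0 < γ 1 1 → ∀ τ : ℍ,
      etaProduct N r (γ • τ) = etaProduct N r τ := by
    intro γ hγ hodd hp τ
    rw [CongruenceSubgroup.Gamma0_mem, ZMod.intCast_zmod_eq_zero_iff_dvd] at hγ
    obtain ⟨c, hc⟩ := hγ
    obtain ⟨d, hd⟩ := Int.eq_ofNat_of_zero_le hp.le
    have hdet := det_eq_one γ
    rw [hd, hc] at hdet
    have hdodd : Odd d := by rw [hd] at hodd; exact_mod_cast hodd
    rw [etaProduct_eq_jacobiSym_mul ha hb h0 (a := γ 0 0) (b := γ 0 1) (c := c) hdodd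
      (by linear_combination hdet) τ]
    · obtain ⟨t, ht⟩ := (squareCondition_iff_isSquare N r).mp hsq
      have hcop : IsCoprime ((absProduct N r : ℕ) : ℤ) d := by
        rw [absProduct, Nat.cast_prod]
        refine IsCoprime.prod_left fun δ hδ => ?_
        have hNd : IsCoprime (N : ℤ) d := ⟨-(γ 0 1) * c, γ 0 0, by linear_combination hdet⟩
        rw [Nat.cast_pow]
        exact (hNd.of_isCoprime_of_dvd_left (Int.natCast_dvd_natCast.mpr
          (Nat.div_dvd_of_dvd (Nat.dvd_of_mem_divisors hδ)))).pow_left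
      rw [ht] at hcop ⊢
      push_cast at hcop ⊢
      have h1 : Int.gcd t d = 1 := Int.isCoprime_iff_gcd_eq_one.mp hcop.of_mul_left_left
      rw [← sq, jacobiSym.sq_one' h1, Int.cast_one, one_mul]
    · rw [coe_smul_SL, hc, hd]; push_cast; ring
  have hodd : ∀ γ ∈ CongruenceSubgroup.Gamma0 N, Odd (γ 1 1) → ∀ τ : ℍ,
      etaProduct N r (γ • τ) = etaProduct N r τ := by
    intro γ hγ hodd τ
    rcases lt_trichotomy (γ 1 1) 0 with h | h | h
    · rw [← ModularGroup.SL_neg_smul]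
      refine hpos (-γ) ?_ (by simpa using hodd) (by simpa using h) τ
      rw [CongruenceSubgroup.Gamma0_mem] at hγ ⊢
      simp [hγ]
    · rw [h] at hodd; simp at hodd
    · exact hpos γ hγ hodd h τ
  rcases Int.even_or_odd (γ 1 1) with he | ho
  · have hdet := det_eq_one γ
    have hc : Odd (γ 1 0) := by
      by_contra hcon
      rw [Int.not_odd_iff_even] at hcon
      have : Even (1 : ℤ) := by rw [← hdet]; exact (he.mul_left _).sub (hcon.mul_left _)
      simp at this
    -- If `d` is even then `c` is odd, and `γ T` has the odd lower right entry `c + d`.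
    have h1 : γ • τ = (γ * ModularGroup.T) • (ModularGroup.T⁻¹ • τ) := by
      rw [mul_smul, smul_inv_smul]
    have h2 : (γ * ModularGroup.T) 1 1 = γ 1 0 + γ 1 1 := by
      rw [Matrix.SpecialLinearGroup.coe_mul, ModularGroup.coe_T, Matrix.mul_apply,
        Fin.sum_univ_two]
      simp
    have h3 : (γ * ModularGroup.T) 1 0 = γ 1 0 := by
      rw [Matrix.SpecialLinearGroup.coe_mul, ModularGroup.coe_T, Matrix.mul_apply,
        Fin.sum_univ_two]
      simp
    rw [h1, hodd]
    · rw [← etaProduct_T_smul ha, smul_inv_smul]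
    · rw [CongruenceSubgroup.Gamma0_mem] at hγ ⊢
      rw [h3, hγ]
    · rw [h2]; exact hc.add_even he
  · exact hodd γ hγ ho τ

lemma etaProduct_ne_zero (N : ℕ) (r : ℕ → ℤ) (τ : ℍ) : etaProduct N r τ ≠ 0 := by
  refine Finset.prod_ne_zero_iff.mpr fun δ hδ => zpow_ne_zero _ (eta_ne_zero ?_)
  have : (0 : ℝ) < δ := by exact_mod_cast Nat.pos_of_mem_divisors hδ
  simpa using mul_pos this τ.im_pos

/-- Conversely, the square condition is necessary for invariance under `Γ₀(N)`. -/
theorem squareCondition_of_smul (hN : 0 < N) (ha : 24 ∣ ∑ δ ∈ N.divisors, r δ * (δ : ℤ))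
    (hb : 24 ∣ ∑ δ ∈ N.divisors, r δ * ((N / δ : ℕ) : ℤ)) (h0 : ∑ δ ∈ N.divisors, r δ = 0)
    (hinv : ∀ γ ∈ CongruenceSubgroup.Gamma0 N, ∀ τ : ℍ,
      etaProduct N r (γ • τ) = etaProduct N r τ) : SquareCondition N r := by
  rw [squareCondition_iff_isSquare]
  refine isSquare_of_forall_jacobiSym (absProduct_ne_zero N r) hN.ne' fun d hd hdN => ?_
  have hcop : IsCoprime (d : ℤ) N := Nat.isCoprime_iff_coprime.mpr hdN
  obtain ⟨a, b, hab⟩ := hcop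
  let γ : SL(2, ℤ) := ⟨!![a, -b; N, d], by rw [Matrix.det_fin_two_of]; linarith⟩
  have hγ : γ ∈ CongruenceSubgroup.Gamma0 N := by
    rw [CongruenceSubgroup.Gamma0_mem]; simp [γ]
  have h1 := hinv γ hγ I
  rw [etaProduct_eq_jacobiSym_mul ha hb h0 (a := a) (b := -b) (c := 1) hd (by linarith) I (γ • I)
    (by rw [coe_smul_SL]; simp [γ])] at h1
  have h2 := mul_right_cancel₀ (etaProduct_ne_zero N r I) (h1.trans (one_mul _).symm)
  exact_mod_cast h2

end ModularForm

/-! ### Growth of eta products at the cusps -/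

open scoped Topology Manifold

namespace ModularForm

/-- The product formula for `Δ = η ^ 24`, whose leading term is `q`. -/
lemma tendsto_norm_eta_pow :
    Tendsto (fun w : ℍ => ‖eta w‖ ^ 24 * Real.exp (2 * Real.pi * w.im)) atImInfty (𝓝 1) := by
  have h := tendsto_atImInfty_tprod_one_sub_eta_q_pow.norm
  rw [norm_one] at h
  refine h.congr fun w => ?_
  rw [← norm_pow, show eta w ^ 24 = discriminant w from rfl, discriminant_eq_q_prod, norm_mul,
    Function.Periodic.norm_qParam, mul_right_comm, ← Real.exp_add]
  simp

lemma discriminant_smul (γ : SL(2, ℤ)) (τ : ℍ) :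
    discriminant (γ • τ) = ((γ 1 0 : ℤ) * τ + (γ 1 1 : ℤ)) ^ 12 * discriminant τ := by
  have h := SlashInvariantForm.slash_action_eqn' (Γ := 𝒮ℒ) CuspForm.discriminant
    (γ := (γ : GL (Fin 2) ℝ)) (by simp; exact ⟨γ, rfl⟩) τ
  simpa using! h

/-- Factor `(δ 0; 0 1) γ = γ' (A B; 0 D)` with `γ'` in `SL(2, ℤ)`, `A = gcd (c, δ)` and `A D = δ`.
Then `w = (A τ + B) / D` has imaginary part `A² / δ` times that of `τ`, and the modularity of `Δ`
under `γ'` contributes the factor `(c τ + d) / D`. -/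
lemma norm_eta_mul_smul_pow (γ : SL(2, ℤ)) {δ : ℕ} (hδ : 0 < δ) :
    ∃ D : ℝ, 0 < D ∧ ∃ w : ℍ → ℍ, ∀ τ : ℍ,
      (w τ).im = (Int.gcd (γ 1 0) δ : ℝ) ^ 2 / δ * τ.im ∧
      ‖eta (δ * (γ • τ : ℍ))‖ ^ 24 =
        (‖((γ 1 0 : ℤ) : ℂ) * τ + (γ 1 1 : ℤ)‖ / D) ^ 12 * ‖eta (w τ)‖ ^ 24 := by
  have hdet := det_eq_one γ
  set a := γ 0 0
  set b := γ 0 1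
  set c := γ 1 0
  set d := γ 1 1
  set A : ℕ := Int.gcd c δ with hA
  have hApos : 0 < A := Int.gcd_pos_of_ne_zero_right _ (by exact_mod_cast hδ.ne')
  obtain ⟨q, hq⟩ : (A : ℤ) ∣ c := Int.gcd_dvd_left _ _
  obtain ⟨D, hD⟩ : (A : ℤ) ∣ δ := Int.gcd_dvd_right _ _
  have hA0 : (A : ℤ) ≠ 0 := by exact_mod_cast hApos.ne'
  have hDpos : 0 < D := by
    have : (0 : ℤ) < A * D := by rw [← hD]; exact_mod_cast hδ
    exact pos_of_mul_pos_right this (by positivity)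
  -- `p = a D` and `q` are coprime
  have hqD : IsCoprime q D := by
    have h1 : Int.gcd (A * q) (A * D) = A := by rw [← hq, ← hD]
    rw [Int.gcd_mul_left, Int.natAbs_natCast] at h1
    exact Int.isCoprime_iff_gcd_eq_one.mpr (Nat.eq_of_mul_eq_mul_left hApos (by rw [h1, mul_one]))
  have hqa : IsCoprime q a := ⟨-b * A, d, by rw [← hdet, hq]; ring⟩
  obtain ⟨v, u, huv⟩ := hqa.mul_right hqD
  set p := a * D
  let γ' : SL(2, ℤ) := ⟨!![p, -v; q, u], by rw [Matrix.det_fin_two_of]; linarith⟩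
  set B : ℤ := u * δ * b + v * d
  have hDval : p * d - q * δ * b = D := by
    apply mul_left_cancel₀ hA0
    have e1 : A * (p * d - q * δ * b) = δ * (a * d) - (δ * b) * c := by
      rw [hq, hD]; simp only [p]; ring
    rw [e1, ← hD]; linear_combination (δ : ℤ) * hdet
  have hDR : (0 : ℝ) < D := by exact_mod_cast hDpos
  have hAR : (0 : ℝ) < A := by exact_mod_cast hApos
  have him : ∀ τ : ℍ, (((A : ℂ) * τ + (B : ℂ)) / (D : ℂ)).im = A / D * τ.im := by
    intro τ
    rw [show (D : ℂ) = ((D : ℝ) : ℂ) by push_cast; rfl, Complex.div_ofReal_im]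
    simp; ring
  have hpos : ∀ τ : ℍ, 0 < (((A : ℂ) * τ + (B : ℂ)) / (D : ℂ)).im := by
    intro τ
    rw [him]
    have := τ.im_pos
    positivity
  refine ⟨D, hDR, fun τ => ⟨((A : ℂ) * τ + B) / D, hpos τ⟩,
    fun τ => ⟨?_, ?_⟩⟩
  · have : (δ : ℝ) = A * D := by exact_mod_cast congrArg (Int.cast : ℤ → ℝ) hD
    change (((A : ℂ) * τ + (B : ℂ)) / (D : ℂ)).im = _
    rw [him, this]
    field_simp
  · set w : ℍ := ⟨((A : ℂ) * τ + B) / D, hpos τ⟩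
    have hw : (w : ℂ) = (A * τ + B) / D := rfl
    have hDC : (D : ℂ) ≠ 0 := by exact_mod_cast hDpos.ne'
    have hden : (q : ℂ) * w + u = ((c : ℂ) * τ + d) / D := by
      have e1 : (q : ℤ) * B + u * D = d := by
        rw [← hDval]; simp only [B]; linear_combination d * huv
      have e2 : (q : ℂ) * B + u * D = d := by exact_mod_cast congrArg (Int.cast : ℤ → ℂ) e1
      have e3 : (c : ℂ) = A * q := by exact_mod_cast congrArg (Int.cast : ℤ → ℂ) hq
      rw [hw, eq_div_iff hDC, add_mul, mul_assoc, div_mul_cancel₀ _ hDC, e3, ← e2]; ring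
    have hnum : (p : ℂ) * w - v = (δ : ℂ) * ((a : ℂ) * τ + b) / D := by
      have e1 : (p : ℤ) * B - v * D = δ * b := by
        rw [← hDval]; simp only [B]; linear_combination δ * b * huv
      have e2 : (p : ℂ) * B - v * D = δ * b := by exact_mod_cast congrArg (Int.cast : ℤ → ℂ) e1
      have e3 : (p : ℂ) * A = δ * a := by
        have : p * A = δ * a := by rw [hD]; simp only [p]; ring
        exact_mod_cast congrArg (Int.cast : ℤ → ℂ) this
      rw [hw, eq_div_iff hDC, sub_mul, mul_assoc, div_mul_cancel₀ _ hDC]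
      linear_combination τ * e3 + e2
    have hcd : (c : ℂ) * τ + d ≠ 0 := by
      intro h0
      have h1 : (γ' 1 0 : ℂ) * w + (γ' 1 1 : ℤ) ≠ 0 := by
        have := UpperHalfPlane.denom_ne_zero (γ' : GL (Fin 2) ℝ) w
        simpa [UpperHalfPlane.denom] using this
      apply h1
      simpa [γ', h0] using hden
    have key : ((γ' • w : ℍ) : ℂ) = δ * (γ • τ : ℍ) := by
      have e1 : ((γ' • w : ℍ) : ℂ) = ((p : ℂ) * w - v) / ((q : ℂ) * w + u) := by
        rw [coe_smul_SL]; simp [γ', sub_eq_add_neg]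
      rw [e1, hden, hnum, coe_smul_SL, div_div_div_cancel_right₀ hDC, mul_div_assoc]
    rw [← key, ← norm_pow, show eta (γ' • w : ℍ) ^ 24 = discriminant (γ' • w) from rfl,
      discriminant_smul, norm_mul, norm_pow]
    have e2 : ((γ' 1 0 : ℤ) : ℂ) * w + (γ' 1 1 : ℤ) = ((c : ℂ) * τ + d) / D := by
      rw [← hden]; simp [γ']
    rw [e2, norm_div, discriminant, norm_pow]
    congr 3
    simpa using abs_of_pos hDR

/-- `24 / w` times the order of the eta product at the cusp `γ ∞` of denominator `c = γ 1 0` and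
width `w`. -/
noncomputable def etaOrder (N : ℕ) (r : ℕ → ℤ) (c : ℤ) : ℝ :=
  ∑ δ ∈ N.divisors, (r δ : ℝ) * ((Int.gcd c δ : ℝ) ^ 2 / δ)

/-- The growth of an eta product at the cusp `γ ∞`. -/
theorem tendsto_norm_etaProduct_smul (N : ℕ) (r : ℕ → ℤ) (γ : SL(2, ℤ)) :
    ∃ C : ℝ, 0 < C ∧ Tendsto (fun τ : ℍ => ‖etaProduct N r (γ • τ)‖ ^ 24 *
      Real.exp (2 * Real.pi * (etaOrder N r (γ 1 0) * τ.im)) *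
      ‖((γ 1 0 : ℤ) : ℂ) * τ + (γ 1 1 : ℤ)‖ ^ (-12 * ∑ δ ∈ N.divisors, r δ)) atImInfty (𝓝 C) := by
  have hterm : ∀ δ ∈ N.divisors, ∃ C : ℝ, 0 < C ∧ Tendsto (fun τ : ℍ =>
      ‖eta (δ * (γ • τ : ℍ))‖ ^ 24 *
        Real.exp (2 * Real.pi * ((Int.gcd (γ 1 0) δ : ℝ) ^ 2 / δ * τ.im)) *
        (‖((γ 1 0 : ℤ) : ℂ) * τ + (γ 1 1 : ℤ)‖ ^ 12)⁻¹) atImInfty (𝓝 C) := by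
    intro δ hδ
    have hδ0 := Nat.pos_of_mem_divisors hδ
    obtain ⟨D, hD, w, hw⟩ := norm_eta_mul_smul_pow γ hδ0
    refine ⟨(D ^ 12)⁻¹, by positivity, ?_⟩
    have hκ : 0 < (Int.gcd (γ 1 0) δ : ℝ) ^ 2 / δ := by
      have : 0 < Int.gcd (γ 1 0) δ := Int.gcd_pos_of_ne_zero_right _ (by exact_mod_cast hδ0.ne')
      positivity
    have hwt : Tendsto w atImInfty atImInfty := by
      rw [atImInfty, tendsto_comap_iff]
      have : UpperHalfPlane.im ∘ w =
          fun τ => (Int.gcd (γ 1 0) δ : ℝ) ^ 2 / δ * τ.im := funext fun τ => (hw τ).1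
      rw [this]
      exact (tendsto_comap (f := UpperHalfPlane.im)).const_mul_atTop hκ
    have h := ((tendsto_norm_eta_pow.comp hwt).const_mul (D ^ 12)⁻¹)
    rw [mul_one] at h
    refine h.congr fun τ => ?_
    have hden : ‖((γ 1 0 : ℤ) : ℂ) * τ + (γ 1 1 : ℤ)‖ ≠ 0 := by
      have := UpperHalfPlane.denom_ne_zero (γ : GL (Fin 2) ℝ) τ
      refine norm_ne_zero_iff.mpr ?_
      simpa [UpperHalfPlane.denom] using this
    rw [Function.comp_apply, (hw τ).2, (hw τ).1, div_pow]
    field_simp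
  choose! C hC hCt using hterm
  refine ⟨∏ δ ∈ N.divisors, C δ ^ r δ, Finset.prod_pos fun δ hδ => zpow_pos (hC δ hδ) _, ?_⟩
  have h := tendsto_finsetProd N.divisors fun δ hδ =>
    (hCt δ hδ).zpow₀ (r δ) (Or.inl (hC δ hδ).ne')
  refine h.congr fun τ => ?_
  have hden : ‖((γ 1 0 : ℤ) : ℂ) * τ + (γ 1 1 : ℤ)‖ ≠ 0 := by
    have := UpperHalfPlane.denom_ne_zero (γ : GL (Fin 2) ℝ) τ
    refine norm_ne_zero_iff.mpr ?_
    simpa [UpperHalfPlane.denom] using this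
  simp_rw [mul_zpow]
  rw [Finset.prod_mul_distrib, Finset.prod_mul_distrib]
  congr 1
  · congr 1
    · rw [etaProduct, norm_prod, ← Finset.prod_pow]
      refine Finset.prod_congr rfl fun δ _ => ?_
      rw [norm_zpow, ← zpow_natCast, ← zpow_natCast, zpow_comm]
    · rw [etaOrder, Finset.sum_mul, Finset.mul_sum, Real.exp_sum]
      refine Finset.prod_congr rfl fun δ _ => ?_
      rw [← Real.rpow_intCast, ← Real.exp_mul]
      congr 1; ring
  · generalize N.divisors = S
    classical
    induction S using Finset.induction_on with
    | empty => simp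
    | insert a S ha ih =>
      rw [Finset.prod_insert ha, Finset.sum_insert ha, mul_add, zpow_add₀ hden, ih, zpow_mul _ _ (r a)]
      rw [show (-12 : ℤ) = -((12 : ℕ) : ℤ) from rfl, zpow_neg, zpow_natCast]

lemma mdifferentiable_etaProduct (N : ℕ) (r : ℕ → ℤ) : MDiff (etaProduct N r) := by
  rw [UpperHalfPlane.mdifferentiable_iff]
  have hpos : ∀ δ ∈ N.divisors, ∀ z : ℂ, 0 < z.im → 0 < ((δ : ℂ) * z).im := by
    intro δ hδ z hz
    have : (0 : ℝ) < δ := by exact_mod_cast Nat.pos_of_mem_divisors hδ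
    simpa using mul_pos this hz
  have : DifferentiableOn ℂ (fun z : ℂ => ∏ δ ∈ N.divisors, eta ((δ : ℂ) * z) ^ r δ)
      {z | 0 < z.im} := by
    refine DifferentiableOn.fun_finsetProd fun δ hδ z hz => ?_
    refine DifferentiableAt.differentiableWithinAt ?_
    refine DifferentiableAt.zpow ?_ (Or.inl (eta_ne_zero (hpos δ hδ z hz)))
    exact (differentiableAt_eta_of_mem_upperHalfPlaneSet (hpos δ hδ z hz)).comp z (by fun_prop)
  refine this.congr fun z hz => ?_
  simp [etaProduct, ofComplex_apply_of_im_pos hz]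

end ModularForm

lemma UpperHalfPlane.mdifferentiable_comp_smul {f : ℍ → ℂ} (hf : MDiff f) (γ : SL(2, ℤ)) :
    MDiff (fun τ : ℍ => f (γ • τ)) :=
  hf.comp (UpperHalfPlane.mdifferentiable_smul (g := (γ : GL (Fin 2) ℝ)) (by simp))

-- Expansions in the local parameter at a cusp

local notation "𝕢" => Function.Periodic.qParam

namespace UpperHalfPlane

lemma mdifferentiable_qParam_zpow (h : ℝ) (m : ℤ) : MDiff (fun τ : ℍ => 𝕢 h τ ^ m) := by
  rw [UpperHalfPlane.mdifferentiable_iff]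
  have : Differentiable ℂ (fun z : ℂ => 𝕢 h z ^ m) := fun z =>
    (Function.Periodic.differentiable_qParam z).zpow (Or.inl (Function.Periodic.qParam_ne_zero z))
  refine this.differentiableOn.congr fun z hz => ?_
  simp [ofComplex_apply_of_im_pos hz]

lemma qParam_vadd {h : ℝ} (hh : h ≠ 0) (τ : ℍ) : 𝕢 h ((h +ᵥ τ : ℍ) : ℂ) = 𝕢 h τ := by
  rw [coe_vadd, Function.Periodic.qParam, Function.Periodic.qParam, Complex.exp_eq_exp_iff_exists_int]
  refine ⟨1, ?_⟩
  have : (h : ℂ) ≠ 0 := by exact_mod_cast hh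
  field_simp
  push_cast
  ring

lemma periodic_comp_ofComplex {f : ℍ → ℂ} {h : ℝ} (hper : ∀ τ : ℍ, f (h +ᵥ τ) = f τ) :
    Function.Periodic (f ∘ ofComplex) h := by
  intro w
  by_cases! hw : 0 < w.im
  · have : 0 < (w + h).im := by simp [hw]
    simp only [Function.comp_apply, ofComplex_apply_of_im_pos this, ofComplex_apply_of_im_pos hw]
    rw [← hper ⟨w, hw⟩]
    congr 1
    ext
    simp [add_comm]
  · have : (w + h).im ≤ 0 := by simpa using hw
    simp [ofComplex_apply_of_im_nonpos this, ofComplex_apply_of_im_nonpos hw]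

/-- A holomorphic function on `ℍ` of period `h` that is `O(q_h ^ (-m))` at `i∞` is `q_h ^ (-m)`
times an analytic function of `q_h`. -/
lemma exists_analyticAt_eq_qParam_zpow_mul {f : ℍ → ℂ} {h : ℝ} (hh : 0 < h)
    (hper : ∀ τ : ℍ, f (h +ᵥ τ) = f τ) (hf : MDiff f) {m : ℤ}
    (hb : IsBoundedAtImInfty fun τ : ℍ => 𝕢 h τ ^ m * f τ) :
    ∃ G : ℂ → ℂ, AnalyticAt ℂ G 0 ∧ ∀ τ : ℍ, f τ = 𝕢 h τ ^ (-m) * G (𝕢 h τ) := by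
  set g : ℍ → ℂ := fun τ => 𝕢 h τ ^ m * f τ
  have hg : MDiff g := (mdifferentiable_qParam_zpow h m).mul hf
  have hgper : Function.Periodic (g ∘ ofComplex) h := by
    refine periodic_comp_ofComplex fun τ => ?_
    simp only [g]
    rw [hper, qParam_vadd hh.ne']
  refine ⟨cuspFunction h g, analyticAt_cuspFunction_zero hh hgper hg hb, fun τ => ?_⟩
  rw [eq_cuspFunction τ hh.ne' hgper, ← mul_assoc,
    ← zpow_add₀ (Function.Periodic.qParam_ne_zero _)]
  simp

lemma exists_meromorphicAt_eq_qParam {f : ℍ → ℂ} {h : ℝ} (hh : 0 < h)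
    (hper : ∀ τ : ℍ, f (h +ᵥ τ) = f τ) (hf : MDiff f) {m : ℤ}
    (hb : IsBoundedAtImInfty fun τ : ℍ => 𝕢 h τ ^ m * f τ) :
    ∃ F : ℂ → ℂ, MeromorphicAt F 0 ∧ ∀ τ : ℍ, f τ = F (𝕢 h τ) := by
  obtain ⟨G, hG, hfG⟩ := exists_analyticAt_eq_qParam_zpow_mul hh hper hf hb
  exact ⟨fun z => z ^ (-m) * G z, ((MeromorphicAt.id 0).zpow _).mul hG.meromorphicAt, hfG⟩

/-- The analytic cofactor `G` satisfies `‖G 0‖ = C ≠ 0`, so the power of `q_h` is the exact order.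
-/
lemma exists_meromorphicOrderAt_eq {f : ℍ → ℂ} {h : ℝ} (hh : 0 < h)
    (hper : ∀ τ : ℍ, f (h +ᵥ τ) = f τ) (hf : MDiff f) {m : ℤ} {C : ℝ} (hC : C ≠ 0)
    (hb : Tendsto (fun τ : ℍ => ‖𝕢 h τ ^ m * f τ‖) atImInfty (𝓝 C)) :
    ∃ F : ℂ → ℂ, MeromorphicAt F 0 ∧ meromorphicOrderAt F 0 = ((-m : ℤ) : WithTop ℤ) ∧
      ∀ τ : ℍ, f τ = F (𝕢 h τ) := by
  obtain ⟨G, hG, hfG⟩ := exists_analyticAt_eq_qParam_zpow_mul hh hper hf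
    (m := m) (hb.isBigO_one ℝ).of_norm_left
  refine ⟨fun z => z ^ (-m) * G z, ((MeromorphicAt.id 0).zpow _).mul hG.meromorphicAt, ?_, hfG⟩
  have hG0 : G 0 ≠ 0 := by
    have h1 : Tendsto (fun τ : ℍ => ‖G (𝕢 h τ)‖) atImInfty (𝓝 ‖G 0‖) :=
      (hG.continuousAt.tendsto.comp (qParam_tendsto_atImInfty hh)).norm
    have h2 : (fun τ : ℍ => ‖𝕢 h τ ^ m * f τ‖) = fun τ : ℍ => ‖G (𝕢 h τ)‖ := by
      funext τ
      rw [hfG, ← mul_assoc, ← zpow_add₀ (Function.Periodic.qParam_ne_zero _)]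
      simp
    rw [h2] at hb
    have := tendsto_nhds_unique hb h1
    intro h0
    rw [h0, norm_zero] at this
    exact hC this
  have hF : MeromorphicAt (fun z => z ^ (-m) * G z) 0 :=
    ((MeromorphicAt.id 0).zpow _).mul hG.meromorphicAt
  rw [meromorphicOrderAt_eq_int_iff hF]
  exact ⟨G, hG, hG0, by simp⟩

/-- `γ T ^ N γ⁻¹` lies in `Γ(N)`, which is normal in `SL(2, ℤ)` and contained in `Γ₀(N)`. Hence `N`
is a period at every cusp, whatever its width. -/
lemma smul_vadd_natCast_eq {N : ℕ} {f : ℍ → ℂ}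
    (hinv : ∀ γ ∈ CongruenceSubgroup.Gamma0 N, ∀ τ, f (γ • τ) = f τ) (γ : SL(2, ℤ)) (τ : ℍ) :
    f (γ • (((N : ℕ) : ℝ) +ᵥ τ : ℍ)) = f (γ • τ) := by
  have h1 : ModularGroup.T ^ (N : ℤ) ∈ CongruenceSubgroup.Gamma N := by
    simpa using CongruenceSubgroup.ModularGroup_T_pow_mem_Gamma (N : ℤ) N dvd_rfl
  have h2 := (CongruenceSubgroup.Gamma_normal N).conj_mem _ h1 γ
  have h3 : γ * ModularGroup.T ^ (N : ℤ) * γ⁻¹ ∈ CongruenceSubgroup.Gamma0 N := by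
    rw [CongruenceSubgroup.Gamma_mem] at h2
    exact CongruenceSubgroup.Gamma0_mem.mpr h2.2.2.1
  rw [← hinv _ h3 (γ • τ), ← mul_smul, inv_mul_cancel_right, mul_smul, modular_T_zpow_smul]
  simp

lemma meromorphicOn_comp_ofComplex {f : ℍ → ℂ} (hf : MDiff f) :
    MeromorphicOn (f ∘ ofComplex) upperHalfPlaneSet := by
  rw [UpperHalfPlane.mdifferentiable_iff] at hf
  exact fun z hz => (hf.analyticAt (isOpen_upperHalfPlaneSet.mem_nhds hz)).meromorphicAt

lemma isModularFunction_of_mdifferentiable {N : ℕ} (hN : 0 < N) {f : ℍ → ℂ} (hf : MDiff f)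
    (hinv : ∀ γ ∈ CongruenceSubgroup.Gamma0 N, ∀ τ, f (γ • τ) = f τ)
    (hb : ∀ γ : SL(2, ℤ), ∃ m : ℤ, IsBoundedAtImInfty fun τ : ℍ => 𝕢 N τ ^ m * f (γ • τ)) :
    IsModularFunction N f where
  meromorphic := meromorphicOn_comp_ofComplex hf
  invariant γ hγ := Eventually.of_forall (hinv γ hγ)
  meromorphic_cusps γ := by
    obtain ⟨m, hm⟩ := hb γ
    obtain ⟨F, hF, hfF⟩ := exists_meromorphicAt_eq_qParam (by exact_mod_cast hN)
      (smul_vadd_natCast_eq hinv γ) (mdifferentiable_comp_smul hf γ) hm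
    exact ⟨F, hF, Eventually.of_forall hfF⟩

end UpperHalfPlane

namespace ModularForm

lemma tendsto_norm_etaProduct_smul_of_sum_eq_zero {N : ℕ} {r : ℕ → ℤ}
    (h0 : ∑ δ ∈ N.divisors, r δ = 0) (γ : SL(2, ℤ)) :
    ∃ C : ℝ, 0 < C ∧ Tendsto (fun τ : ℍ => ‖etaProduct N r (γ • τ)‖ ^ 24 *
      Real.exp (2 * Real.pi * (etaOrder N r (γ 1 0) * τ.im))) atImInfty (𝓝 C) := by
  simpa [h0] using tendsto_norm_etaProduct_smul N r γ

lemma norm_qParam_zpow_mul_pow {N : ℕ} (hN : 0 < N) (m : ℤ) (τ : ℍ) (z : ℂ) :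
    ‖𝕢 N τ ^ m * z‖ ^ 24 = ‖z‖ ^ 24 * Real.exp (2 * Real.pi * (-(24 * m / N) * τ.im)) := by
  have hN' : (N : ℝ) ≠ 0 := by exact_mod_cast hN.ne'
  rw [norm_mul, norm_zpow, Function.Periodic.norm_qParam, mul_pow, mul_comm, ← Real.rpow_intCast,
    ← Real.rpow_natCast (_ ^ _), ← Real.rpow_mul (Real.exp_pos _).le, ← Real.exp_mul]
  congr 2
  rw [coe_im]
  push_cast
  field_simp

lemma isModularFunction_etaProduct {N : ℕ} (hN : 0 < N) {r : ℕ → ℤ}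
    (h0 : ∑ δ ∈ N.divisors, r δ = 0)
    (hinv : ∀ γ ∈ CongruenceSubgroup.Gamma0 N, ∀ τ,
      etaProduct N r (γ • τ) = etaProduct N r τ) :
    IsModularFunction N (etaProduct N r) := by
  refine isModularFunction_of_mdifferentiable hN (mdifferentiable_etaProduct N r) hinv fun γ => ?_
  obtain ⟨C, -, hC⟩ := tendsto_norm_etaProduct_smul_of_sum_eq_zero h0 γ
  -- Any integer at least the pole order, measured in `q_N`, will do.
  obtain ⟨m, hm⟩ := exists_nat_ge (-(N * etaOrder N r (γ 1 0)) / 24)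
  have hN' : (0 : ℝ) < N := by exact_mod_cast hN
  refine ⟨m, ?_⟩
  have h1 : (fun τ : ℍ => ‖𝕢 N τ ^ (m : ℤ) * etaProduct N r (γ • τ)‖ ^ 24) =O[atImInfty]
      (1 : ℍ → ℝ) := by
    refine Asymptotics.IsBigO.trans (Asymptotics.IsBigO.of_bound 1 (Eventually.of_forall fun τ => ?_))
      (hC.isBigO_one ℝ)
    rw [norm_qParam_zpow_mul_pow hN, one_mul, Real.norm_of_nonneg (by positivity),
      Real.norm_of_nonneg (by positivity)]
    have hτ := τ.im_pos
    gcongr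
    rw [div_le_iff₀ (by norm_num)] at hm
    rw [neg_le_iff_add_nonneg', Int.cast_natCast]
    have : 0 ≤ (24 * m + N * etaOrder N r (γ 1 0)) / N := by
      apply div_nonneg _ hN'.le
      linarith
    rw [add_div, mul_div_cancel_left₀ _ hN'.ne'] at this
    linarith
  have h2 : (fun τ : ℍ => (𝕢 N τ ^ (m : ℤ) * etaProduct N r (γ • τ)) ^ 24) =O[atImInfty]
      (fun τ : ℍ => (1 : ℝ) ^ 24) := by
    refine Asymptotics.IsBigO.of_norm_left ?_
    simpa [norm_pow, Pi.one_def] using h1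
  exact h2.of_pow (by norm_num)

/-- The leading term of an eta product at the cusp `γ ∞`. -/
lemma tendsto_norm_qParam_zpow_mul_etaProduct_smul {N : ℕ} (hN : 0 < N) {r : ℕ → ℤ}
    (h0 : ∑ δ ∈ N.divisors, r δ = 0) (γ : SL(2, ℤ)) {m : ℤ}
    (hm : N * etaOrder N r (γ 1 0) = 24 * m) :
    ∃ C : ℝ, 0 < C ∧ Tendsto (fun τ : ℍ => ‖𝕢 N τ ^ (-m) * etaProduct N r (γ • τ)‖)
      atImInfty (𝓝 C) := by
  have hN' : (N : ℝ) ≠ 0 := by exact_mod_cast hN.ne'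
  obtain ⟨C, hC0, hC⟩ := tendsto_norm_etaProduct_smul_of_sum_eq_zero h0 γ
  refine ⟨C ^ (1 / 24 : ℝ), by positivity, ?_⟩
  have h1 := hC.rpow_const (p := 1 / 24) (Or.inl hC0.ne')
  refine h1.congr fun τ => ?_
  have : etaOrder N r (γ 1 0) = 24 * m / N := by
    rw [← hm]; field_simp
  rw [this]
  have h2 := norm_qParam_zpow_mul_pow hN (-m) τ (etaProduct N r (γ • τ))
  push_cast at h2
  rw [mul_neg, neg_div, neg_neg] at h2
  rw [← h2, ← Real.rpow_natCast, ← Real.rpow_mul (norm_nonneg _)]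
  norm_num

/-- The expansion of an eta product at `i∞`. -/
lemma exists_analyticAt_etaProduct_eq (N : ℕ) (r : ℕ → ℤ) {m : ℤ}
    (hm : ∑ δ ∈ N.divisors, r δ * (δ : ℤ) = 24 * m) :
    ∃ G : ℂ → ℂ, AnalyticAt ℂ G 0 ∧ G 0 = 1 ∧
      ∀ τ : ℍ, etaProduct N r τ = 𝕢 1 τ ^ m * G (𝕢 1 τ) := by
  set φ : ℂ → ℂ := fun q => ∏' n : ℕ, (1 - q ^ (n + 1))
  have hφ0 : φ 0 = 1 := by simp [φ]
  have hφ : AnalyticAt ℂ φ 0 :=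
    differentiableOn_tprod_one_sub_pow.analyticAt (Metric.ball_mem_nhds 0 one_pos)
  refine ⟨fun q => ∏ δ ∈ N.divisors, φ (q ^ δ) ^ r δ, ?_, ?_, fun τ => ?_⟩
  · refine Finset.analyticAt_fun_prod _ fun δ hδ => ?_
    have hδ0 : δ ≠ 0 := (Nat.pos_of_mem_divisors hδ).ne'
    refine AnalyticAt.zpow ?_ (by simp [hδ0, hφ0])
    refine AnalyticAt.fun_comp (by simpa [hδ0] using hφ) (by fun_prop)
  · refine Finset.prod_eq_one fun δ hδ => ?_
    have hδ0 : δ ≠ 0 := (Nat.pos_of_mem_divisors hδ).ne'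
    simp [hδ0, hφ0]
  · have h1 : ∀ δ : ℕ, eta ((δ : ℂ) * τ) = 𝕢 24 τ ^ δ * φ (𝕢 1 τ ^ δ) := by
      intro δ
      have h2 : ∀ h : ℝ, 𝕢 h ((δ : ℂ) * τ) = 𝕢 h τ ^ δ := by
        intro h
        rw [Function.Periodic.qParam, Function.Periodic.qParam, ← Complex.exp_nat_mul]
        congr 1; ring
      rw [eta, h2]
      simp only [φ, eta_q, h2]
    simp_rw [etaProduct, h1, mul_zpow]
    rw [Finset.prod_mul_distrib]
    congr 1
    have h3 : 𝕢 1 (τ : ℂ) = 𝕢 24 τ ^ (24 : ℤ) := by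
      rw [Function.Periodic.qParam, Function.Periodic.qParam, ← Complex.exp_int_mul]
      congr 1
      push_cast
      ring
    rw [h3, ← zpow_mul, ← hm]
    have hq : 𝕢 24 (τ : ℂ) ≠ 0 := Function.Periodic.qParam_ne_zero _
    generalize N.divisors = S
    induction S using Finset.induction_on with
    | empty => simp
    | insert a S ha ih =>
      rw [Finset.prod_insert ha, Finset.sum_insert ha, zpow_add₀ hq, ih, ← zpow_natCast,
        ← zpow_mul, mul_comm (a : ℤ)]

lemma etaProduct_qExpansion {N : ℕ} {r : ℕ → ℤ}
    (ha : ∑ δ ∈ N.divisors, r δ * (δ : ℤ) = -24) :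
    Tendsto (fun τ : ℍ => 𝕢 1 τ * etaProduct N r τ) atImInfty (𝓝 1) ∧
    IsBoundedAtImInfty (fun τ : ℍ => etaProduct N r τ - (𝕢 1 (τ : ℂ))⁻¹) := by
  obtain ⟨G, hG, hG0, h⟩ := exists_analyticAt_etaProduct_eq N r (m := -1) (by rw [ha]; rfl)
  have hq := qParam_tendsto_atImInfty one_pos
  constructor
  · have := hG.continuousAt.tendsto.comp hq
    rw [hG0] at this
    refine this.congr fun τ => ?_
    rw [h, ← mul_assoc, zpow_neg_one, mul_inv_cancel₀ (Function.Periodic.qParam_ne_zero _),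
      one_mul, Function.comp_apply]
  · have h1 := hG.differentiableAt.isBigO_sub.comp_tendsto hq
    have h2 := (Asymptotics.isBigO_refl (fun τ : ℍ => (𝕢 1 (τ : ℂ))⁻¹) atImInfty).mul h1
    refine (h2.congr (fun τ => ?_) (fun τ => ?_) : _ =O[atImInfty] (fun _ : ℍ => (1 : ℂ))).trans
      ?_
    · rw [Function.comp_apply, h, hG0, zpow_neg_one]; ring
    · simp [Function.Periodic.qParam_ne_zero]
    · exact Asymptotics.isBigO_of_le _ fun _ => by simp

end ModularForm

/-! ### Equality of functions off closed discrete sets -/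

namespace UpperHalfPlane

lemma eventually_codiscrete_iff {p : ℍ → Prop} :
    (∀ᶠ τ in codiscrete ℍ, p τ) ↔ ∀ τ : ℍ, ∀ᶠ w in 𝓝[≠] τ, p w := by
  rw [Filter.Eventually, mem_codiscrete]
  simp [disjoint_principal_right, Filter.Eventually]

lemma tendsto_coe_nhdsNE (τ : ℍ) : Tendsto ((↑) : ℍ → ℂ) (𝓝[≠] τ) (𝓝[≠] (τ : ℂ)) :=
  tendsto_nhdsWithin_of_tendsto_nhds_of_eventually_within _
    (continuous_coe.continuousAt.tendsto.mono_left nhdsWithin_le_nhds)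
    (eventually_mem_nhdsWithin.mono fun _ hw h => hw (UpperHalfPlane.ext h))

lemma tendsto_ofComplex_nhdsNE (τ : ℍ) : Tendsto ofComplex (𝓝[≠] (τ : ℂ)) (𝓝[≠] τ) := by
  refine tendsto_nhdsWithin_of_tendsto_nhds_of_eventually_within _ ?_ ?_
  · have : ContinuousAt ofComplex (τ : ℂ) :=
      (contMDiffAt_ofComplex (n := ⊤) τ.im_pos).continuousAt
    simpa using! this.tendsto.mono_left nhdsWithin_le_nhds
  · filter_upwards [eventually_mem_nhdsWithin,
      mem_nhdsWithin_of_mem_nhds (isOpen_upperHalfPlaneSet.mem_nhds τ.im_pos)] with z hz hz' h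
    apply hz
    rw [Set.mem_singleton_iff] at h ⊢
    rw [← h, ofComplex_apply_of_im_pos hz']

instance neBot_nhdsNE (τ : ℍ) : (𝓝[≠] τ).NeBot := (tendsto_ofComplex_nhdsNE τ).neBot

lemma eventuallyEq_comp_ofComplex {f g : ℍ → ℂ} (h : f =ᶠ[codiscrete ℍ] g) (τ : ℍ) :
    f ∘ ofComplex =ᶠ[𝓝[≠] (τ : ℂ)] g ∘ ofComplex :=
  (tendsto_ofComplex_nhdsNE τ).eventually (eventually_codiscrete_iff.mp h τ)

lemma tendsto_smul_codiscrete (γ : SL(2, ℤ)) :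
    Tendsto (fun τ : ℍ => γ • τ) (codiscrete ℍ) (codiscrete ℍ) := by
  intro s hs
  refine eventually_codiscrete_iff.mpr fun τ => ?_
  have : Tendsto (fun w : ℍ => γ • w) (𝓝[≠] τ) (𝓝[≠] (γ • τ)) :=
    tendsto_nhdsWithin_of_tendsto_nhds_of_eventually_within _
      ((UpperHalfPlane.mdifferentiable_smul (g := (γ : GL (Fin 2) ℝ)) (by simp)
        ).continuous.continuousAt.tendsto.mono_left nhdsWithin_le_nhds)
      (eventually_mem_nhdsWithin.mono fun _ hw h => hw (MulAction.injective γ h))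
  exact this.eventually (eventually_codiscrete_iff.mp hs (γ • τ))

lemma dense_of_mem_codiscrete {s : Set ℍ} (hs : s ∈ codiscrete ℍ) : Dense s := fun τ => by
  have := eventually_codiscrete_iff.mp hs τ
  exact mem_closure_iff_frequently.mpr
    (this.frequently.filter_mono nhdsWithin_le_nhds)

/-- Codiscrete subsets of `ℍ` are dense. -/
lemma eq_of_eventuallyEq_codiscrete {f g : ℍ → ℂ} (hf : Continuous f) (hg : Continuous g)
    (h : f =ᶠ[codiscrete ℍ] g) : f = g :=
  hf.ext_on (dense_of_mem_codiscrete h) hg fun _ hx => hx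

lemma analyticAt_comp_ofComplex {f : ℍ → ℂ} (hf : MDiff f) (τ : ℍ) :
    AnalyticAt ℂ (f ∘ ofComplex) τ :=
  (UpperHalfPlane.mdifferentiable_iff.mp hf).analyticAt
    (isOpen_upperHalfPlaneSet.mem_nhds τ.im_pos)

/-- Removal of the removable singularities of a meromorphic function. -/
lemma exists_mdifferentiable_eventuallyEq {f : ℍ → ℂ}
    (hf : MeromorphicOn (f ∘ ofComplex) upperHalfPlaneSet)
    (h : ∀ τ : ℍ, 0 ≤ meromorphicOrderAt (f ∘ ofComplex) τ) :
    ∃ G : ℍ → ℂ, MDiff G ∧ f =ᶠ[codiscrete ℍ] G := by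
  set F := toMeromorphicNFOn (f ∘ ofComplex) upperHalfPlaneSet
  have hF : ∀ z ∈ upperHalfPlaneSet, AnalyticAt ℂ F z := by
    intro z hz
    have h1 := meromorphicNFOn_toMeromorphicNFOn (f ∘ ofComplex) upperHalfPlaneSet hz
    rw [← h1.meromorphicOrderAt_nonneg_iff_analyticAt, meromorphicOrderAt_toMeromorphicNFOn hf hz]
    exact h ⟨z, hz⟩
  refine ⟨fun τ => F τ, ?_, ?_⟩
  · rw [UpperHalfPlane.mdifferentiable_iff]
    refine DifferentiableOn.congr (f := F)
      (fun z hz => (hF z hz).differentiableAt.differentiableWithinAt) fun z hz => ?_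
    simp [ofComplex_apply_of_im_pos hz]
  · refine eventually_codiscrete_iff.mpr fun τ => ?_
    have h1 := hf.toMeromorphicNFOn_eq_self_on_nhdsNE τ.im_pos
    filter_upwards [(tendsto_coe_nhdsNE τ).eventually h1] with w hw
    simpa using hw.symm

/-- The zeros of a nonzero holomorphic function on `ℍ` are isolated. -/
lemma eventually_codiscrete_ne_zero {f : ℍ → ℂ} (hf : MDiff f) (h0 : f ≠ 0) :
    ∀ᶠ τ in codiscrete ℍ, f τ ≠ 0 := by
  refine eventually_codiscrete_iff.mpr fun τ => ?_
  by_contra hc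
  exact h0 (UpperHalfPlane.eq_zero_of_frequently hf (not_eventually.mp hc |>.mono fun _ h => not_not.mp h))

end UpperHalfPlane

/-! ### Functions with a single simple pole generate the function field -/

namespace UpperHalfPlane

lemma mdifferentiable_polynomial_eval {h : ℍ → ℂ} (hh : MDiff h) (Q : ℂ[X]) :
    MDiff (fun τ => Q.eval (h τ)) := by
  rw [UpperHalfPlane.mdifferentiable_iff] at hh ⊢
  exact fun z hz => (Q.differentiable.differentiableAt).comp_differentiableWithinAt z (hh z hz)

lemma meromorphicOrderAt_mul_nonneg {f g : ℍ → ℂ} (hf : MDiff f) {τ : ℍ}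
    (hg : MeromorphicAt (g ∘ ofComplex) τ) (h0 : 0 ≤ meromorphicOrderAt (g ∘ ofComplex) τ) :
    0 ≤ meromorphicOrderAt ((fun τ => f τ * g τ) ∘ ofComplex) τ := by
  have hf' := analyticAt_comp_ofComplex hf τ
  rw [show (fun τ => f τ * g τ) ∘ ofComplex = (f ∘ ofComplex) * (g ∘ ofComplex) from rfl,
    meromorphicOrderAt_mul hf'.meromorphicAt hg]
  exact add_nonneg hf'.meromorphicOrderAt_nonneg h0

/-- The poles of a meromorphic function on a compact subset of `ℍ` can be removed by a polynomial
in a given holomorphic function. -/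
lemma exists_polynomial_meromorphicOrderAt_nonneg {h g : ℍ → ℂ} (hh : MDiff h)
    (hg : MeromorphicOn (g ∘ ofComplex) upperHalfPlaneSet) {K : Set ℍ} (hK : IsCompact K) :
    ∃ Q : ℂ[X], Q ≠ 0 ∧
      ∀ τ ∈ K, 0 ≤ meromorphicOrderAt ((fun τ => Q.eval (h τ) * g τ) ∘ ofComplex) τ := by
  have hmero : ∀ (Q : ℂ[X]) (τ : ℍ),
      MeromorphicAt ((fun τ => Q.eval (h τ) * g τ) ∘ ofComplex) τ := fun Q τ =>
    (analyticAt_comp_ofComplex (mdifferentiable_polynomial_eval hh Q) τ).meromorphicAt.mul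
      (hg τ τ.im_pos)
  refine hK.induction_on (p := fun s => ∃ Q : ℂ[X], Q ≠ 0 ∧
      ∀ τ ∈ s, 0 ≤ meromorphicOrderAt ((fun τ => Q.eval (h τ) * g τ) ∘ ofComplex) τ)
    ⟨1, one_ne_zero, by simp⟩ ?_ ?_ ?_
  · rintro s t hst ⟨Q, hQ, h⟩
    exact ⟨Q, hQ, fun τ hτ => h τ (hst hτ)⟩
  · rintro s t ⟨Q, hQ, hs⟩ ⟨R, hR, ht⟩
    refine ⟨Q * R, mul_ne_zero hQ hR, fun τ hτ => ?_⟩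
    rcases hτ with hτ | hτ
    · convert! meromorphicOrderAt_mul_nonneg (mdifferentiable_polynomial_eval hh R)
        (hmero Q τ) (hs τ hτ) using 3
      funext τ
      rw [eval_mul]; ring
    · convert! meromorphicOrderAt_mul_nonneg (mdifferentiable_polynomial_eval hh Q)
        (hmero R τ) (ht τ hτ) using 3
      funext τ
      rw [eval_mul]; ring
  · intro τ _
    have hτ := hg τ τ.im_pos
    obtain ⟨n, hn⟩ : ∃ n : ℕ, 0 ≤ (n : WithTop ℤ) + meromorphicOrderAt (g ∘ ofComplex) τ := by
      cases hk : meromorphicOrderAt (g ∘ ofComplex) (τ : ℂ) with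
      | top => exact ⟨0, by simp⟩
      | coe k =>
        refine ⟨k.natAbs, ?_⟩
        have : (0 : ℤ) ≤ (k.natAbs : ℤ) + k := by omega
        rw [← WithTop.coe_natCast, ← WithTop.coe_add]
        exact WithTop.coe_le_coe.mpr this
    -- `h - h τ` vanishes at `τ`, so its `n`-th power cancels a pole of order at most `n`. Near `τ`
    -- there is no other pole of `g`, so the same `Q` serves on a neighbourhood; compactness leaves
    -- finitely many factors.
    set Q : ℂ[X] := (X - C (h τ)) ^ n
    have h1 : 0 ≤ meromorphicOrderAt ((fun τ => Q.eval (h τ) * g τ) ∘ ofComplex) τ := by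
      have hA : AnalyticAt ℂ (fun z => h (ofComplex z) - h τ) τ :=
        (analyticAt_comp_ofComplex hh τ).sub analyticAt_const
      have e : (fun τ => Q.eval (h τ) * g τ) ∘ ofComplex =
          (fun z => h (ofComplex z) - h τ) ^ n * (g ∘ ofComplex) := by
        funext z; simp [Q]
      rw [e, meromorphicOrderAt_mul (hA.meromorphicAt.pow n) hτ,
        meromorphicOrderAt_pow hA.meromorphicAt]
      have hpos : 0 < meromorphicOrderAt (fun z => h (ofComplex z) - h τ) (τ : ℂ) := by
        rw [← tendsto_zero_iff_meromorphicOrderAt_pos hA.meromorphicAt]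
        simpa using hA.continuousAt.tendsto.mono_left nhdsWithin_le_nhds
      refine hn.trans (add_le_add_left ?_ _)
      cases hk : meromorphicOrderAt (fun z => h (ofComplex z) - h τ) (τ : ℂ) with
      | top =>
        cases n with
        | zero => simp
        | succ n =>
          rw [WithTop.mul_top (by exact_mod_cast n.succ_ne_zero)]
          exact le_top
      | coe k =>
        rw [hk] at hpos
        have hk0 : 0 < k := by exact_mod_cast hpos
        have : (n : ℤ) ≤ n * k := le_mul_of_one_le_right (by positivity) hk0
        exact_mod_cast this
    refine ⟨{w | 0 ≤ meromorphicOrderAt ((fun τ => Q.eval (h τ) * g τ) ∘ ofComplex) w}, ?_, Q,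
      pow_ne_zero _ (X_sub_C_ne_zero _), fun w hw => hw⟩
    refine mem_nhdsWithin_of_mem_nhds ?_
    rw [← pure_sup_nhdsNE, mem_sup]
    refine ⟨h1, ?_⟩
    filter_upwards [(tendsto_coe_nhdsNE τ).eventually hτ.eventually_analyticAt] with w hw
    exact meromorphicOrderAt_mul_nonneg (mdifferentiable_polynomial_eval hh Q) hw.meromorphicAt
      hw.meromorphicOrderAt_nonneg

/-- `F` is analytic on a punctured disc, so the poles of `f` do not accumulate at the cusp. This
confines them, modulo `Γ₀(N)`, to a compact set. -/
lemma eventually_meromorphicOrderAt_nonneg {f : ℍ → ℂ} {h : ℝ} (hh : 0 < h) {F : ℂ → ℂ}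
    (hF : MeromorphicAt F 0) (hf : ∀ᶠ τ : ℍ in atImInfty, f τ = F (𝕢 h τ)) :
    ∀ᶠ τ : ℍ in atImInfty, 0 ≤ meromorphicOrderAt (f ∘ ofComplex) τ := by
  have h1 : ∀ᶠ τ : ℍ in atImInfty, AnalyticAt ℂ F (𝕢 h τ) :=
    (((Function.Periodic.qParam_tendsto hh).comp tendsto_coe_atImInfty).eventually
      hF.eventually_analyticAt)
  obtain ⟨A, hA⟩ := (atImInfty_mem _).mp hf
  filter_upwards [h1, (atImInfty_mem {τ | A < τ.im}).mpr ⟨A + 1, fun τ hτ => by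
    simp only [Set.mem_ofPred_eq]; linarith⟩] with τ hτ hτA
  have h2 : f ∘ ofComplex =ᶠ[𝓝 (τ : ℂ)] fun z => F (𝕢 h z) := by
    have ho : IsOpen {z : ℂ | A < z.im} := isOpen_lt continuous_const Complex.continuous_im
    filter_upwards [ho.mem_nhds hτA, isOpen_upperHalfPlaneSet.mem_nhds τ.im_pos] with z hz hz'
    rw [Function.comp_apply, ofComplex_apply_of_im_pos hz']
    exact hA ⟨z, hz'⟩ (le_of_lt hz)
  have h3 : AnalyticAt ℂ (fun z => F (𝕢 h z)) τ :=
    hτ.fun_comp (Function.Periodic.differentiable_qParam.analyticAt _)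
  exact (h3.congr h2.symm).meromorphicOrderAt_nonneg

lemma exists_isBoundedAtImInfty_zpow_mul {f : ℍ → ℂ} {h : ℝ} (hh : 0 < h) {F : ℂ → ℂ}
    (hF : MeromorphicAt F 0) (hf : ∀ᶠ τ : ℍ in atImInfty, f τ = F (𝕢 h τ)) :
    ∃ m : ℕ, IsBoundedAtImInfty fun τ : ℍ => 𝕢 h τ ^ m * f τ := by
  obtain ⟨m, hm⟩ := hF
  refine ⟨m, ?_⟩
  have h1 := (hm.continuousAt.tendsto.comp (qParam_tendsto_atImInfty hh)).isBigO_one ℝ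
  refine h1.congr' ?_ EventuallyEq.rfl
  filter_upwards [hf] with τ hτ
  simp [hτ]

/-- The bound for `g` passes to `f` on a dense subset of the open half-plane `A < Im τ`, and to the
rest by continuity. -/
lemma IsBoundedAtImInfty.of_eventuallyEq_codiscrete {f g : ℍ → ℂ} (hf : Continuous f)
    (hfg : f =ᶠ[codiscrete ℍ] g) (hg : IsBoundedAtImInfty g) : IsBoundedAtImInfty f := by
  rw [isBoundedAtImInfty_iff] at hg ⊢
  obtain ⟨M, A, h⟩ := hg
  refine ⟨M, A + 1, fun τ hτ => ?_⟩
  have ho : IsOpen {τ : ℍ | A < τ.im} := isOpen_lt continuous_const UpperHalfPlane.continuous_im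
  have hcl : IsClosed {τ : ℍ | ‖f τ‖ ≤ M} := isClosed_le hf.norm continuous_const
  have h1 := (dense_of_mem_codiscrete hfg).open_subset_closure_inter ho
    (show A < τ.im by linarith)
  refine hcl.closure_subset_iff.mpr (fun w hw => ?_) h1
  have h2 : f w = g w := hw.2
  simpa [h2] using h w (le_of_lt hw.1)

/-- A holomorphic function invariant under `Γ₀(N)` and bounded at all cusps is constant. -/
lemma exists_eq_const_of_bounded {N : ℕ} (hN : 0 < N) {f : ℍ → ℂ} (hf : MDiff f)
    (hinv : ∀ γ ∈ CongruenceSubgroup.Gamma0 N, ∀ τ, f (γ • τ) = f τ)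
    (hb : ∀ γ : SL(2, ℤ), IsBoundedAtImInfty fun τ => f (γ • τ)) :
    ∃ c : ℂ, ∀ τ, f τ = c := by
  have : NeZero N := ⟨hN.ne'⟩
  have hslash : ∀ γ : SL(2, ℤ), SlashAction.map (0 : ℤ) γ f = fun τ => f (γ • τ) := by
    intro γ
    funext τ
    rw [ModularForm.SL_slash_apply]
    simp
  let F : ModularForm ((CongruenceSubgroup.Gamma0 N).map (Matrix.SpecialLinearGroup.mapGL ℝ)) 0 :=
    { toFun := f
      slash_action_eq' := by
        rintro _ ⟨γ, hγ, rfl⟩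
        exact (hslash γ).trans (funext fun τ => hinv γ hγ τ)
      holo' := hf
      bdd_at_cusps' := by
        intro c hc
        rw [Subgroup.IsArithmetic.isCusp_iff_isCusp_SL2Z] at hc
        rw [OnePoint.isBoundedAt_iff_forall_SL2Z hc]
        intro γ _
        rw [hslash]
        exact hb γ }
  obtain ⟨c, hc⟩ := ModularForm.eq_const_of_weight_zero F
  exact ⟨c, fun τ => congrFun hc τ⟩

end UpperHalfPlane

lemma MeromorphicAt.polynomial_eval {H : ℂ → ℂ} {x : ℂ} (hH : MeromorphicAt H x) (Q : ℂ[X]) :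
    MeromorphicAt (fun z => Q.eval (H z)) x := by
  induction Q using Polynomial.induction_on' with
  | add p q hp hq => simpa only [eval_add] using hp.fun_add hq
  | monomial n a =>
    simp only [eval_monomial]
    exact (MeromorphicAt.const a x).fun_mul (hH.fun_pow n)

namespace UpperHalfPlane

lemma exists_finset_forall_eq_mul {N : ℕ} (hN : 0 < N) :
    ∃ s : Finset SL(2, ℤ), ∀ γ : SL(2, ℤ), ∃ ρ ∈ CongruenceSubgroup.Gamma0 N, ∃ σ ∈ s,
      γ = ρ * σ := by
  classical
  have : NeZero N := ⟨hN.ne'⟩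
  have : Fintype (SL(2, ℤ) ⧸ CongruenceSubgroup.Gamma0 N) := Fintype.ofFinite _
  refine ⟨Finset.univ.image fun x : SL(2, ℤ) ⧸ CongruenceSubgroup.Gamma0 N => x.out⁻¹,
    fun γ => ?_⟩
  obtain ⟨ρ, hρ⟩ := QuotientGroup.mk_out_eq_mul (CongruenceSubgroup.Gamma0 N) γ⁻¹
  refine ⟨ρ, ρ.2, _, Finset.mem_image_of_mem _
    (Finset.mem_univ ((γ⁻¹ : SL(2, ℤ)) : SL(2, ℤ) ⧸ CongruenceSubgroup.Gamma0 N)), ?_⟩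
  rw [hρ]
  group

lemma exists_analyticAt_smul {N : ℕ} (hN : 0 < N) {h : ℍ → ℂ} (hh : MDiff h)
    (hinv : ∀ γ ∈ CongruenceSubgroup.Gamma0 N, ∀ τ, h (γ • τ) = h τ) {γ : SL(2, ℤ)}
    (hb : IsBoundedAtImInfty fun τ => h (γ • τ)) :
    ∃ H : ℂ → ℂ, AnalyticAt ℂ H 0 ∧ ∀ τ : ℍ, h (γ • τ) = H (𝕢 N τ) := by
  obtain ⟨H, hH, h1⟩ := exists_analyticAt_eq_qParam_zpow_mul (h := N) (m := 0)
    (by exact_mod_cast hN) (smul_vadd_natCast_eq hinv γ) (mdifferentiable_comp_smul hh γ)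
    (by simpa using hb)
  exact ⟨H, hH, by simpa using h1⟩

/-- A pole at a cusp at which `h` is finite is removed by a polynomial in `h`. -/
lemma exists_polynomial_isBoundedAtImInfty {N : ℕ} (hN : 0 < N) {h : ℍ → ℂ} (hh : MDiff h)
    (hinv : ∀ γ ∈ CongruenceSubgroup.Gamma0 N, ∀ τ, h (γ • τ) = h τ) {γ : SL(2, ℤ)}
    (hb : IsBoundedAtImInfty fun τ => h (γ • τ)) {G : ℍ → ℂ} {m : ℕ}
    (hG : IsBoundedAtImInfty fun τ : ℍ => 𝕢 N τ ^ m * G (γ • τ)) :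
    ∃ Q : ℂ[X], Q ≠ 0 ∧ IsBoundedAtImInfty fun τ => Q.eval (h (γ • τ)) * G (γ • τ) := by
  obtain ⟨H, hH, hhH⟩ := exists_analyticAt_smul hN hh hinv hb
  refine ⟨(X - C (H 0)) ^ m, pow_ne_zero _ (X_sub_C_ne_zero _), ?_⟩
  -- `H 0` is the value of `h` at the cusp, so `h - H 0` vanishes there and its `m`-th power absorbs
  -- the pole of `G`.
  have h1 : (fun τ : ℍ => h (γ • τ) - H 0) =O[atImInfty] fun τ : ℍ => 𝕢 N (τ : ℂ) := by
    have := hH.differentiableAt.isBigO_sub.comp_tendsto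
      (qParam_tendsto_atImInfty (h := N) (by exact_mod_cast hN))
    simpa only [Function.comp_def, hhH, sub_zero] using this
  have h2 := (h1.pow m).mul (Asymptotics.isBigO_refl (fun τ : ℍ => G (γ • τ)) atImInfty)
  exact (h2.trans hG).congr_left fun τ => by simp only [eval_pow, eval_sub, eval_X, eval_C]

lemma isBoundedAtImInfty_polynomial_eval {h : ℍ → ℂ} (hb : IsBoundedAtImInfty h) (Q : ℂ[X]) :
    IsBoundedAtImInfty fun τ => Q.eval (h τ) := by
  induction Q using Polynomial.induction_on' with
  | add p q hp hq =>
    simp only [eval_add]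
    exact BoundedAtFilter.add hp hq
  | monomial n a =>
    simp only [eval_monomial]
    have h1 : (fun τ => h τ ^ n) =O[atImInfty] fun _ : ℍ => (1 : ℝ) ^ n := hb.pow n
    simpa [IsBoundedAtImInfty, BoundedAtFilter, Pi.one_def] using h1.const_mul_left a

/-- One polynomial for each of finitely many coset representatives; at a given cusp the other
factors stay bounded because `h` does. -/
lemma exists_polynomial_forall_isBoundedAtImInfty {N : ℕ} (hN : 0 < N) {h : ℍ → ℂ}
    (hh : MDiff h) (hinv : ∀ γ ∈ CongruenceSubgroup.Gamma0 N, ∀ τ, h (γ • τ) = h τ)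
    (hcusp : ∀ γ ∉ CongruenceSubgroup.Gamma0 N, IsBoundedAtImInfty fun τ => h (γ • τ))
    {G : ℍ → ℂ} (hGinv : ∀ γ ∈ CongruenceSubgroup.Gamma0 N, ∀ τ, G (γ • τ) = G τ)
    (hG : ∀ γ : SL(2, ℤ), ∃ m : ℕ, IsBoundedAtImInfty fun τ : ℍ => 𝕢 N τ ^ m * G (γ • τ)) :
    ∃ Q : ℂ[X], Q ≠ 0 ∧ ∀ γ ∉ CongruenceSubgroup.Gamma0 N,
      IsBoundedAtImInfty fun τ => Q.eval (h (γ • τ)) * G (γ • τ) := by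
  classical
  have h1 : ∀ γ : SL(2, ℤ), ∃ Q : ℂ[X], Q ≠ 0 ∧ (γ ∉ CongruenceSubgroup.Gamma0 N →
      IsBoundedAtImInfty fun τ => Q.eval (h (γ • τ)) * G (γ • τ)) := by
    intro γ
    by_cases hγ : γ ∈ CongruenceSubgroup.Gamma0 N
    · exact ⟨1, one_ne_zero, fun h => absurd hγ h⟩
    · obtain ⟨m, hm⟩ := hG γ
      obtain ⟨Q, hQ, hQb⟩ := exists_polynomial_isBoundedAtImInfty hN hh hinv (hcusp γ hγ) hm
      exact ⟨Q, hQ, fun _ => hQb⟩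
  choose Q hQ0 hQ using h1
  obtain ⟨s, hs⟩ := exists_finset_forall_eq_mul hN
  refine ⟨∏ σ ∈ s, Q σ, Finset.prod_ne_zero_iff.mpr fun σ _ => hQ0 σ, fun γ hγ => ?_⟩
  obtain ⟨ρ, hρ, σ, hσ, rfl⟩ := hs γ
  have hσ' : σ ∉ CongruenceSubgroup.Gamma0 N := fun h => hγ (mul_mem hρ h)
  have h2 := (isBoundedAtImInfty_polynomial_eval (hcusp σ hσ') (∏ x ∈ s.erase σ, Q x)).mul
    (hQ σ hσ')
  simp_rw [mul_smul, hinv ρ hρ, hGinv ρ hρ]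
  rw [← Finset.mul_prod_erase s Q hσ]
  refine (h2.congr (fun τ => ?_) fun τ => ?_ : _ =O[atImInfty] (1 : ℍ → ℝ))
  · simp only [Pi.mul_apply, eval_mul]; ring
  · simp

lemma vadd_one_eq {N : ℕ} {f : ℍ → ℂ}
    (hf : ∀ γ ∈ CongruenceSubgroup.Gamma0 N, ∀ τ, f (γ • τ) = f τ) (τ : ℍ) :
    f ((1 : ℝ) +ᵥ τ) = f τ := by
  rw [← modular_T_smul, hf]
  rw [CongruenceSubgroup.Gamma0_mem]
  simp [ModularGroup.T]

/-- Induction on the pole order at `∞`. As `h ~ 1/q`, subtracting a multiple of the top power of `h`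
lowers it; with no pole left the function is bounded at all cusps, hence constant. -/
lemma exists_polynomial_eq_of_bounded {N : ℕ} (hN : 0 < N) {h : ℍ → ℂ} (hh : MDiff h)
    (hinv : ∀ γ ∈ CongruenceSubgroup.Gamma0 N, ∀ τ, h (γ • τ) = h τ)
    (hinfty : Tendsto (fun τ : ℍ => 𝕢 1 τ * h τ) atImInfty (𝓝 1))
    (hcusp : ∀ γ ∉ CongruenceSubgroup.Gamma0 N, IsBoundedAtImInfty fun τ => h (γ • τ))
    (m : ℕ) : ∀ {G : ℍ → ℂ}, MDiff G →
    (∀ γ ∈ CongruenceSubgroup.Gamma0 N, ∀ τ, G (γ • τ) = G τ) →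
    (∀ γ ∉ CongruenceSubgroup.Gamma0 N, IsBoundedAtImInfty fun τ => G (γ • τ)) →
    IsBoundedAtImInfty (fun τ : ℍ => 𝕢 1 τ ^ m * G τ) →
    ∃ P : ℂ[X], ∀ τ, G τ = P.eval (h τ) := by
  induction m with
  | zero =>
    intro G hG hGinv hGb hGi
    obtain ⟨c, hc⟩ := exists_eq_const_of_bounded hN hG hGinv fun γ => by
      by_cases hγ : γ ∈ CongruenceSubgroup.Gamma0 N
      · simpa only [hGinv γ hγ, pow_zero, one_mul] using hGi
      · exact hGb γ hγ
    exact ⟨C c, by simpa using hc⟩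
  | succ m ih =>
    intro G hG hGinv hGb hGi
    obtain ⟨A, hA, hGA⟩ := exists_analyticAt_eq_qParam_zpow_mul one_pos (vadd_one_eq hGinv) hG
      (m := (m + 1 : ℕ)) (by simpa only [zpow_natCast] using hGi)
    -- The coefficient of `q ^ (-(m + 1))` in `G`.
    set c := A 0
    set G' : ℍ → ℂ := fun τ => G τ - c * h τ ^ (m + 1) with hG'
    have hG'd : MDiff G' := by
      have := mdifferentiable_polynomial_eval hh (C c * X ^ (m + 1))
      exact hG.sub (by simpa using this)
    have hG'inv : ∀ γ ∈ CongruenceSubgroup.Gamma0 N, ∀ τ, G' (γ • τ) = G' τ := by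
      intro γ hγ τ
      simp only [G', hinv γ hγ, hGinv γ hγ]
    have hq := qParam_tendsto_atImInfty one_pos
    have hlim : Tendsto (fun τ : ℍ => 𝕢 1 τ ^ (m + 1) * G' τ) atImInfty (𝓝 0) := by
      have h1 : Tendsto (fun τ : ℍ => A (𝕢 1 τ) - c * (𝕢 1 τ * h τ) ^ (m + 1)) atImInfty
          (𝓝 (A 0 - c * 1 ^ (m + 1))) :=
        (hA.continuousAt.tendsto.comp hq).sub ((hinfty.pow _).const_mul c)
      rw [one_pow, mul_one, sub_self] at h1
      refine h1.congr fun τ => ?_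
      have hq0 : 𝕢 1 (τ : ℂ) ≠ 0 := Function.Periodic.qParam_ne_zero _
      simp only [G']
      rw [hGA, zpow_neg, zpow_natCast]
      rw [mul_sub, mul_inv_cancel_left₀ (pow_ne_zero _ hq0)]
      ring
    obtain ⟨B, hB, hGB⟩ := exists_analyticAt_eq_qParam_zpow_mul one_pos (vadd_one_eq hG'inv) hG'd
      (m := (m + 1 : ℕ)) (by simp only [zpow_natCast]; exact hlim.isBigO_one ℝ)
    have hB' : ∀ τ : ℍ, 𝕢 1 τ ^ (m + 1) * G' τ = B (𝕢 1 τ) := by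
      intro τ
      have hq0 : 𝕢 1 (τ : ℂ) ≠ 0 := Function.Periodic.qParam_ne_zero _
      rw [hGB, zpow_neg, zpow_natCast, mul_inv_cancel_left₀ (pow_ne_zero _ hq0)]
    have hB0 : B 0 = 0 := by
      refine tendsto_nhds_unique (hB.continuousAt.tendsto.comp hq) (hlim.congr fun τ => ?_)
      rw [hB', Function.comp_apply]
    obtain ⟨P, hP⟩ := ih hG'd hG'inv
      (fun γ hγ => by
        have := isBoundedAtImInfty_polynomial_eval (hcusp γ hγ) (C c * X ^ (m + 1))
        simp only [eval_mul, eval_C, eval_pow, eval_X] at this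
        exact Asymptotics.IsBigO.sub (hGb γ hγ) this)
      (by
        have h1 := (hB.differentiableAt.isBigO_sub.comp_tendsto hq).mul
          (Asymptotics.isBigO_refl (fun τ : ℍ => (𝕢 1 (τ : ℂ))⁻¹) atImInfty)
        refine (h1.congr (fun τ => ?_) (fun τ => ?_) :
          _ =O[atImInfty] (fun _ : ℍ => (1 : ℂ))).trans
          (Asymptotics.isBigO_of_le _ fun _ => by simp)
        · have hq0 : 𝕢 1 (τ : ℂ) ≠ 0 := Function.Periodic.qParam_ne_zero _
          rw [Function.comp_apply, hB0, sub_zero, ← hB', pow_succ]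
          field_simp
        · simp [Function.Periodic.qParam_ne_zero])
    refine ⟨P + C c * X ^ (m + 1), fun τ => ?_⟩
    have := hP τ
    simp only [G'] at this
    simp [← this]

/-- Poles of a modular function on `ℍ` are removed by a polynomial in `h`. -/
lemma IsModularFunction.exists_polynomial_nonneg {N : ℕ} (hN : 0 < N) {h : ℍ → ℂ} (hh : MDiff h)
    (hinv : ∀ γ ∈ CongruenceSubgroup.Gamma0 N, ∀ τ, h (γ • τ) = h τ)
    {g : ℍ → ℂ} (hg : IsModularFunction N g) :
    ∃ Q : ℂ[X], Q ≠ 0 ∧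
      ∀ τ : ℍ, 0 ≤ meromorphicOrderAt ((fun τ => Q.eval (h τ) * g τ) ∘ ofComplex) τ := by
  obtain ⟨s, hs⟩ := exists_finset_forall_eq_mul hN
  have hord : ∀ (f : ℍ → ℂ) (γ : SL(2, ℤ)) (τ : ℍ),
      meromorphicOrderAt ((fun τ => f (γ • τ)) ∘ ofComplex) τ =
        meromorphicOrderAt (f ∘ ofComplex) ((γ • τ : ℍ) : ℂ) := by
    intro f γ τ
    have hdet : 0 < (γ : GL (Fin 2) ℝ).det.val := by simp
    exact meromorphicOrderAt_comp_smul (f := f) (τ := τ) (g := (γ : GL (Fin 2) ℝ)) hdet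
  have hcusp : ∀ γ : SL(2, ℤ), ∃ A : ℝ, ∀ τ : ℍ, A ≤ τ.im →
      0 ≤ meromorphicOrderAt (g ∘ ofComplex) ((γ • τ : ℍ) : ℂ) := by
    intro γ
    obtain ⟨F, hF, hgF⟩ := hg.meromorphic_cusps γ
    have h1 := eventually_meromorphicOrderAt_nonneg (by exact_mod_cast hN) hF hgF
    simp_rw [hord] at h1
    exact (atImInfty_mem _).mp h1
  choose A hA using hcusp
  -- `Γ₀(N)`-translates of the sets `σ • fd` cover `ℍ`, where `fd` is the standard fundamental
  -- domain and `σ` runs over the coset representatives. Above height `A σ` the function `g` has no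
  -- poles, so one truncation for each `σ` suffices.
  have hK : IsCompact (⋃ σ ∈ s, (fun τ : ℍ => σ • τ) ''
      ModularGroup.truncatedFundamentalDomain (A σ)) :=
    s.isCompact_biUnion fun σ _ => (ModularGroup.isCompact_truncatedFundamentalDomain _).image
      (UpperHalfPlane.mdifferentiable_smul (g := (σ : GL (Fin 2) ℝ)) (by simp)).continuous
  obtain ⟨Q, hQ0, hQ⟩ := exists_polynomial_meromorphicOrderAt_nonneg hh hg.meromorphic hK
  refine ⟨Q, hQ0, fun τ => ?_⟩
  obtain ⟨δ, hδ⟩ := ModularGroup.exists_smul_mem_fd τ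
  obtain ⟨ρ, hρ, σ, hσ, hδρ⟩ := hs δ⁻¹
  set w := δ • τ
  have hτ : τ = ρ • σ • w := by
    rw [← mul_smul, ← hδρ, inv_smul_smul]
  have hcongr : meromorphicOrderAt ((fun τ => Q.eval (h τ) * g τ) ∘ ofComplex)
      ((ρ • σ • w : ℍ) : ℂ) =
      meromorphicOrderAt ((fun τ => Q.eval (h τ) * g τ) ∘ ofComplex) ((σ • w : ℍ) : ℂ) := by
    rw [← hord]
    refine meromorphicOrderAt_congr (eventuallyEq_comp_ofComplex ?_ _)
    filter_upwards [hg.invariant ρ hρ] with z hz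
    rw [hinv ρ hρ, hz]
  rw [hτ, hcongr]
  by_cases hw : w.im ≤ A σ
  · exact hQ _ (Set.mem_biUnion hσ ⟨w, ⟨hδ, hw⟩, rfl⟩)
  · exact meromorphicOrderAt_mul_nonneg (mdifferentiable_polynomial_eval hh Q)
      (hg.meromorphic _ (σ • w).im_pos) (hA σ w (not_le.mp hw).le)

lemma qParam_natCast_pow {N : ℕ} (hN : 0 < N) (τ : ℍ) : 𝕢 N (τ : ℂ) ^ N = 𝕢 1 τ := by
  have : (N : ℂ) ≠ 0 := by exact_mod_cast hN.ne'
  rw [Function.Periodic.qParam, Function.Periodic.qParam, ← Complex.exp_nat_mul]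
  congr 1
  push_cast
  field_simp

/-- A holomorphic `Γ₀(N)`-invariant function whose only pole, at the cusp `∞`, is simple generates
the field of modular functions. -/
theorem IsModularFunction.exists_eq_div {N : ℕ} (hN : 0 < N) {h : ℍ → ℂ} (hh : MDiff h)
    (hinv : ∀ γ ∈ CongruenceSubgroup.Gamma0 N, ∀ τ, h (γ • τ) = h τ)
    (hinfty : Tendsto (fun τ : ℍ => 𝕢 1 τ * h τ) atImInfty (𝓝 1))
    (hcusp : ∀ γ ∉ CongruenceSubgroup.Gamma0 N, IsBoundedAtImInfty fun τ => h (γ • τ))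
    {g : ℍ → ℂ} (hg : IsModularFunction N g) :
    ∃ P Q : ℂ[X], Q ≠ 0 ∧ g =ᶠ[codiscrete ℍ] fun τ : ℍ => P.eval (h τ) / Q.eval (h τ) := by
  obtain ⟨Q, hQ0, hQ⟩ := exists_polynomial_nonneg hN hh hinv hg
  obtain ⟨G, hG, hGg⟩ := exists_mdifferentiable_eventuallyEq
    (f := fun τ => Q.eval (h τ) * g τ) (fun z hz =>
    (analyticAt_comp_ofComplex (mdifferentiable_polynomial_eval hh Q)
      ⟨z, hz⟩).meromorphicAt.mul (hg.meromorphic z hz)) hQ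
  have hsmul : ∀ γ : SL(2, ℤ), (fun τ => G (γ • τ)) =ᶠ[codiscrete ℍ]
      fun τ => Q.eval (h (γ • τ)) * g (γ • τ) := fun γ =>
    ((tendsto_smul_codiscrete γ).eventually hGg).mono fun _ h => h.symm
  have hGinv : ∀ γ ∈ CongruenceSubgroup.Gamma0 N, ∀ τ, G (γ • τ) = G τ := by
    intro γ hγ
    refine congrFun (eq_of_eventuallyEq_codiscrete (mdifferentiable_comp_smul hG γ).continuous
      hG.continuous ?_)
    filter_upwards [hsmul γ, hg.invariant γ hγ, hGg] with τ h1 h2 h3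
    rw [h1, h2, hinv γ hγ, h3]
  have hGm : ∀ γ : SL(2, ℤ), ∃ m : ℕ, IsBoundedAtImInfty fun τ : ℍ => 𝕢 N τ ^ m * G (γ • τ) := by
    intro γ
    obtain ⟨F, hF, hgF⟩ := hg.meromorphic_cusps γ
    obtain ⟨H, hH, hhH⟩ : ∃ H : ℂ → ℂ, MeromorphicAt H 0 ∧ ∀ τ : ℍ, h (γ • τ) = H (𝕢 N τ) := by
      by_cases hγ : γ ∈ CongruenceSubgroup.Gamma0 N
      · have hb : IsBoundedAtImInfty fun τ : ℍ => 𝕢 N τ ^ (N : ℤ) * h (γ • τ) := by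
          simp_rw [zpow_natCast, qParam_natCast_pow hN, hinv γ hγ]
          exact hinfty.isBigO_one ℝ
        exact exists_meromorphicAt_eq_qParam (by exact_mod_cast hN)
          (smul_vadd_natCast_eq hinv γ) (mdifferentiable_comp_smul hh γ) hb
      · obtain ⟨H, hH, hhH⟩ := exists_analyticAt_smul hN hh hinv (hcusp γ hγ)
        exact ⟨H, hH.meromorphicAt, hhH⟩
    obtain ⟨m, hm⟩ := exists_isBoundedAtImInfty_zpow_mul (f := fun τ : ℍ =>
      Q.eval (h (γ • τ)) * g (γ • τ)) (h := N) (by exact_mod_cast hN)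
      ((hH.polynomial_eval Q).mul hF) (hgF.mono fun τ hτ => by rw [hhH, hτ]; rfl)
    refine ⟨m, IsBoundedAtImInfty.of_eventuallyEq_codiscrete ?_ ?_ hm⟩
    · have := ((mdifferentiable_qParam_zpow N m).mul (mdifferentiable_comp_smul hG γ)).continuous
      simpa [Pi.mul_def] using! this
    · filter_upwards [hsmul γ] with τ hτ
      rw [hτ]
  obtain ⟨R, hR0, hR⟩ := exists_polynomial_forall_isBoundedAtImInfty hN hh hinv hcusp hGinv hGm
  have hRd := mdifferentiable_polynomial_eval hh R
  obtain ⟨m, hm⟩ := hGm 1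
  obtain ⟨n, hn⟩ : ∃ n : ℕ, IsBoundedAtImInfty fun τ : ℍ => 𝕢 1 τ ^ n * R.eval (h τ) := by
    obtain ⟨H, hH, hhH⟩ := exists_meromorphicAt_eq_qParam one_pos (vadd_one_eq hinv) hh (m := 1)
      (by simp only [zpow_one]; exact hinfty.isBigO_one ℝ)
    exact exists_isBoundedAtImInfty_zpow_mul one_pos (hH.polynomial_eval R)
      (Eventually.of_forall fun τ => by rw [hhH])
  -- `R(h) G`, where `G` extends `Q(h) g`, has a pole only at `∞`. Its order in `q` is bounded by
  -- `n` from `R(h)` and `m` from `G`; the bound for `G` is in `q_N`, and `‖q‖ ≤ ‖q_N‖`.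
  obtain ⟨P, hP⟩ := exists_polynomial_eq_of_bounded hN hh hinv hinfty hcusp (n + m)
    (hRd.mul hG) (fun γ hγ τ => by simp only [Pi.mul_apply, hinv γ hγ, hGinv γ hγ]) hR (by
      simp only [one_smul] at hm
      refine (Asymptotics.IsBigO.of_bound' (Eventually.of_forall fun τ => ?_)).trans
        (BoundedAtFilter.mul hn hm)
      have h1 : ‖𝕢 1 (τ : ℂ)‖ ≤ ‖𝕢 N (τ : ℂ)‖ := by
        rw [← qParam_natCast_pow hN, norm_pow]
        exact pow_le_of_le_one (norm_nonneg _)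
          (Function.Periodic.norm_qParam_lt_one (by exact_mod_cast hN) τ.im_pos).le hN.ne'
      simp only [Pi.mul_apply, norm_mul, norm_pow, pow_add]
      calc _ = ‖𝕢 1 (τ : ℂ)‖ ^ n * ‖R.eval (h τ)‖ * (‖𝕢 1 (τ : ℂ)‖ ^ m * ‖G τ‖) := by ring
        _ ≤ _ := by gcongr)
  -- Were `S(h)` identically zero, `h` would take finitely many values and `q h` would tend to 0
  -- instead of 1.
  have hQR : ∀ S : ℂ[X], S ≠ 0 → ∀ᶠ τ in codiscrete ℍ, S.eval (h τ) ≠ 0 := by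
    intro S hS
    refine eventually_codiscrete_ne_zero (mdifferentiable_polynomial_eval hh S) ?_
    intro h0
    have hroot : ∀ τ, h τ ∈ S.roots.toFinset := fun τ => by
      rw [Multiset.mem_toFinset, mem_roots hS]
      exact congrFun h0 τ
    have hb : Bornology.IsBounded (Set.range h) :=
      (S.roots.toFinset.finite_toSet.isBounded).subset (by rintro _ ⟨τ, rfl⟩; exact hroot τ)
    obtain ⟨M, hM⟩ := hb.exists_norm_le
    have h1 := (qParam_tendsto_atImInfty one_pos).zero_mul_isBoundedUnder_le
      (g := h) ⟨M, eventually_map.mpr (Eventually.of_forall fun τ => hM _ ⟨τ, rfl⟩)⟩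
    exact one_ne_zero (tendsto_nhds_unique hinfty h1)
  refine ⟨P, R * Q, mul_ne_zero hR0 hQ0, ?_⟩
  filter_upwards [hGg, hQR _ hR0, hQR _ hQ0] with τ h1 h2 h3
  rw [eq_div_iff (by rw [eval_mul]; exact mul_ne_zero h2 h3), ← hP, Pi.mul_apply, ← h1, eval_mul]
  ring

end UpperHalfPlane

/-! ### Orders at the cusps and sufficiency of the conditions -/

namespace ModularForm

lemma etaOrder_gcd (N : ℕ) (r : ℕ → ℤ) (c : ℤ) :
    etaOrder N r (Int.gcd c N : ℕ) = etaOrder N r c := by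
  refine Finset.sum_congr rfl fun δ hδ => ?_
  have : Int.gcd ((Int.gcd c N : ℕ) : ℤ) δ = Int.gcd c δ := by
    rw [Int.gcd_assoc]
    congr 1
    rw [Int.gcd_natCast_natCast, Nat.gcd_eq_right (Nat.dvd_of_mem_divisors hδ)]
  rw [this]

lemma natCast_mul_etaOrder_one (N : ℕ) (r : ℕ → ℤ) :
    N * etaOrder N r 1 = ((∑ δ ∈ N.divisors, r δ * ((N / δ : ℕ) : ℤ) : ℤ) : ℝ) := by
  rw [etaOrder, Finset.mul_sum]
  simp only [Int.cast_sum, Int.cast_mul, Int.cast_natCast]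
  refine Finset.sum_congr rfl fun δ hδ => ?_
  have hδ0 : (δ : ℝ) ≠ 0 := by exact_mod_cast (Nat.pos_of_mem_divisors hδ).ne'
  rw [Nat.cast_div (Nat.dvd_of_mem_divisors hδ) hδ0]
  simp
  ring

lemma etaOrder_level {N : ℕ} (r : ℕ → ℤ) :
    etaOrder N r N = ((∑ δ ∈ N.divisors, r δ * (δ : ℤ) : ℤ) : ℝ) := by
  rw [etaOrder]
  push_cast
  refine Finset.sum_congr rfl fun δ hδ => ?_
  have hδ0 : (δ : ℝ) ≠ 0 := by exact_mod_cast (Nat.pos_of_mem_divisors hδ).ne'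
  rw [Int.gcd_natCast_natCast, Nat.gcd_eq_right (Nat.dvd_of_mem_divisors hδ)]
  field_simp

lemma etaOrder_natCast_eq_zero_iff {N : ℕ} (r : ℕ → ℤ) {d : ℕ} (hd : d ∈ N.divisors) :
    etaOrder N r d = 0 ↔ ((N / d : ℕ) : ℚ) * (Nat.gcd d (N / d) : ℚ) *
      ∑ δ ∈ N.divisors, (r δ : ℚ) * (Nat.gcd δ d : ℚ) ^ 2 / (δ : ℚ) = 0 := by
  have h1 : ((N / d : ℕ) : ℚ) ≠ 0 := by
    exact_mod_cast (Nat.div_pos (Nat.divisor_le hd) (Nat.pos_of_mem_divisors hd)).ne'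
  have h2 : (Nat.gcd d (N / d) : ℚ) ≠ 0 := by
    exact_mod_cast (Nat.gcd_pos_of_pos_left _ (Nat.pos_of_mem_divisors hd)).ne'
  have h3 : etaOrder N r d =
      ((∑ δ ∈ N.divisors, (r δ : ℚ) * (Nat.gcd δ d : ℚ) ^ 2 / (δ : ℚ) : ℚ) : ℝ) := by
    rw [etaOrder]
    push_cast
    refine Finset.sum_congr rfl fun δ _ => ?_
    rw [Int.gcd_natCast_natCast, Nat.gcd_comm, mul_div_assoc]
  rw [h3, Rat.cast_eq_zero]
  simp [h1, h2]

lemma gcd_eq_level_iff {N : ℕ} (γ : SL(2, ℤ)) :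
    Int.gcd (γ 1 0) N = N ↔ γ ∈ CongruenceSubgroup.Gamma0 N := by
  rw [CongruenceSubgroup.Gamma0_mem, ZMod.intCast_zmod_eq_zero_iff_dvd]
  exact ⟨fun h => by rw [← h]; exact_mod_cast Int.gcd_dvd_left _ _,
    fun h => Int.gcd_eq_right (by positivity) h |> fun h => by exact_mod_cast h⟩

lemma gcd_mem_divisors {N : ℕ} (hN : 0 < N) (c : ℤ) : Int.gcd c N ∈ N.divisors :=
  Nat.mem_divisors.mpr ⟨by exact_mod_cast Int.gcd_dvd_right c N, hN.ne'⟩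

lemma hasSimpleZeroAtCuspZero_etaProduct {N : ℕ} (hN : 0 < N) {r : ℕ → ℤ}
    (hb : ∑ δ ∈ N.divisors, r δ * ((N / δ : ℕ) : ℤ) = 24) (h0 : ∑ δ ∈ N.divisors, r δ = 0)
    (hinv : ∀ γ ∈ CongruenceSubgroup.Gamma0 N, ∀ τ,
      etaProduct N r (γ • τ) = etaProduct N r τ) :
    HasSimpleZeroAtCuspZero N (etaProduct N r) := by
  obtain ⟨C, hC, h⟩ := tendsto_norm_qParam_zpow_mul_etaProduct_smul hN h0 ModularGroup.S (m := 1)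
    (by
      have := natCast_mul_etaOrder_one N r
      rw [hb] at this
      simpa [ModularGroup.S] using this)
  obtain ⟨F, hF, hF1, hFe⟩ := exists_meromorphicOrderAt_eq (by exact_mod_cast hN)
    (smul_vadd_natCast_eq hinv _) (mdifferentiable_comp_smul (mdifferentiable_etaProduct N r) _)
    hC.ne' h
  exact ⟨F, hF, by simpa using hF1, Eventually.of_forall hFe⟩

theorem isHauptmodul_etaProduct {N : ℕ} (hN : 0 < N) {r : ℕ → ℤ} (hl : LinearConditions N r)
    (hsq : SquareCondition N r) :
    IsHauptmodul N (etaProduct N r) ∧ HasSimpleZeroAtCuspZero N (etaProduct N r) := by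
  obtain ⟨ha, hb, h0, he⟩ := hl
  have hinv : ∀ γ ∈ CongruenceSubgroup.Gamma0 N, ∀ τ,
      etaProduct N r (γ • τ) = etaProduct N r τ := fun γ hγ τ =>
    etaProduct_smul (by rw [ha]; decide) (by rw [hb]) h0 hsq hγ τ
  obtain ⟨hinfty, hq⟩ := etaProduct_qExpansion ha
  have hcusp : ∀ γ ∉ CongruenceSubgroup.Gamma0 N,
      IsBoundedAtImInfty fun τ => etaProduct N r (γ • τ) := by
    intro γ hγ
    obtain ⟨m, hm⟩ : ∃ m : ℕ, N * etaOrder N r (γ 1 0) = 24 * (m : ℤ) := by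
      rw [← etaOrder_gcd]
      -- A cusp of denominator prime to `N` has the order of the cusp `0`. Every other `γ` outside
      -- `Γ₀(N)` has gcd different from 1 and `N`, hence order 0 by (e).
      by_cases hd : Int.gcd (γ 1 0) N = 1
      · refine ⟨1, ?_⟩
        rw [hd, Nat.cast_one, natCast_mul_etaOrder_one N, hb]
        norm_num
      · refine ⟨0, ?_⟩
        rw [(etaOrder_natCast_eq_zero_iff r (gcd_mem_divisors hN _)).mpr
          (he _ (gcd_mem_divisors hN _) hd (mt (gcd_eq_level_iff γ).mp hγ))]
        simp
    obtain ⟨C, -, hC⟩ := tendsto_norm_qParam_zpow_mul_etaProduct_smul hN h0 γ hm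
    have h1 := (hC.isBigO_one ℝ).of_norm_left
    have h2 : (fun τ : ℍ => 𝕢 N (τ : ℂ) ^ m) =O[atImInfty] fun _ => (1 : ℝ) :=
      ((qParam_tendsto_atImInfty (h := N) (by exact_mod_cast hN)).pow m).isBigO_one ℝ
    refine ((h2.mul h1).congr (fun τ => ?_) fun τ => ?_ : _ =O[atImInfty] (1 : ℍ → ℝ))
    · rw [← mul_assoc, zpow_neg, zpow_natCast,
        mul_inv_cancel₀ (pow_ne_zero _ (Function.Periodic.qParam_ne_zero _)), one_mul]
    · simp
  exact ⟨⟨isModularFunction_etaProduct hN h0 hinv, fun g hg =>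
    IsModularFunction.exists_eq_div hN (mdifferentiable_etaProduct N r) hinv hinfty hcusp hg, hq⟩,
    hasSimpleZeroAtCuspZero_etaProduct hN hb h0 hinv⟩

end ModularForm

/-! ### Necessity of the conditions -/

namespace UpperHalfPlane

/-- Rational expressions in `h` are known only off a closed discrete set, so limits at `i∞` have to
be compared along this filter. -/
instance neBot_atImInfty_inf_codiscrete : (atImInfty ⊓ codiscrete ℍ).NeBot := by
  rw [inf_neBot_iff]
  intro s hs t ht
  obtain ⟨A, hA⟩ := (atImInfty_mem s).mp hs
  have ho : IsOpen {τ : ℍ | A < τ.im} := isOpen_lt continuous_const UpperHalfPlane.continuous_im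
  obtain ⟨τ, hτ⟩ : ({τ : ℍ | A < τ.im}).Nonempty :=
    ⟨⟨⟨0, max A 0 + 1⟩, by positivity⟩, by
      change A < max A 0 + 1
      linarith [le_max_left A 0]⟩
  obtain ⟨w, hw, hwt⟩ := (dense_of_mem_codiscrete ht).inter_open_nonempty _ ho ⟨τ, hτ⟩
  exact ⟨w, hA w (le_of_lt hw), hwt⟩

lemma tendsto_exp_mul_im_atImInfty {a : ℝ} (ha : 0 < a) :
    Tendsto (fun τ : ℍ => Real.exp (2 * Real.pi * (a * τ.im))) atImInfty atTop := by
  refine Real.tendsto_exp_atTop.comp ?_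
  refine Tendsto.const_mul_atTop (by positivity) (Tendsto.const_mul_atTop ha ?_)
  exact tendsto_comap

lemma eq_zero_of_tendsto_exp_mul_im {l : Filter ℍ} [l.NeBot] (hl : l ≤ atImInfty) {a C : ℝ}
    (hC : C ≠ 0) (h : Tendsto (fun τ : ℍ => Real.exp (2 * Real.pi * (a * τ.im))) l (𝓝 C)) :
    a = 0 := by
  rcases lt_trichotomy a 0 with ha | ha | ha
  · exfalso
    have h1 := (tendsto_exp_mul_im_atImInfty (neg_pos.mpr ha)).mono_left hl
    have h2 := h.inv₀ hC
    refine not_tendsto_nhds_of_tendsto_atTop h1 C⁻¹ (h2.congr fun τ => ?_)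
    rw [← Real.exp_neg]
    congr 1; ring
  · exact ha
  · exact absurd h
      (not_tendsto_nhds_of_tendsto_atTop ((tendsto_exp_mul_im_atImInfty ha).mono_left hl) C)

lemma eq_of_tendsto_mul_exp {l : Filter ℍ} [l.NeBot] (hl : l ≤ atImInfty) {u : ℍ → ℝ}
    (hu : ∀ τ, u τ ≠ 0) {a b C D : ℝ} (hC : C ≠ 0) (hD : D ≠ 0)
    (h1 : Tendsto (fun τ : ℍ => u τ * Real.exp (2 * Real.pi * (a * τ.im))) l (𝓝 C))
    (h2 : Tendsto (fun τ : ℍ => u τ * Real.exp (2 * Real.pi * (b * τ.im))) l (𝓝 D)) :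
    a = b := by
  refine sub_eq_zero.mp (eq_zero_of_tendsto_exp_mul_im hl (div_ne_zero hC hD)
    ((h1.div h2 hD).congr fun τ => ?_))
  rw [Pi.div_apply, mul_div_mul_left _ _ (hu τ), ← Real.exp_sub]
  congr 1; ring

end UpperHalfPlane

namespace ModularForm

lemma etaOrder_neg (N : ℕ) (r : ℕ → ℤ) (c : ℤ) : etaOrder N (-r) c = -etaOrder N r c := by
  simp [etaOrder]

lemma etaProduct_neg (N : ℕ) (r : ℕ → ℤ) (τ : ℍ) :
    etaProduct N (-r) τ = (etaProduct N r τ)⁻¹ := by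
  simp [etaProduct]

lemma etaOrder_zero (N : ℕ) (r : ℕ → ℤ) : etaOrder N r 0 = etaOrder N r N := by
  rw [← etaOrder_gcd N r 0, Int.gcd_zero_left, Int.natAbs_natCast]

/-- A zero at the cusp gives the limit 0; the neighbourhood can be punctured because eta products do
not vanish on `ℍ`. -/
lemma tendsto_etaProduct_smul_nhdsNE {N : ℕ} {r : ℕ → ℤ} (h0 : ∑ δ ∈ N.divisors, r δ = 0)
    {γ : SL(2, ℤ)} (he : 0 < etaOrder N r (γ 1 0)) :
    Tendsto (fun τ : ℍ => etaProduct N r (γ • τ)) atImInfty (𝓝[≠] 0) := by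
  obtain ⟨C, hC0, hC⟩ := tendsto_norm_etaProduct_smul_of_sum_eq_zero h0 γ
  refine tendsto_nhdsWithin_of_tendsto_nhds_of_eventually_within _ ?_
    (Eventually.of_forall fun τ => etaProduct_ne_zero N r _)
  have h1 := hC.mul (tendsto_exp_mul_im_atImInfty he).inv_tendsto_atTop
  rw [mul_zero] at h1
  have h2 : Tendsto (fun τ : ℍ => ‖etaProduct N r (γ • τ)‖ ^ 24) atImInfty (𝓝 0) := by
    refine h1.congr fun τ => ?_
    rw [Pi.inv_apply, mul_assoc, mul_inv_cancel₀ (Real.exp_pos _).ne', mul_one]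
  have h3 := h2.rpow_const (p := 1 / 24) (Or.inr (by norm_num))
  rw [Real.zero_rpow (by norm_num)] at h3
  refine tendsto_zero_iff_norm_tendsto_zero.mpr (h3.congr fun τ => ?_)
  rw [← Real.rpow_natCast, ← Real.rpow_mul (norm_nonneg _)]
  norm_num

/-- If an eta product is a function `R` of a parameter `φ` at one cusp, and the same function `R`
of a parameter `ψ` at another one, its orders at the two cusps vanish simultaneously. -/
lemma etaOrder_eq_zero_of_eventually_eq {N : ℕ} {s : ℕ → ℤ} (h0 : ∑ δ ∈ N.divisors, s δ = 0)
    {R : ℂ → ℂ} (hR : MeromorphicAt R 0) {φ ψ : ℍ → ℂ} (hφ : Tendsto φ atImInfty (𝓝[≠] 0))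
    (hψ : Tendsto ψ atImInfty (𝓝[≠] 0)) {γ δ : SL(2, ℤ)}
    (hγ : ∀ᶠ τ in codiscrete ℍ, etaProduct N s (γ • τ) = R (φ τ))
    (hδ : ∀ᶠ τ in codiscrete ℍ, etaProduct N s (δ • τ) = R (ψ τ))
    (he : etaOrder N s (γ 1 0) = 0) : etaOrder N s (δ 1 0) = 0 := by
  set l := atImInfty ⊓ codiscrete ℍ
  have hl : l ≤ atImInfty := inf_le_left
  obtain ⟨C, hC0, hC⟩ := tendsto_norm_etaProduct_smul_of_sum_eq_zero h0 γ
  obtain ⟨D, hD0, hD⟩ := tendsto_norm_etaProduct_smul_of_sum_eq_zero h0 δ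
  simp only [he, zero_mul, mul_zero, Real.exp_zero, mul_one] at hC
  have hC' : Tendsto (fun τ => ‖R (φ τ)‖ ^ 24) l (𝓝 C) :=
    (hC.mono_left hl).congr' ((hγ.filter_mono inf_le_right).mono fun τ hτ => by rw [hτ])
  have hφl := hφ.mono_left hl
  have hψl := hψ.mono_left hl
  -- At the first cusp `‖R(φ)‖` has a finite nonzero limit, which excludes a zero or a pole of `R`.
  -- Then `R(ψ)` has a nonzero limit as well, which fixes the growth at the second cusp.
  have hord : meromorphicOrderAt R 0 = 0 := by
    rcases lt_trichotomy (meromorphicOrderAt R 0) 0 with h | h | h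
    · exfalso
      have h1 := tendsto_norm_atTop_iff_cobounded.mpr
        ((tendsto_cobounded_of_meromorphicOrderAt_neg h).comp hφl)
      exact not_tendsto_nhds_of_tendsto_atTop ((tendsto_pow_atTop (by norm_num)).comp h1) C hC'
    · exact h
    · exfalso
      have h1 := ((tendsto_zero_of_meromorphicOrderAt_pos h).comp hφl).norm.pow 24
      have := tendsto_nhds_unique h1 hC'
      simp at this
      exact hC0.ne this
  obtain ⟨c, hc0, hc⟩ := tendsto_ne_zero_of_meromorphicOrderAt_eq_zero hR hord
  have h1 : Tendsto (fun τ => ‖etaProduct N s (δ • τ)‖ ^ 24 *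
      Real.exp (2 * Real.pi * (0 * τ.im))) l (𝓝 (‖c‖ ^ 24)) := by
    refine ((hc.comp hψl).norm.pow 24).congr' ((hδ.filter_mono inf_le_right).mono fun τ hτ => ?_)
    beta_reduce
    rw [hτ, zero_mul, mul_zero, Real.exp_zero, mul_one, Function.comp_apply]
  exact eq_of_tendsto_mul_exp hl
    (fun τ => pow_ne_zero _ (norm_ne_zero_iff.mpr (etaProduct_ne_zero N s _)))
    hD0.ne' (pow_ne_zero _ (norm_ne_zero_iff.mpr hc0)) (hD.mono_left hl) h1

/-- These are products of powers of the functions `Δ(δτ)`. Congruences modulo 24 and the square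
condition are automatic, so they provide test functions. -/
lemma isModularFunction_etaProduct_of_dvd {N : ℕ} (hN : 0 < N) {s : ℕ → ℤ}
    (h0 : ∑ δ ∈ N.divisors, s δ = 0) (hs : ∀ δ, 24 ∣ s δ) :
    IsModularFunction N (etaProduct N s) := by
  refine isModularFunction_etaProduct hN h0 fun γ hγ τ => etaProduct_smul
    (Finset.dvd_sum fun δ _ => (hs δ).mul_right _) (Finset.dvd_sum fun δ _ => (hs δ).mul_right _)
    h0 ?_ hγ τ
  have hdiv : ∀ δ ∈ N.divisors, ((N / δ : ℕ) : ℚ) ≠ 0 := fun δ hδ => by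
    exact_mod_cast (Nat.div_pos (Nat.divisor_le hδ) (Nat.pos_of_mem_divisors hδ)).ne'
  refine ⟨∏ δ ∈ N.divisors, ((N / δ : ℕ) : ℚ) ^ (s δ / 2),
    Finset.prod_ne_zero_iff.mpr fun δ hδ => zpow_ne_zero _ (hdiv δ hδ), ?_⟩
  rw [← Finset.prod_pow]
  refine Finset.prod_congr rfl fun δ _ => ?_
  rw [← zpow_natCast, ← zpow_mul]
  congr 1
  have := hs δ
  push_cast
  omega

/-- The exponents `24 x`, `24 y`, `24 z` at the divisors `1`, `d`, `N`. -/
def threeTermExponent (N d : ℕ) (x y z : ℤ) (δ : ℕ) : ℤ :=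
  24 * ((if δ = 1 then x else 0) + (if δ = d then y else 0) + (if δ = N then z else 0))

lemma sum_threeTermExponent {N d : ℕ} (hd : d ∈ N.divisors) (x y z : ℤ) (u : ℕ → ℝ) :
    ∑ δ ∈ N.divisors, (threeTermExponent N d x y z δ : ℝ) * u δ =
      24 * (x * u 1 + y * u d + z * u N) := by
  have hN : N ≠ 0 := (Nat.mem_divisors.mp hd).2
  have h1 : 1 ∈ N.divisors := Nat.one_mem_divisors.mpr hN
  have h2 : N ∈ N.divisors := Nat.mem_divisors_self N hN
  have : ∀ δ, (threeTermExponent N d x y z δ : ℝ) * u δ =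
      24 * ((if δ = 1 then (x : ℝ) * u 1 else 0) + (if δ = d then y * u d else 0) +
        (if δ = N then z * u N else 0)) := by
    intro δ
    simp only [threeTermExponent]
    push_cast
    rw [mul_assoc, add_mul, add_mul]
    have h3 : ∀ (v : ℝ) (e : ℕ), (if δ = e then v else 0) * u δ = if δ = e then v * u e else 0 := by
      intro v e
      split_ifs with h
      · rw [h]
      · rw [zero_mul]
    rw [h3, h3, h3]
  simp_rw [this]
  rw [← Finset.mul_sum, Finset.sum_add_distrib, Finset.sum_add_distrib]
  simp [h1, h2, hd]

lemma etaOrder_threeTermExponent {N d : ℕ} (hd : d ∈ N.divisors) (x y z : ℤ) (c : ℤ) :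
    etaOrder N (threeTermExponent N d x y z) c =
      24 * (x + y * ((Int.gcd c d : ℝ) ^ 2 / d) + z * ((Int.gcd c N : ℝ) ^ 2 / N)) := by
  rw [etaOrder, sum_threeTermExponent hd x y z fun δ => (Int.gcd c δ : ℝ) ^ 2 / δ]
  simp

lemma sum_threeTermExponent_eq_zero {N d : ℕ} (hd : d ∈ N.divisors) {x y z : ℤ}
    (h : x + y + z = 0) : ∑ δ ∈ N.divisors, threeTermExponent N d x y z δ = 0 := by
  have h1 := sum_threeTermExponent hd x y z fun _ => 1
  simp only [mul_one] at h1
  have h2 : (x : ℝ) + y + z = 0 := by exact_mod_cast congrArg (Int.cast : ℤ → ℝ) h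
  rw [h2, mul_zero] at h1
  exact_mod_cast h1

/-- The matrix `(1 0; c 1)`. -/
def lowerUnipotent (c : ℤ) : SL(2, ℤ) := ⟨!![1, 0; c, 1], by simp⟩

lemma lowerUnipotent_one_zero (c : ℤ) : lowerUnipotent c 1 0 = c := by
  simp [lowerUnipotent]

/-- If the product vanishes at two cusps, every modular function is the same function of a parameter
tending to 0 at both. `T` will be the identity for common zeros and inversion, applied to the
reciprocal product, for common poles. -/
lemma etaOrder_eq_zero_of_forall_eq_div {N : ℕ} (hN : 0 < N) {r : ℕ → ℤ}
    (h0 : ∑ δ ∈ N.divisors, r δ = 0) {T : ℂ → ℂ} (hT : MeromorphicAt T 0)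
    (hgen : ∀ g : ℍ → ℂ, IsModularFunction N g → ∃ P Q : ℂ[X], Q ≠ 0 ∧ g =ᶠ[codiscrete ℍ]
      fun τ : ℍ => P.eval (T (etaProduct N r τ)) / Q.eval (T (etaProduct N r τ)))
    {c d : ℤ} (hc : 0 < etaOrder N r c) (hd : 0 < etaOrder N r d) {s : ℕ → ℤ}
    (hs0 : ∑ δ ∈ N.divisors, s δ = 0) (hs : ∀ δ, 24 ∣ s δ) (hsc : etaOrder N s c = 0) :
    etaOrder N s d = 0 := by
  obtain ⟨P, Q, -, hPQ⟩ := hgen _ (isModularFunction_etaProduct_of_dvd hN hs0 hs)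
  rw [← lowerUnipotent_one_zero c] at hc hsc
  rw [← lowerUnipotent_one_zero d] at hd ⊢
  exact etaOrder_eq_zero_of_eventually_eq hs0
    (R := fun z => P.eval (T z) / Q.eval (T z))
    ((hT.polynomial_eval P).fun_div (hT.polynomial_eval Q))
    (tendsto_etaProduct_smul_nhdsNE h0 hc) (tendsto_etaProduct_smul_nhdsNE h0 hd)
    ((tendsto_smul_codiscrete (lowerUnipotent c)).eventually hPQ)
    ((tendsto_smul_codiscrete (lowerUnipotent d)).eventually hPQ) hsc

/-- A pole at denominator `d` would be a second pole besides `∞`, a zero a second zero besides `0`;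
each is refuted by a test function of order zero at one of the two cusps only. -/
lemma etaOrder_eq_zero_of_generates {N : ℕ} (hN : 0 < N) {r : ℕ → ℤ}
    (h0 : ∑ δ ∈ N.divisors, r δ = 0) (h1 : 0 < etaOrder N r 1) (hinf : etaOrder N r N < 0)
    (hgen : ∀ g : ℍ → ℂ, IsModularFunction N g → ∃ P Q : ℂ[X], Q ≠ 0 ∧
      g =ᶠ[codiscrete ℍ] fun τ : ℍ => P.eval (etaProduct N r τ) / Q.eval (etaProduct N r τ))
    {d : ℕ} (hd : d ∈ N.divisors) (hd1 : d ≠ 1) (hdN : d ≠ N) : etaOrder N r d = 0 := by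
  have hd0 := Nat.pos_of_mem_divisors hd
  have hdlt : d < N := lt_of_le_of_ne (Nat.divisor_le hd) hdN
  have hdR : (0 : ℝ) < d := by exact_mod_cast hd0
  have hd1R : (1 : ℝ) < d := by exact_mod_cast (by omega : 1 < d)
  have hdNR : (d : ℝ) < N := by exact_mod_cast hdlt
  have hgcd : Int.gcd d N = d := by
    rw [Int.gcd_natCast_natCast, Nat.gcd_eq_left (Nat.dvd_of_mem_divisors hd)]
  have hgcd' : Int.gcd (N : ℤ) d = d := by rw [Int.gcd_comm, hgcd]
  rcases lt_trichotomy (etaOrder N r d) 0 with he | he | he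
  · exfalso
    -- The exponents solve, up to scaling, weight 0 and order 0 at `∞`. At denominator `d` the value
    -- of `etaOrder` is then `-24 (d - 1)(N² - d²) / N`, which is not zero.
    set s := threeTermExponent N d (N - d) (1 - N) (d - 1)
    have hs0 : ∑ δ ∈ N.divisors, s δ = 0 := sum_threeTermExponent_eq_zero hd (by ring)
    have hsN : etaOrder N s N = 0 := by
      rw [etaOrder_threeTermExponent hd, hgcd', Int.gcd_self, Int.natAbs_natCast]
      push_cast
      field_simp
      ring
    have h2 : etaOrder N s d = 0 := by
      refine etaOrder_eq_zero_of_forall_eq_div hN (r := -r) (by simp [h0])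
        (MeromorphicAt.id 0).inv (c := N) (fun g hg => ?_)
        (by rw [etaOrder_neg]; linarith) (by rw [etaOrder_neg]; linarith) hs0
        (fun δ => Dvd.intro _ rfl) hsN
      obtain ⟨P, Q, hQ, h⟩ := hgen g hg
      exact ⟨P, Q, hQ, by simpa [etaProduct_neg] using h⟩
    rw [etaOrder_threeTermExponent hd, hgcd, Int.gcd_self, Int.natAbs_natCast] at h2
    push_cast at h2
    field_simp at h2
    have h3 : ((d : ℝ) - 1) * ((N - d) * (N + d)) = 0 := by linear_combination -h2 / 24
    have h4 : 0 < ((d : ℝ) - 1) * ((N - d) * (N + d)) := by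
      have := sub_pos.mpr hd1R
      have := sub_pos.mpr hdNR
      positivity
    linarith
  · exact he
  · exfalso
    -- Now weight 0 and order 0 at the cusp `0`. At denominator `d` the value is `24 (d² - 1)(N -
    -- d)`, which is not zero.
    set s := threeTermExponent N d (d - N) (N * d - d) (N - N * d)
    have hs0 : ∑ δ ∈ N.divisors, s δ = 0 := sum_threeTermExponent_eq_zero hd (by ring)
    have hs1 : etaOrder N s 1 = 0 := by
      rw [etaOrder_threeTermExponent hd]
      simp
      field_simp
      ring
    have h2 : etaOrder N s d = 0 :=
      etaOrder_eq_zero_of_forall_eq_div hN h0 (MeromorphicAt.id 0) (c := 1) hgen h1 he hs0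
        (fun δ => Dvd.intro _ rfl) hs1
    rw [etaOrder_threeTermExponent hd, hgcd, Int.gcd_self, Int.natAbs_natCast] at h2
    push_cast at h2
    field_simp at h2
    have h3 : ((d : ℝ) - 1) * ((N - d) * (d + 1)) = 0 := by linear_combination h2 / 24
    have h4 : 0 < ((d : ℝ) - 1) * ((N - d) * (d + 1)) := by
      have := sub_pos.mpr hd1R
      have := sub_pos.mpr hdNR
      positivity
    linarith

/-- Growth at `i∞` is computed with the identity and with `(1 0; N 1)`, which lies in `Γ₀(N)`. The
exponential factors agree, so a power of `‖N τ + 1‖` with exponent `-12 ∑ r` has a finite nonzero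
limit. -/
lemma sum_eq_zero_of_smul {N : ℕ} (hN : 0 < N) {r : ℕ → ℤ}
    (hinv : ∀ γ ∈ CongruenceSubgroup.Gamma0 N, ∀ τ,
      etaProduct N r (γ • τ) = etaProduct N r τ) : ∑ δ ∈ N.divisors, r δ = 0 := by
  obtain ⟨C, hC0, hC⟩ := tendsto_norm_etaProduct_smul N r 1
  obtain ⟨D, hD0, hD⟩ := tendsto_norm_etaProduct_smul N r (lowerUnipotent N)
  have hmem : lowerUnipotent N ∈ CongruenceSubgroup.Gamma0 N := by
    rw [CongruenceSubgroup.Gamma0_mem]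
    simp [lowerUnipotent]
  have e : etaOrder N r ((lowerUnipotent N) 1 0) = etaOrder N r ((1 : SL(2, ℤ)) 1 0) := by
    simp [lowerUnipotent, etaOrder_zero]
  rw [e] at hD
  simp_rw [hinv _ hmem] at hD
  simp only [one_smul] at hC
  have h1 := hD.div hC hC0.ne'
  set X : ℍ → ℝ := fun τ => ‖(N : ℂ) * τ + 1‖
  have hX : Tendsto X atImInfty atTop := by
    have h2 : Tendsto (fun τ : ℍ => (N : ℝ) * τ.im) atImInfty atTop :=
      Tendsto.const_mul_atTop (by exact_mod_cast hN) tendsto_comap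
    refine tendsto_atTop_mono (fun τ => ?_) h2
    refine le_trans ?_ (Complex.im_le_norm _)
    simp
  have h3 : Tendsto (fun τ => X τ ^ (-12 * ∑ δ ∈ N.divisors, r δ)) atImInfty (𝓝 (D / C)) := by
    refine h1.congr fun τ => ?_
    have : ‖etaProduct N r τ‖ ≠ 0 := norm_ne_zero_iff.mpr (etaProduct_ne_zero N r τ)
    have := Real.exp_pos (2 * Real.pi * (etaOrder N r ((1 : SL(2, ℤ)) 1 0) * τ.im))
    simp only [Pi.div_apply]
    rw [mul_div_mul_comm, div_self (by positivity)]
    simp [lowerUnipotent, X]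
  rcases lt_trichotomy (-12 * ∑ δ ∈ N.divisors, r δ) 0 with h | h | h
  · have := tendsto_nhds_unique h3 ((tendsto_zpow_atTop_zero h).comp hX)
    exact absurd this (div_pos hD0 hC0).ne'
  · omega
  · exact absurd h3 (not_tendsto_nhds_of_tendsto_atTop ((tendsto_zpow_atTop_atTop h).comp hX) _)

/-- Invariance off a discrete set extends by continuity and forces weight 0. The growth rates read
off from `1/q + O(1)` and from the simple zero must equal those of the eta product, which gives the
orders at `∞` and `0`. -/
theorem conditions_of_isHauptmodul {N : ℕ} (hN : 0 < N) {r : ℕ → ℤ}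
    (h : IsHauptmodul N (etaProduct N r)) (hz : HasSimpleZeroAtCuspZero N (etaProduct N r)) :
    LinearConditions N r ∧ SquareCondition N r := by
  have hne : ∀ τ, ‖etaProduct N r τ‖ ^ 24 ≠ 0 := fun τ =>
    pow_ne_zero _ (norm_ne_zero_iff.mpr (etaProduct_ne_zero N r _))
  have hmd := mdifferentiable_etaProduct N r
  have hinv : ∀ γ ∈ CongruenceSubgroup.Gamma0 N, ∀ τ,
      etaProduct N r (γ • τ) = etaProduct N r τ := fun γ hγ =>
    congrFun (eq_of_eventuallyEq_codiscrete (mdifferentiable_comp_smul hmd γ).continuous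
      hmd.continuous (h.modular.invariant γ hγ))
  have h0 := sum_eq_zero_of_smul hN hinv
  have ha : etaOrder N r N = -24 := by
    obtain ⟨C, hC0, hC⟩ := tendsto_norm_etaProduct_smul_of_sum_eq_zero h0 1
    have h1 : Tendsto (fun τ : ℍ => 𝕢 1 τ * (etaProduct N r τ - (𝕢 1 (τ : ℂ))⁻¹)) atImInfty
        (𝓝 0) := by
      have h2 : (fun τ : ℍ => etaProduct N r τ - (𝕢 1 (τ : ℂ))⁻¹) =O[atImInfty] (1 : ℍ → ℝ) :=
        h.qExpansion
      have := (Asymptotics.isBigO_refl (fun τ : ℍ => 𝕢 1 (τ : ℂ)) atImInfty).norm_right.mul h2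
      refine this.trans_tendsto ?_
      simpa using (qParam_tendsto_atImInfty one_pos).norm
    have h2 : Tendsto (fun τ : ℍ => ‖etaProduct N r τ‖ ^ 24 *
        Real.exp (2 * Real.pi * (-24 * τ.im))) atImInfty (𝓝 1) := by
      have h3 := ((h1.add_const 1).norm.pow 24)
      rw [zero_add, norm_one, one_pow] at h3
      refine h3.congr fun τ => ?_
      have h4 := norm_qParam_zpow_mul_pow one_pos 1 τ (etaProduct N r τ)
      have h5 : 𝕢 1 (τ : ℂ) ≠ 0 := Function.Periodic.qParam_ne_zero _
      rw [mul_sub, mul_inv_cancel₀ h5, sub_add_cancel]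
      simpa using h4
    simp only [one_smul] at hC
    have := eq_of_tendsto_mul_exp le_rfl hne hC0.ne' one_ne_zero hC h2
    simpa [etaOrder_zero] using this
  have hb : N * etaOrder N r 1 = 24 := by
    have hN' : (N : ℝ) ≠ 0 := by exact_mod_cast hN.ne'
    obtain ⟨C, hC0, hC⟩ := tendsto_norm_etaProduct_smul_of_sum_eq_zero h0 ModularGroup.S
    obtain ⟨F, hF, hF1, hFe⟩ := hz
    obtain ⟨G, hG, hG0, hFG⟩ := (meromorphicOrderAt_eq_int_iff (n := 1) hF).mp hF1
    have hq : Tendsto (fun τ : ℍ => 𝕢 N (τ : ℂ)) atImInfty (𝓝[≠] 0) :=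
      (Function.Periodic.qParam_tendsto (by exact_mod_cast hN)).comp tendsto_coe_atImInfty
    have h2 : Tendsto (fun τ : ℍ => ‖etaProduct N r (ModularGroup.S • τ)‖ ^ 24 *
        Real.exp (2 * Real.pi * (24 / N * τ.im))) atImInfty (𝓝 (‖G 0‖ ^ 24)) := by
      have h3 := ((hG.continuousAt.tendsto.comp
        (hq.mono_right nhdsWithin_le_nhds)).norm.pow 24)
      refine h3.congr' ?_
      filter_upwards [hFe, hq.eventually hFG] with τ h4 h5
      have h6 := norm_qParam_zpow_mul_pow hN (-1) τ (etaProduct N r (ModularGroup.S • τ))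
      have h7 : 𝕢 N (τ : ℂ) ≠ 0 := Function.Periodic.qParam_ne_zero _
      have h8 : 𝕢 N (τ : ℂ) ^ (-1 : ℤ) * etaProduct N r (ModularGroup.S • τ) = G (𝕢 N τ) := by
        rw [h4, h5, sub_zero, zpow_one, zpow_neg_one, smul_eq_mul, inv_mul_cancel_left₀ h7]
      rw [h8] at h6
      rw [Function.comp_apply, h6]
      congr 3
      push_cast
      ring
    have h3 := eq_of_tendsto_mul_exp le_rfl (fun τ => hne _) hC0.ne'
      (pow_ne_zero _ (norm_ne_zero_iff.mpr hG0)) hC h2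
    have h4 : etaOrder N r 1 = 24 / N := by simpa [ModularGroup.S] using h3
    rw [h4]
    field_simp
  have ha' : ∑ δ ∈ N.divisors, r δ * (δ : ℤ) = -24 := by
    rw [etaOrder_level] at ha
    exact_mod_cast ha
  have hb' : ∑ δ ∈ N.divisors, r δ * ((N / δ : ℕ) : ℤ) = 24 := by
    rw [natCast_mul_etaOrder_one] at hb
    exact_mod_cast hb
  refine ⟨⟨ha', hb', h0, fun d hd hd1 hdN => ?_⟩,
    squareCondition_of_smul hN (by rw [ha']; decide) (by rw [hb']) h0 hinv⟩
  rw [← etaOrder_natCast_eq_zero_iff r hd]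
  refine etaOrder_eq_zero_of_generates hN h0 ?_ (by rw [ha]; norm_num) h.generates hd hd1 hdN
  have hN' : (0 : ℝ) < N := by exact_mod_cast hN
  exact pos_of_mul_pos_right (hb ▸ by norm_num) hN'.le

end ModularForm

/-! ### The table of levels -/

lemma Nat.divisors_tableLevels :
    divisors 2 = {1, 2} ∧ divisors 3 = {1, 3} ∧ divisors 4 = {1, 2, 4} ∧ divisors 5 = {1, 5} ∧
    divisors 6 = {1, 2, 3, 6} ∧ divisors 7 = {1, 7} ∧ divisors 8 = {1, 2, 4, 8} ∧
    divisors 9 = {1, 3, 9} ∧ divisors 10 = {1, 2, 5, 10} ∧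
    divisors 12 = {1, 2, 3, 4, 6, 12} ∧ divisors 13 = {1, 13} ∧
    divisors 16 = {1, 2, 4, 8, 16} ∧ divisors 18 = {1, 2, 3, 6, 9, 18} ∧
    divisors 25 = {1, 5, 25} := by decide

lemma tableExponent_values :
    tableExponent 2 1 = 24 ∧ tableExponent 2 2 = -24 ∧ tableExponent 3 1 = 12 ∧
    tableExponent 3 3 = -12 ∧ tableExponent 4 1 = 8 ∧ tableExponent 4 2 = 0 ∧
    tableExponent 4 4 = -8 ∧ tableExponent 5 1 = 6 ∧ tableExponent 5 5 = -6 ∧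
    tableExponent 6 1 = 5 ∧ tableExponent 6 2 = -1 ∧ tableExponent 6 3 = 1 ∧
    tableExponent 6 6 = -5 ∧ tableExponent 7 1 = 4 ∧ tableExponent 7 7 = -4 ∧
    tableExponent 8 1 = 4 ∧ tableExponent 8 2 = -2 ∧ tableExponent 8 4 = 2 ∧
    tableExponent 8 8 = -4 ∧ tableExponent 9 1 = 3 ∧ tableExponent 9 3 = 0 ∧
    tableExponent 9 9 = -3 ∧ tableExponent 10 1 = 3 ∧ tableExponent 10 2 = -1 ∧
    tableExponent 10 5 = 1 ∧ tableExponent 10 10 = -3 ∧ tableExponent 12 1 = 3 ∧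
    tableExponent 12 2 = -2 ∧ tableExponent 12 3 = -1 ∧ tableExponent 12 4 = 1 ∧
    tableExponent 12 6 = 2 ∧ tableExponent 12 12 = -3 ∧ tableExponent 13 1 = 2 ∧
    tableExponent 13 13 = -2 ∧ tableExponent 16 1 = 2 ∧ tableExponent 16 2 = -1 ∧
    tableExponent 16 4 = 0 ∧ tableExponent 16 8 = 1 ∧ tableExponent 16 16 = -2 ∧
    tableExponent 18 1 = 2 ∧ tableExponent 18 2 = -1 ∧ tableExponent 18 3 = -1 ∧
    tableExponent 18 6 = 1 ∧ tableExponent 18 9 = 1 ∧ tableExponent 18 18 = -2 ∧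
    tableExponent 25 1 = 1 ∧ tableExponent 25 5 = 0 ∧ tableExponent 25 25 = -1 := by
  and_intros <;> rfl

/-- Dividing (e) by its nonzero prefactor and multiplying by `N` leaves linear equations over `ℤ`,
within reach of `omega`. -/
lemma linearConditions_iff {N : ℕ} (r : ℕ → ℤ) :
    LinearConditions N r ↔ (∑ δ ∈ N.divisors, r δ * (δ : ℤ) = -24) ∧
      (∑ δ ∈ N.divisors, r δ * ((N / δ : ℕ) : ℤ) = 24) ∧ (∑ δ ∈ N.divisors, r δ = 0) ∧
      ∀ d ∈ N.divisors, d ≠ 1 → d ≠ N →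
        ∑ δ ∈ N.divisors, r δ * ((Nat.gcd δ d ^ 2 * (N / δ) : ℕ) : ℤ) = 0 := by
  have key : ∀ d ∈ N.divisors, (((N / d : ℕ) : ℚ) * (Nat.gcd d (N / d) : ℚ) *
      ∑ δ ∈ N.divisors, (r δ : ℚ) * (Nat.gcd δ d : ℚ) ^ 2 / (δ : ℚ) = 0 ↔
      ∑ δ ∈ N.divisors, r δ * ((Nat.gcd δ d ^ 2 * (N / δ) : ℕ) : ℤ) = 0) := by
    intro d hd
    have hN : (N : ℚ) ≠ 0 := by exact_mod_cast (Nat.mem_divisors.mp hd).2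
    have h1 : ((N / d : ℕ) : ℚ) ≠ 0 := by
      exact_mod_cast (Nat.div_pos (Nat.divisor_le hd) (Nat.pos_of_mem_divisors hd)).ne'
    have h2 : (Nat.gcd d (N / d) : ℚ) ≠ 0 := by
      exact_mod_cast (Nat.gcd_pos_of_pos_left _ (Nat.pos_of_mem_divisors hd)).ne'
    have h3 : ((∑ δ ∈ N.divisors, r δ * ((Nat.gcd δ d ^ 2 * (N / δ) : ℕ) : ℤ) : ℤ) : ℚ) =
        N * ∑ δ ∈ N.divisors, (r δ : ℚ) * (Nat.gcd δ d : ℚ) ^ 2 / (δ : ℚ) := by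
      rw [Finset.mul_sum]
      simp only [Int.cast_sum, Int.cast_mul, Int.cast_natCast, Nat.cast_mul, Nat.cast_pow]
      refine Finset.sum_congr rfl fun δ hδ => ?_
      have hδ0 : (δ : ℚ) ≠ 0 := by exact_mod_cast (Nat.pos_of_mem_divisors hδ).ne'
      rw [Nat.cast_div (Nat.dvd_of_mem_divisors hδ) hδ0]
      push_cast
      field_simp
    rw [← Int.cast_inj (α := ℚ), h3, Int.cast_zero, mul_eq_zero, mul_eq_zero, mul_eq_zero]
    simp only [h1, h2, hN, false_or]
  exact ⟨fun h => ⟨h.1, h.2, h.3, fun d hd h1 h2 => (key d hd).mp (h.4 d hd h1 h2)⟩,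
    fun h => ⟨h.1, h.2.1, h.2.2.1, fun d hd h1 h2 => (key d hd).mpr (h.2.2.2 d hd h1 h2)⟩⟩

set_option maxHeartbeats 1000000 in
lemma linearConditions_iff_tableExponent {N : ℕ} (hN : N ∈ tableLevels) (r : ℕ → ℤ) :
    LinearConditions N r ↔ ∀ δ ∈ N.divisors, r δ = tableExponent N δ := by
  rw [linearConditions_iff]
  obtain ⟨h2, h3, h4, h5, h6, h7, h8, h9, h10, h12, h13, h16, h18, h25⟩ :=
    Nat.divisors_tableLevels
  simp only [tableLevels, Finset.mem_insert, Finset.mem_singleton] at hN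
  rcases hN with rfl | rfl | rfl | rfl | rfl | rfl | rfl | rfl | rfl | rfl | rfl | rfl | rfl | rfl
  all_goals
    simp only [h2, h3, h4, h5, h6, h7, h8, h9, h10, h12, h13, h16, h18, h25]
    simp [tableExponent_values]
    omega

lemma squareCondition_tableExponent {N : ℕ} (hN : N ∈ tableLevels) :
    SquareCondition N (tableExponent N) := by
  obtain ⟨h2, h3, h4, h5, h6, h7, h8, h9, h10, h12, h13, h16, h18, h25⟩ :=
    Nat.divisors_tableLevels
  simp only [tableLevels, Finset.mem_insert, Finset.mem_singleton] at hN
  unfold SquareCondition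
  rcases hN with rfl | rfl | rfl | rfl | rfl | rfl | rfl | rfl | rfl | rfl | rfl | rfl | rfl | rfl
  -- Each witness is the positive square root of the product for its level.
  · exact ⟨2 ^ 12, by norm_num, by rw [h2]; norm_num [tableExponent_values]⟩
  · exact ⟨3 ^ 6, by norm_num, by rw [h3]; norm_num [tableExponent_values]⟩
  · exact ⟨4 ^ 4, by norm_num, by rw [h4]; norm_num [tableExponent_values]⟩
  · exact ⟨5 ^ 3, by norm_num, by rw [h5]; norm_num [tableExponent_values]⟩
  · exact ⟨72, by norm_num, by rw [h6]; norm_num [tableExponent_values]⟩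
  · exact ⟨7 ^ 2, by norm_num, by rw [h7]; norm_num [tableExponent_values]⟩
  · exact ⟨32, by norm_num, by rw [h8]; norm_num [tableExponent_values]⟩
  · exact ⟨27, by norm_num, by rw [h9]; norm_num [tableExponent_values]⟩
  · exact ⟨20, by norm_num, by rw [h10]; norm_num [tableExponent_values]⟩
  · exact ⟨12, by norm_num, by rw [h12]; norm_num [tableExponent_values]⟩
  · exact ⟨13, by norm_num, by rw [h13]; norm_num [tableExponent_values]⟩
  · exact ⟨8, by norm_num, by rw [h16]; norm_num [tableExponent_values]⟩
  · exact ⟨6, by norm_num, by rw [h18]; norm_num [tableExponent_values]⟩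
  · exact ⟨5, by norm_num, by rw [h25]; norm_num [tableExponent_values]⟩

theorem proposition3p3 :
    (∀ (N : ℕ), 0 < N → ∀ r : ℕ → ℤ,
      (IsHauptmodul N (etaProduct N r) ∧ HasSimpleZeroAtCuspZero N (etaProduct N r)) ↔
        (LinearConditions N r ∧ SquareCondition N r)) ∧
    (∀ N ∈ tableLevels,
      (∀ r : ℕ → ℤ, LinearConditions N r ↔ ∀ δ ∈ N.divisors, r δ = tableExponent N δ) ∧
      SquareCondition N (tableExponent N) ∧
      IsHauptmodul N (etaProduct N (tableExponent N)) ∧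
      HasSimpleZeroAtCuspZero N (etaProduct N (tableExponent N))) := by
  refine ⟨fun N hN r => ⟨fun h => ModularForm.conditions_of_isHauptmodul hN h.1 h.2,
    fun h => ModularForm.isHauptmodul_etaProduct hN h.1 h.2⟩, fun N hN => ?_⟩
  have hpos : 0 < N := by
    rw [tableLevels] at hN
    revert N
    decide
  exact ⟨linearConditions_iff_tableExponent hN, squareCondition_tableExponent hN,
    ModularForm.isHauptmodul_etaProduct hpos
      ((linearConditions_iff_tableExponent hN _).mpr fun _ _ => rfl)
      (squareCondition_tableExponent hN)⟩
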